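/- Let $n\ge 1$, let $\mathbb T^n=\mathbb R^n/\mathbb Z^n$ be the flat torus with distance $d(x,y)=\inf_{k\in\mathbb Z^n}|x-y-k|$, and let $f:\mathbb T^n\times\mathbb T^n\to\mathbb R$ be $C^2$. For probability measures $\mu,\nu$ on $\mathbb T^n$ put $$F(\mu,\nu)=\iint f(x,y)\,d\mu(x)\,d\nu(y)+H(\mu)-H(\nu),$$ where $H(\mu)=\int\log\bigl(\tfrac{d\mu}{dx}\bigr)\,d\mu$ if $\mu\ll dx$ and $H(\mu)=\infty$ otherwise. Let $(\mu^*,\nu^*)$ be the unique mixed Nash equilibrium, i.e. $F(\mu^*,\nu)\le F(\mu^*,\nu^*)\le F(\mu,\nu^*)$ for all probability measures $\mu,\nu$. Write $V_{\nu^*}(x)=\int f(x,y)\,d\nu^*(y)$, $U_{\mu^*}(y)=\int f(x,y)\,d\mu^*(x)$, and let $\lambda_{\mathrm{gap}}=\lambda_{\mathrm{gap}}(f)$ be the smaller of $$\inf_{\phi\in W^{2,2}(\mathbb T^n),\ \nabla\phi\ne0}\frac{\int\bigl(|\nabla^2\phi|^2+\langle\nabla\phi,\nabla^2V_{\nu^*}\nabla\phi\rangle\bigr)\,d\mu^*}{\int|\nabla\phi|^2\,d\mu^*}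 \quad\text{and}\quad \inf_{\psi\in W^{2,2}(\mathbb T^n),\ \nabla\psi\ne0}\frac{\int\bigl(|\nabla^2\psi|^2-\langle\nabla\psi,\nabla^2U_{\mu^*}\nabla\psi\rangle\bigr)\,d\nu^*}{\int|\nabla\psi|^2\,d\nu^*}.$$ Then $\lambda_{\mathrm{gap}}>0$, and for every $\eta>0$ and every real $p>n$ there is $\delta>0$, depending only on $f$, $p$ and $\eta$, with the following property. Let $\mu=(T_{\mu^*\to\mu})_\#\mu^*$ and $\nu=(T_{\nu^*\to\nu})_\#\nu^*$, where $T_{\mu^*\to\mu}$ and $T_{\nu^*\to\nu}$ are optimal transport maps for the cost $d^2$ with $$\|T_{\mu^*\to\mu}-\mathrm{id}\|_{W^{2,p}}\le\delta,\qquad \|T_{\nu^*\to\nu}-\mathrm{id}\|_{W^{2,p}}\le\delta$$ (that is, each map has almost everywhere the form $x\mapsto x+u(x)$ modulo $\mathbb Z^n$ with $u:\mathbb T^n\to\mathbb R^n$ and $\|u\|_{W^{2,p}}\le\delta$). Then for all $\phi,\psi:\mathbb T^n\to\mathbb R$ with $\nabla\phi,\nabla\psi\in W^{2,p}(\mathbb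 T^n)$ the following second derivatives exist and satisfy $$\frac{d^2}{dt^2}\Big|_{t=0}F\bigl((\mathrm{id}+t\nabla\phi)_\#\mu,\nu\bigr)\ \ge\ (1-\eta)\,\lambda_{\mathrm{gap}}\int|\nabla\phi|^2\,d\mu,$$ $$\frac{d^2}{dt^2}\Big|_{t=0}F\bigl(\mu,(\mathrm{id}+t\nabla\psi)_\#\nu\bigr)\ \le\ -(1-\eta)\,\lambda_{\mathrm{gap}}\int|\nabla\psi|^2\,d\nu.$$ -/

import Mathlib

open MeasureTheory Filter Topology

noncomputable section

/-- The Euclidean space `ℝⁿ`. -/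
abbrev Euc (n : ℕ) : Type := EuclideanSpace ℝ (Fin n)

/-- The flat torus `𝕋ⁿ = ℝⁿ / ℤⁿ`; its `volume` is Lebesgue measure, of total mass one. -/
abbrev Torus (n : ℕ) : Type := UnitAddTorus (Fin n)

/-- The quotient map `ℝⁿ → 𝕋ⁿ`. -/
def toTorus {n : ℕ} (v : Euc n) : Torus n := fun i => (v i : UnitAddCircle)

/-- The flat distance `inf_{k ∈ ℤⁿ} |x - y - k|`: the least length of a representative of `x - y`. -/
def torusDist {n : ℕ} (x y : Torus n) : ℝ :=
  ⨅ v : {v : Euc n // toTorus v = x - y}, ‖(v : Euc n)‖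

/-! ### Derivatives and Sobolev spaces on the torus -/

/-- `g ∈ C^∞(𝕋ⁿ)`. -/
def TorusSmooth {n : ℕ} (g : Torus n → ℝ) : Prop :=
  ContDiff ℝ ((⊤ : ℕ∞) : WithTop ℕ∞) (fun v : Euc n => g (toTorus v))

/-- The classical partial derivative `∂ᵢ g`. -/
def torusPartial {n : ℕ} (i : Fin n) (g : Torus n → ℝ) (x : Torus n) : ℝ :=
  deriv (fun t : ℝ => g (x + toTorus (EuclideanSpace.single i t))) 0

/-- The classical derivative `D^α g`, for a multi-index `α`. -/
def multiDeriv {n : ℕ} (α : Fin n → ℕ) (g : Torus n → ℝ) : Torus n → ℝ :=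
  (List.finRange n).foldr (fun i h => (torusPartial i)^[α i] h) g

/-- `v` is a weak derivative `D^α u` of `u`; `u` may be scalar- or vector-valued. -/
def HasWeakDeriv {n : ℕ} {G : Type*} [NormedAddCommGroup G] [NormedSpace ℝ G]
    (α : Fin n → ℕ) (u v : Torus n → G) : Prop :=
  Integrable u ∧ Integrable v ∧ ∀ g : Torus n → ℝ, TorusSmooth g →
    ∫ x, multiDeriv α g x • u x = (-1 : ℝ) ^ (∑ i, α i) • ∫ x, g x • v x

open scoped Classical in
/-- The weak derivative `D^α u` (unique up to null sets when it exists, and `0` otherwise). -/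
def weakDeriv {n : ℕ} {G : Type*} [NormedAddCommGroup G] [NormedSpace ℝ G]
    (α : Fin n → ℕ) (u : Torus n → G) : Torus n → G :=
  if h : ∃ v, HasWeakDeriv α u v then h.choose else 0

/-- The multi-indices `α ∈ ℕⁿ` with `|α| ≤ k`. -/
def multiIndices (n k : ℕ) : Finset (Fin n → ℕ) :=
  (Fintype.piFinset fun _ => Finset.range (k + 1)).filter fun α => ∑ i, α i ≤ k

/-- `u ∈ W^{k,p}(𝕋ⁿ)`. -/
def MemSobolev {n : ℕ} {G : Type*} [NormedAddCommGroup G] [NormedSpace ℝ G]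
    (k : ℕ) (p : ℝ) (u : Torus n → G) : Prop :=
  ∀ α ∈ multiIndices n k, ∃ v, HasWeakDeriv α u v ∧ MemLp v (ENNReal.ofReal p)

/-- The norm `‖u‖_{W^{k,p}} = (∑_{|α| ≤ k} ∫ |D^α u|^p dx)^{1/p}` of `u ∈ W^{k,p}(𝕋ⁿ)`. -/
def sobolevNorm {n : ℕ} {G : Type*} [NormedAddCommGroup G] [NormedSpace ℝ G]
    (k : ℕ) (p : ℝ) (u : Torus n → G) : ℝ :=
  (∑ α ∈ multiIndices n k, ∫ x, ‖weakDeriv α u x‖ ^ p) ^ (1 / p)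

/-- `Φ = ∇φ` in the weak sense. -/
def IsWeakGradient {n : ℕ} (φ : Torus n → ℝ) (Φ : Torus n → Euc n) : Prop :=
  ∀ i, HasWeakDeriv (Pi.single i 1) φ (fun x => Φ x i)

/-! ### The functional and its mixed Nash equilibria -/

open scoped Classical in
/-- `H(μ) = ∫ log (dμ/dx) dμ` if `μ ≪ dx`, and `∞` otherwise. As `r log r` is bounded below, the
integral is `∞` whenever the integrand is not integrable. -/
def entropy {n : ℕ} (μ : Measure (Torus n)) : EReal :=
  if μ ≪ volume ∧ Integrable (fun x => Real.log (μ.rnDeriv volume x).toReal) μ then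
    ((∫ x, Real.log (μ.rnDeriv volume x).toReal ∂μ : ℝ) : EReal)
  else ⊤

/-- `F(μ, ν) = ∬ f(x, y) dμ(x) dν(y) + H(μ) - H(ν)`. -/
def payoff {n : ℕ} (f : Torus n → Torus n → ℝ) (μ ν : Measure (Torus n)) : EReal :=
  ((∫ x, ∫ y, f x y ∂ν ∂μ : ℝ) : EReal) + entropy μ - entropy ν

/-- `(μ, ν)` is a mixed Nash equilibrium. -/
def IsMNE {n : ℕ} (f : Torus n → Torus n → ℝ) (μ ν : Measure (Torus n)) : Prop :=
  IsProbabilityMeasure μ ∧ IsProbabilityMeasure ν ∧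
    (∀ ν' : Measure (Torus n), IsProbabilityMeasure ν' → payoff f μ ν' ≤ payoff f μ ν) ∧
    (∀ μ' : Measure (Torus n), IsProbabilityMeasure μ' → payoff f μ ν ≤ payoff f μ' ν)

/-! ### The spectral gap -/

/-- The quadratic form `∫ (|∇²φ|² + ⟨∇φ, ∇²W ∇φ⟩) dm`, for `φ ∈ W^{2,2}` and `W ∈ C²`. -/
def hessianForm {n : ℕ} (m : Measure (Torus n)) (W φ : Torus n → ℝ) : ℝ :=
  ∫ x, ((∑ i, ∑ j, weakDeriv (Pi.single i 1 + Pi.single j 1) φ x ^ 2) +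
    ∑ i, ∑ j, torusPartial i (torusPartial j W) x *
      weakDeriv (Pi.single i 1) φ x * weakDeriv (Pi.single j 1) φ x) ∂m

/-- The infimum over all `φ ∈ W^{2,2}` with `∇φ ≠ 0` of the Rayleigh quotient
`∫ (|∇²φ|² + ⟨∇φ, ∇²W ∇φ⟩) dm / ∫ |∇φ|² dm`. -/
def rayleighInf {n : ℕ} (m : Measure (Torus n)) (W : Torus n → ℝ) : ℝ :=
  sInf {r : ℝ | ∃ φ : Torus n → ℝ, MemSobolev 2 2 φ ∧
    (∃ i, ¬ weakDeriv (Pi.single i 1) φ =ᵐ[volume] 0) ∧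
    r = hessianForm m W φ / ∫ x, ∑ i, weakDeriv (Pi.single i 1) φ x ^ 2 ∂m}

/-- The spectral gap `λ_gap` at `(μ, ν)`: the smaller of the two Rayleigh infima, for `μ` with the
potential `x ↦ ∫ f(x, y) dν(y)` and for `ν` with the potential `y ↦ - ∫ f(x, y) dμ(x)`. -/
def spectralGap {n : ℕ} (f : Torus n → Torus n → ℝ) (μ ν : Measure (Torus n)) : ℝ :=
  min (rayleighInf μ fun x => ∫ y, f x y ∂ν) (rayleighInf ν fun y => -∫ x, f x y ∂μ)

/-! ### Optimal maps and second variations -/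

/-- The squared Wasserstein distance `W₂(μ, ν)²`. -/
def wassersteinSq {n : ℕ} (μ ν : Measure (Torus n)) : ENNReal :=
  ⨅ π ∈ {π : Measure (Torus n × Torus n) | π.map Prod.fst = μ ∧ π.map Prod.snd = ν},
    ∫⁻ z, ENNReal.ofReal (torusDist z.1 z.2 ^ 2) ∂π

/-- `T` is an optimal transport map from `μ` to `ν`. -/
def IsOptimalMap {n : ℕ} (μ ν : Measure (Torus n)) (T : Torus n → Torus n) : Prop :=
  Measurable T ∧ μ.map T = ν ∧
    ∫⁻ x, ENNReal.ofReal (torusDist x (T x) ^ 2) ∂μ = wassersteinSq μ ν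

/-- `‖T - id‖_{W^{2,p}} ≤ δ` for a map `T : 𝕋ⁿ → 𝕋ⁿ` given up to `m`-null sets: `T(x) = x + u(x)`
modulo `ℤⁿ` for a displacement `u : 𝕋ⁿ → ℝⁿ` with `‖u‖_{W^{2,p}} ≤ δ`. -/
def SobolevCloseToId {n : ℕ} (p δ : ℝ) (m : Measure (Torus n)) (T : Torus n → Torus n) : Prop :=
  ∃ u : Torus n → Euc n, (∀ᵐ x ∂m, T x = x + toTorus (u x)) ∧
    MemSobolev 2 p u ∧ sobolevNorm 2 p u ≤ δ

/-- The push-forward `(id + t Φ)_# μ`. -/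
def pushAlong {n : ℕ} (μ : Measure (Torus n)) (Φ : Torus n → Euc n) (t : ℝ) : Measure (Torus n) :=
  μ.map fun x => x + toTorus (t • Φ x)

/-- Near `t = 0` the function `G` is finite and differentiable, and its derivative is differentiable
at `0` with `d²/dt²|_{t=0} G(t) = D`. -/
def HasSecondDerivAtZero (G : ℝ → EReal) (D : ℝ) : Prop :=
  ∃ g g' : ℝ → ℝ, (∀ᶠ t in 𝓝 (0 : ℝ), G t = (g t : EReal)) ∧
    (∀ᶠ t in 𝓝 (0 : ℝ), HasDerivAt g (g' t) t) ∧ HasDerivAt g' D 0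

end

/-! With the opponent held at `ν`, the first player's payoff is, up to a constant, the free energy
`∫ V dμ + H(μ)` with potential `V(x) = ∫ f(x, y) dν(y)`. It equals `KL(μ | e^{-V} dx / Z)` up to a
constant, so each equilibrium measure is the Gibbs measure of its own potential (`IsMNE.eq_gibbs`).
The second player is the first player of the game `(y, x) ↦ -f(x, y)`, so everything is proved for
one player and used twice.

Second variation. By the change of variables formula, pushing `μ` along `id + tΦ` changes the
entropy by `-∫ log det(1 + t DΦ) dμ`. Hence the second derivative of the free energy at `t = 0` is
`∫ (tr (DΦ)² + ⟨Φ, ∇²V Φ⟩) dμ` (`exists_secondVariation`). For a gradient `Φ = ∇φ` the matrix `DΦ`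
is symmetric and the trace is `|∇²φ|²`, so at equilibrium this is exactly the quadratic form in the
definition of the spectral gap.

Positivity of the gap. By Bochner's identity the quadratic form equals `∫ (Lφ)² dμ*` for the
generator `Lφ = Δφ - ⟨∇V, ∇φ⟩` (`bochner_pair`), while `∫ |∇φ|² dμ* = -∫ (φ - c) Lφ dμ*`. The
Poincaré inequality on the torus survives the bounded weight `e^{-V}`, and Young's inequality then
bounds the Rayleigh quotient below by `(n e^{2B})⁻¹` with `B = sup |f|`. Mollification carries this
from smooth `φ` to `W^{2,2}`. The bound depends on `f` and `n` alone, which is what allows `δ` to be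
chosen before the equilibrium is known.

Stability. Since `p > n`, Morrey's inequality embeds `W^{2,p}` in `C¹`, so both transport maps agree
almost everywhere with maps `id + U` whose `U` is small in `C¹`. Such a map changes the Gibbs
measure only by a factor close to one (`measureClose_gibbs`), and moving the opponent's measure
changes `∇²V` by little, uniformly, because `∇²f` is uniformly continuous. The form need not have a
nonnegative integrand, so a multiple of `|Φ|²` is added before the measures are compared and
subtracted afterwards (`le_secondVariation`). The resulting losses are small multiples of the gap
and are absorbed in the factor `1 - η`. -/

noncomputable section

/-! ### The torus as a quotient of Euclidean space -/

section TorusBasics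

variable {n : ℕ}

theorem toTorus_add (v w : Euc n) : toTorus (v + w) = toTorus v + toTorus w := by
  funext i; simp [toTorus]

theorem toTorus_zero : toTorus (0 : Euc n) = 0 := by
  funext i; simp [toTorus]

theorem toTorus_neg (v : Euc n) : toTorus (-v) = -toTorus v := by
  funext i; simp [toTorus]

theorem toTorus_sub (v w : Euc n) : toTorus (v - w) = toTorus v - toTorus w := by
  rw [sub_eq_add_neg, toTorus_add, toTorus_neg, sub_eq_add_neg]

theorem continuous_toTorus : Continuous (toTorus : Euc n → Torus n) := by
  unfold toTorus
  refine continuous_pi fun i => ?_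
  exact (AddCircle.continuous_mk' 1).comp (by fun_prop)

theorem toTorus_surjective : Function.Surjective (toTorus : Euc n → Torus n) := by
  intro x
  choose v hv using fun i => QuotientAddGroup.mk_surjective (x i)
  exact ⟨WithLp.toLp 2 v, funext fun i => hv i⟩

theorem isOpenQuotientMap_toTorus : IsOpenQuotientMap (toTorus : Euc n → Torus n) := by
  refine ⟨toTorus_surjective, continuous_toTorus, ?_⟩
  have h1 : IsOpenMap (fun v : Fin n → ℝ => (fun i => (v i : UnitAddCircle) : Torus n)) := by
    exact IsOpenMap.piMap (fun i => QuotientAddGroup.isOpenMap_coe) (by simp)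
  exact h1.comp (EuclideanSpace.equiv (Fin n) ℝ).toHomeomorph.isOpenMap

instance isProbabilityMeasure_unitAddCircle :
    IsProbabilityMeasure (volume : Measure UnitAddCircle) := ⟨by simp⟩

instance isProbabilityMeasure_torus : IsProbabilityMeasure (volume : Measure (Torus n)) := by
  rw [volume_pi]; infer_instance

/-- The half-open unit cube with lower corner `(a, …, a)`. -/
def cubeFrom (n : ℕ) (a : ℝ) : Set (Euc n) := {v | ∀ i, v i ∈ Set.Ico a (a + 1)}

theorem measurableSet_cubeFrom (a : ℝ) : MeasurableSet (cubeFrom n a) := by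
  have : cubeFrom n a = ⋂ i, (fun v : Euc n => v i) ⁻¹' Set.Ico a (a + 1) := by
    ext v; simp [cubeFrom]
  rw [this]
  exact MeasurableSet.iInter fun i => measurableSet_Ico.preimage (by fun_prop)

/-- The circle statement in each coordinate, multiplied up. The corner stays free because two cubes
are needed: the one centred at the origin (`a = -1/2`), stable under contraction, for Morrey and
Poincaré, and the lattice fundamental domain (`a = 0`) for the change of variables. -/
theorem measurePreserving_toTorus (a : ℝ) :
    MeasurePreserving (toTorus : Euc n → Torus n) (volume.restrict (cubeFrom n a)) volume := by
  have h1 : MeasurePreserving ((↑) : ℝ → UnitAddCircle) (volume.restrict (Set.Ico a (a + 1)))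
      volume := by
    have := UnitAddCircle.measurePreserving_mk a
    rwa [Measure.restrict_congr_set (Ico_ae_eq_Ioc (μ := volume) (a := a) (b := a + 1)).symm] at this
  have h2 : MeasurePreserving (fun v : Fin n → ℝ => (fun i => (v i : UnitAddCircle) : Torus n))
      (Measure.pi fun _ => volume.restrict (Set.Ico a (a + 1))) (Measure.pi fun _ => volume) :=
    measurePreserving_pi _ _ (fun _ => h1)
  have h3 : MeasurePreserving (WithLp.ofLp : Euc n → Fin n → ℝ)
      (volume.restrict (cubeFrom n a))
      (volume.restrict (Set.univ.pi fun _ => Set.Ico a (a + 1))) := by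
    have := (PiLp.volume_preserving_ofLp (Fin n)).restrict_preimage
      (s := Set.univ.pi fun _ : Fin n => Set.Ico a (a + 1))
      (MeasurableSet.univ_pi fun _ => measurableSet_Ico)
    have h4 : cubeFrom n a = WithLp.ofLp ⁻¹' (Set.univ.pi fun _ : Fin n => Set.Ico a (a + 1)) := by
      ext v; simp [cubeFrom]
    rw [h4]
    exact this
  rw [volume_pi, Measure.restrict_pi_pi] at h3
  exact h2.comp h3

theorem volume_cubeFrom (a : ℝ) : volume (cubeFrom n a) = 1 := by
  have h := (measurePreserving_toTorus (n := n) a).measure_preimage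
    (MeasurableSet.univ.nullMeasurableSet)
  simpa using h

theorem integral_toTorus {G : Type*} [NormedAddCommGroup G] [NormedSpace ℝ G] (a : ℝ)
    {g : Torus n → G} (hg : AEStronglyMeasurable g) :
    ∫ v in cubeFrom n a, g (toTorus v) = ∫ x, g x := by
  have h := measurePreserving_toTorus (n := n) a
  rw [← h.map_eq] at hg ⊢
  rw [integral_map h.aemeasurable hg]

theorem continuous_of_comp_toTorus {Y : Type*} [TopologicalSpace Y] {g : Torus n → Y}
    (h : Continuous fun v => g (toTorus v)) : Continuous g :=
  isOpenQuotientMap_toTorus.isQuotientMap.continuous_iff.2 h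

theorem norm_toTorus_le (v : Euc n) : ‖toTorus v‖ ≤ ‖v‖ := by
  refine (pi_norm_le_iff_of_nonneg (norm_nonneg v)).2 fun i => ?_
  refine le_trans ?_ (PiLp.norm_apply_le v i)
  exact QuotientAddGroup.norm_mk_le_norm

end TorusBasics

/-! ### Functions of class `C^k` on the torus -/

section Calculus

variable {n : ℕ}

/-- `g ∈ C^k(𝕋ⁿ)`. -/
def TorusContDiff (k : WithTop ℕ∞) (g : Torus n → ℝ) : Prop :=
  ContDiff ℝ k (fun v : Euc n => g (toTorus v))

theorem TorusContDiff.of_le {k l : WithTop ℕ∞} {g : Torus n → ℝ} (h : TorusContDiff l g)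
    (hkl : k ≤ l) : TorusContDiff k g := ContDiff.of_le h hkl

theorem TorusContDiff.continuous {k : WithTop ℕ∞} {g : Torus n → ℝ} (h : TorusContDiff k g) :
    Continuous g := continuous_of_comp_toTorus (ContDiff.continuous h)

/-- The bridge to Fréchet calculus: the product, chain and symmetry rules for `torusPartial` are all
computed on the periodic lift through this identity. -/
theorem torusPartial_toTorus {i : Fin n} {g : Torus n → ℝ} {v : Euc n}
    {L : Euc n →L[ℝ] ℝ} (h : HasFDerivAt (fun v : Euc n => g (toTorus v)) L v) :
    torusPartial i g (toTorus v) = L (EuclideanSpace.single i 1) := by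
  unfold torusPartial
  have h1 : HasDerivAt (fun t : ℝ => v + EuclideanSpace.single i t)
      (EuclideanSpace.single i (1 : ℝ)) 0 := by
    have : (fun t : ℝ => v + EuclideanSpace.single i t)
        = fun t : ℝ => v + t • EuclideanSpace.single i (1 : ℝ) := by
      funext t; ext j; simp
    rw [this]
    simpa using ((hasDerivAt_id (0 : ℝ)).smul_const (EuclideanSpace.single i (1 : ℝ))).const_add v
  have h0 : v + EuclideanSpace.single i (0 : ℝ) = v := by ext j; simp
  have h2 : HasFDerivAt (fun v : Euc n => g (toTorus v)) L (v + EuclideanSpace.single i (0 : ℝ)) := by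
    rwa [h0]
  have := (h2.comp_hasDerivAt 0 h1).deriv
  simpa [Function.comp_def, toTorus_add] using this

theorem TorusContDiff.differentiable {k : WithTop ℕ∞} (hk : k ≠ 0) {g : Torus n → ℝ}
    (h : TorusContDiff k g) : Differentiable ℝ (fun v : Euc n => g (toTorus v)) :=
  ContDiff.differentiable h hk

theorem TorusContDiff.partial {k l : WithTop ℕ∞} {g : Torus n → ℝ} (h : TorusContDiff l g)
    (hkl : k + 1 ≤ l) (i : Fin n) : TorusContDiff k (torusPartial i g) := by
  have h1 : (fun v : Euc n => torusPartial i g (toTorus v))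
      = fun v => fderiv ℝ (fun v : Euc n => g (toTorus v)) v (EuclideanSpace.single i 1) := by
    funext v
    exact torusPartial_toTorus (h.differentiable
      (by rintro rfl; simp at hkl) v).hasFDerivAt
  unfold TorusContDiff
  rw [h1]
  exact (ContDiff.fderiv_right h hkl).clm_apply contDiff_const

theorem TorusSmooth.partial {g : Torus n → ℝ} (h : TorusSmooth g) (i : Fin n) :
    TorusSmooth (torusPartial i g) :=
  TorusContDiff.partial (k := ((⊤ : ℕ∞) : WithTop ℕ∞)) h (by rfl) i

theorem clm_eq_sum_single (L : Euc n →L[ℝ] ℝ) (v : Euc n) :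
    L v = ∑ i, v i * L (EuclideanSpace.single i 1) := by
  conv_lhs => rw [← (EuclideanSpace.basisFun (Fin n) ℝ).sum_repr v]
  simp [map_sum]

theorem TorusContDiff.hasFDerivAt {g : Torus n → ℝ} (h : TorusContDiff 1 g) (v : Euc n) :
    HasFDerivAt (fun v : Euc n => g (toTorus v))
      (∑ i, torusPartial i g (toTorus v) • (EuclideanSpace.proj i : Euc n →L[ℝ] ℝ)) v := by
  have h1 := (h.differentiable one_ne_zero v).hasFDerivAt
  convert h1 using 1
  ext w
  rw [clm_eq_sum_single (fderiv ℝ _ v)]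
  simp only [_root_.sum_apply, _root_.smul_apply, smul_eq_mul,
    torusPartial_toTorus h1, PiLp.proj_apply]
  exact Finset.sum_congr rfl fun i _ => mul_comm _ _

/-- Partial derivatives determine `C¹` functions. -/
theorem torusContDiff_one_of_hasFDerivAt {g : Torus n → ℝ} {w : Fin n → Torus n → ℝ}
    (hw : ∀ i, Continuous (w i))
    (h : ∀ v : Euc n, HasFDerivAt (fun v : Euc n => g (toTorus v))
      (∑ i, w i (toTorus v) • (EuclideanSpace.proj i : Euc n →L[ℝ] ℝ)) v) :
    TorusContDiff 1 g ∧ ∀ i, torusPartial i g = w i := by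
  constructor
  · refine contDiff_one_iff_fderiv.2 ⟨fun v => (h v).differentiableAt, ?_⟩
    rw [show fderiv ℝ (fun v : Euc n => g (toTorus v)) = _ from funext fun v => (h v).fderiv]
    exact continuous_finsetSum _ fun i _ =>
      ((hw i).comp continuous_toTorus).smul continuous_const
  · intro i
    funext x
    obtain ⟨v, rfl⟩ := toTorus_surjective x
    rw [torusPartial_toTorus (h v)]
    simp

theorem torusContDiff_succ {k : ℕ} {g : Torus n → ℝ} (h : TorusContDiff 1 g)
    (h' : ∀ i, TorusContDiff k (torusPartial i g)) : TorusContDiff (k + 1 : ℕ) g := by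
  have h1 : fderiv ℝ (fun v : Euc n => g (toTorus v)) = fun v =>
      ∑ i, torusPartial i g (toTorus v) • (EuclideanSpace.proj i : Euc n →L[ℝ] ℝ) :=
    funext fun v => (h.hasFDerivAt v).fderiv
  unfold TorusContDiff
  rw [Nat.cast_add, Nat.cast_one, contDiff_succ_iff_fderiv, h1]
  refine ⟨h.differentiable one_ne_zero, by simp, ?_⟩
  exact ContDiff.sum fun i _ => ContDiff.smul (h' i) contDiff_const

theorem torusPartial_sub {g h : Torus n → ℝ} (hg : TorusContDiff 1 g) (hh : TorusContDiff 1 h)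
    (i : Fin n) (x : Torus n) :
    torusPartial i (fun x => g x - h x) x = torusPartial i g x - torusPartial i h x := by
  obtain ⟨v, rfl⟩ := toTorus_surjective x
  have h1 := (hg.differentiable one_ne_zero v).hasFDerivAt
  have h2 := (hh.differentiable one_ne_zero v).hasFDerivAt
  rw [torusPartial_toTorus h1, torusPartial_toTorus h2, torusPartial_toTorus (h1.fun_sub h2)]
  rfl

theorem torusPartial_mul {g h : Torus n → ℝ} (hg : TorusContDiff 1 g) (hh : TorusContDiff 1 h)
    (i : Fin n) (x : Torus n) :
    torusPartial i (fun x => g x * h x) x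
      = torusPartial i g x * h x + g x * torusPartial i h x := by
  obtain ⟨v, rfl⟩ := toTorus_surjective x
  have h1 := (hg.differentiable one_ne_zero v).hasFDerivAt
  have h2 := (hh.differentiable one_ne_zero v).hasFDerivAt
  rw [torusPartial_toTorus h1, torusPartial_toTorus h2, torusPartial_toTorus (h1.fun_mul h2)]
  simp; ring

theorem torusPartial_exp_neg {W : Torus n → ℝ} (hW : TorusContDiff 1 W) (i : Fin n)
    (x : Torus n) :
    torusPartial i (fun x => Real.exp (-W x)) x = -torusPartial i W x * Real.exp (-W x) := by
  obtain ⟨v, rfl⟩ := toTorus_surjective x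
  have h1 := (hW.differentiable one_ne_zero v).hasFDerivAt
  rw [torusPartial_toTorus h1, torusPartial_toTorus (h1.fun_neg.exp)]
  simp; ring

theorem torusPartial_comm {g : Torus n → ℝ} (hg : TorusContDiff 2 g) (i j : Fin n) :
    torusPartial i (torusPartial j g) = torusPartial j (torusPartial i g) := by
  funext x
  obtain ⟨v, rfl⟩ := toTorus_surjective x
  have key : ∀ i j : Fin n, torusPartial i (torusPartial j g) (toTorus v)
      = fderiv ℝ (fderiv ℝ (fun v : Euc n => g (toTorus v))) v (EuclideanSpace.single i 1)
        (EuclideanSpace.single j 1) := by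
    intro i j
    have h1 : (fun v : Euc n => torusPartial j g (toTorus v))
        = fun v => fderiv ℝ (fun v : Euc n => g (toTorus v)) v (EuclideanSpace.single j 1) :=
      funext fun v => torusPartial_toTorus (hg.differentiable two_ne_zero v).hasFDerivAt
    have h2 : HasFDerivAt (fderiv ℝ (fun v : Euc n => g (toTorus v)))
        (fderiv ℝ (fderiv ℝ (fun v : Euc n => g (toTorus v))) v) v :=
      ((ContDiff.fderiv_right (m := 1) hg (by norm_num)).differentiable one_ne_zero v).hasFDerivAt
    have h3 : HasFDerivAt (fun v : Euc n => torusPartial j g (toTorus v))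
        ((ContinuousLinearMap.apply ℝ ℝ (EuclideanSpace.single j (1 : ℝ))).comp
          (fderiv ℝ (fderiv ℝ (fun v : Euc n => g (toTorus v))) v)) v := by
      rw [h1]
      exact (ContinuousLinearMap.apply ℝ ℝ (EuclideanSpace.single j (1 : ℝ))).hasFDerivAt.comp v h2
    rw [torusPartial_toTorus h3]
    rfl
  rw [key, key]
  exact (ContDiffAt.isSymmSndFDerivAt (ContDiff.contDiffAt hg) (by simp)).eq _ _

/-- Differentiation along a straight line. -/
theorem TorusContDiff.hasDerivAt_line {g : Torus n → ℝ} (h : TorusContDiff 1 g) (x : Torus n)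
    (w : Euc n) (t : ℝ) :
    HasDerivAt (fun t : ℝ => g (x + toTorus (t • w)))
      (∑ i, w i * torusPartial i g (x + toTorus (t • w))) t := by
  obtain ⟨v, rfl⟩ := toTorus_surjective x
  have h1 : HasDerivAt (fun t : ℝ => v + t • w) w t := by
    simpa using ((hasDerivAt_id t).smul_const w).const_add v
  have h2 := (h.hasFDerivAt (v + t • w)).comp_hasDerivAt t h1
  simp only [Function.comp_def, toTorus_add] at h2
  refine h2.congr_deriv ?_
  rw [_root_.sum_apply]
  exact Finset.sum_congr rfl fun i _ => mul_comm _ _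

end Calculus

/-! ### Differentiation under the integral sign -/

section Parametric

variable {Y : Type*} [TopologicalSpace Y] [CompactSpace Y]
  [MeasurableSpace Y] [BorelSpace Y] {m : Measure Y}

/-- The weight `u` is only integrable, so domination must come from `F'`, which compactness of `Y`
bounds near `v`. The open set `U` is needed for integrands such as `log det(1 + tA)` that make sense
only for small `t`. -/
theorem hasFDerivAt_integral_mul_of_compact [SecondCountableTopology Y] {E : Type*} [NormedAddCommGroup E] [NormedSpace ℝ E]
    {F : E → Y → ℝ} {F' : E → Y → E →L[ℝ] ℝ} {U : Set E} (hU : IsOpen U)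
    (hF : ∀ v ∈ U, Continuous (F v))
    (hF' : ContinuousOn (fun z : E × Y => F' z.1 z.2) (U ×ˢ Set.univ))
    (hd : ∀ v ∈ U, ∀ y, HasFDerivAt (fun v => F v y) (F' v y) v)
    {u : Y → ℝ} (hu : Integrable u m) {v : E} (hv : v ∈ U) :
    HasFDerivAt (fun v => ∫ y, F v y * u y ∂m) (∫ y, u y • F' v y ∂m) v := by
  have hcont : ∀ v ∈ U, Continuous (F' v) := fun v hv =>
    hF'.comp_continuous (f := fun y => (v, y)) (by fun_prop) (by simp [hv])
  obtain ⟨C, hC⟩ : ∃ C, ∀ y, ‖F' v y‖ ≤ C := by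
    obtain ⟨C, hC⟩ := isCompact_univ.exists_bound_of_continuousOn (hcont v hv).continuousOn
    exact ⟨C, fun y => hC y (Set.mem_univ y)⟩
  -- Tube lemma: the strict bound `C + 1` on the slice over `v` persists over a neighbourhood of
  -- `v`, uniformly in the compact variable.
  have hbd : ∀ᶠ w in 𝓝 v, ∀ y ∈ (Set.univ : Set Y), ‖F' w y‖ ≤ C + 1 := by
    refine isCompact_univ.eventually_forall_of_forall_eventually fun y _ => ?_
    have h1 : ContinuousAt (fun z : E × Y => F' z.1 z.2) (v, y) :=
      hF'.continuousAt ((hU.prod isOpen_univ).mem_nhds (by simp [hv]))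
    have h2 := h1.norm.eventually_lt_const
      (show ‖F' v y‖ < C + 1 from (hC y).trans_lt (lt_add_one C))
    exact h2.mono fun z hz => hz.le
  have hs := hbd.and (hU.mem_nhds hv)
  refine hasFDerivAt_integral_of_dominated_of_fderiv_le (𝕜 := ℝ) (F := fun v y => F v y * u y)
    (F' := fun v y => u y • F' v y) (s := {w | (∀ y ∈ (Set.univ : Set Y),
    ‖F' w y‖ ≤ C + 1) ∧ w ∈ U}) (bound := fun y => |u y| * (C + 1)) hs ?_ ?_ ?_ ?_ ?_ ?_
  · filter_upwards [hU.mem_nhds hv] with w hw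
    exact (hF w hw).aestronglyMeasurable.mul hu.1
  · obtain ⟨K, hK⟩ := isCompact_univ.exists_bound_of_continuousOn (hF v hv).continuousOn
    exact hu.bdd_mul (hF v hv).aestronglyMeasurable
      (ae_of_all _ fun y => hK y (Set.mem_univ y))
  · exact hu.1.smul (hcont v hv).aestronglyMeasurable
  · refine ae_of_all _ fun y w hw => ?_
    rw [norm_smul, Real.norm_eq_abs]
    exact mul_le_mul_of_nonneg_left (hw.1 y (Set.mem_univ y)) (abs_nonneg _)
  · exact hu.abs.mul_const _
  · exact ae_of_all _ fun y w hw => (hd w hw.2 y).mul_const (u y)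

theorem hasDerivAt_integral_of_compact [SecondCountableTopology Y] [IsFiniteMeasure m] {F F' : ℝ → Y → ℝ} {U : Set ℝ}
    (hU : IsOpen U) (hF : ∀ t ∈ U, Continuous (F t))
    (hF' : ContinuousOn (fun z : ℝ × Y => F' z.1 z.2) (U ×ˢ Set.univ))
    (hd : ∀ t ∈ U, ∀ y, HasDerivAt (fun t => F t y) (F' t y) t) {t : ℝ} (ht : t ∈ U) :
    HasDerivAt (fun t => ∫ y, F t y ∂m) (∫ y, F' t y ∂m) t := by
  have h := hasFDerivAt_integral_mul_of_compact (m := m) (u := fun _ => 1) (F := F)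
    (F' := fun t y => ContinuousLinearMap.toSpanSingleton ℝ (F' t y)) hU hF
    (((ContinuousLinearMap.toSpanSingletonLE ℝ ℝ ℝ).toContinuousLinearEquiv.continuous).comp_continuousOn hF')
    (fun t ht y => (hd t ht y).hasFDerivAt) (integrable_const _) ht
  have h2 := h.hasDerivAt
  simp only [mul_one, one_smul] at h2
  refine h2.congr_deriv ?_
  rw [ContinuousLinearMap.integral_apply]
  · simp
  · have : Continuous (F' t) := hF'.comp_continuous (f := fun y => (t, y)) (by fun_prop) (by simp [ht])
    refine Continuous.integrable_of_hasCompactSupport ?_ (HasCompactSupport.of_compactSpace _)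
    exact ((ContinuousLinearMap.toSpanSingletonLE ℝ ℝ ℝ).toContinuousLinearEquiv.continuous).comp this

theorem continuous_integral_mul_of_compact {X : Type*} [TopologicalSpace X] [CompactSpace X]
    [FirstCountableTopology X] {K : X → Y → ℝ} (hK : Continuous fun z : X × Y => K z.1 z.2)
    {u : Y → ℝ} (hu : Integrable u m) : Continuous fun x => ∫ y, K x y * u y ∂m := by
  obtain ⟨C, hC⟩ := isCompact_univ.exists_bound_of_continuousOn hK.continuousOn
  refine continuous_of_dominated (bound := fun y => C * |u y|) ?_ ?_ (hu.abs.const_mul _) ?_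
  · intro x
    exact (hK.comp (by fun_prop : Continuous fun y => (x, y))).aestronglyMeasurable.mul hu.1
  · intro x
    refine ae_of_all _ fun y => ?_
    rw [norm_mul]
    exact mul_le_mul_of_nonneg_right (hC (x, y) (Set.mem_univ _)) (abs_nonneg _)
  · exact ae_of_all _ fun y => (hK.comp (by fun_prop : Continuous fun x => (x, y))).mul_const _

theorem integrable_mul_of_continuous_of_compact {K : Y → ℝ} (hK : Continuous K) {u : Y → ℝ}
    (hu : Integrable u m) : Integrable (fun y => K y * u y) m := by
  obtain ⟨C, hC⟩ := isCompact_univ.exists_bound_of_continuousOn hK.continuousOn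
  exact hu.bdd_mul hK.aestronglyMeasurable (ae_of_all _ fun y => hC y (Set.mem_univ y))

theorem Continuous.integrable_of_compact [IsFiniteMeasure m] {K : Y → ℝ} (hK : Continuous K) :
    Integrable K m := by
  simpa using integrable_mul_of_continuous_of_compact hK (integrable_const (1 : ℝ) (μ := m))

variable {n : ℕ}

/-- Used for translates (integration by parts), for convolutions with a merely integrable `u`, and
for potentials `∫ f(x, y) dν(y)`, where `u = 1`. -/
theorem torusContDiff_one_integral [SecondCountableTopology Y] {H : Torus n → Y → ℝ}
    (hH : Continuous fun z : Torus n × Y => H z.1 z.2)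
    (h1 : ∀ y, TorusContDiff 1 (fun x => H x y))
    (h2 : ∀ i, Continuous fun z : Torus n × Y => torusPartial i (fun x => H x z.2) z.1)
    {u : Y → ℝ} (hu : Integrable u m) :
    TorusContDiff 1 (fun x => ∫ y, H x y * u y ∂m) ∧
      ∀ i, torusPartial i (fun x => ∫ y, H x y * u y ∂m)
        = fun x => ∫ y, torusPartial i (fun x => H x y) x * u y ∂m := by
  refine torusContDiff_one_of_hasFDerivAt
    (fun i => continuous_integral_mul_of_compact (h2 i) hu) fun v => ?_
  have h := hasFDerivAt_integral_mul_of_compact (m := m) (u := u) (U := Set.univ)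
    (F := fun (v : Euc n) y => H (toTorus v) y)
    (F' := fun v y => ∑ i, torusPartial i (fun x => H x y) (toTorus v) •
      (EuclideanSpace.proj i : Euc n →L[ℝ] ℝ)) isOpen_univ
    (fun v _ => hH.comp (by fun_prop : Continuous fun y => (toTorus v, y)))
    (Continuous.continuousOn (continuous_finsetSum _ fun i _ => Continuous.smul
      ((h2 i).comp ((continuous_toTorus.comp continuous_fst).prodMk continuous_snd))
      continuous_const))
    (fun v _ y => (h1 y).hasFDerivAt v) hu (Set.mem_univ v)
  refine h.congr_fderiv ?_
  simp_rw [Finset.smul_sum, smul_smul]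
  rw [integral_finsetSum]
  · refine Finset.sum_congr rfl fun i _ => ?_
    rw [integral_smul_const]
    simp_rw [mul_comm (u _)]
  · intro i _
    refine Integrable.smul_const ?_ _
    simp_rw [mul_comm (u _)]
    exact integrable_mul_of_continuous_of_compact
      ((h2 i).comp (by fun_prop : Continuous fun y => (toTorus v, y))) hu

end Parametric

/-! ### Translations and integration by parts -/

section IntegrationByParts

variable {n : ℕ}

theorem torusPartial_comp_add_right (i : Fin n) (g : Torus n → ℝ) (y x : Torus n) :
    torusPartial i (fun x => g (x + y)) x = torusPartial i g (x + y) := by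
  unfold torusPartial
  simp_rw [add_right_comm x _ y]

theorem torusPartial_comp_sub_right (i : Fin n) (g : Torus n → ℝ) (y x : Torus n) :
    torusPartial i (fun x => g (x - y)) x = torusPartial i g (x - y) := by
  simp_rw [sub_eq_add_neg]
  exact torusPartial_comp_add_right i g (-y) x

theorem torusPartial_comp_sub_left (i : Fin n) (g : Torus n → ℝ) (x y : Torus n) :
    torusPartial i (fun y => g (x - y)) y = -torusPartial i g (x - y) := by
  unfold torusPartial
  have h : ∀ t : ℝ, x - (y + toTorus (EuclideanSpace.single i t))
      = x - y + toTorus (EuclideanSpace.single i (-t)) := by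
    intro t
    have : EuclideanSpace.single i (-t) = -EuclideanSpace.single i t := by
      ext j; by_cases hj : j = i <;> simp [hj]
    rw [this, toTorus_neg]; abel
  simp_rw [h]
  rw [deriv_comp_neg (fun t : ℝ => g (x - y + toTorus (EuclideanSpace.single i t)))]
  simp

theorem TorusContDiff.comp_add_right {k : WithTop ℕ∞} {g : Torus n → ℝ} (h : TorusContDiff k g)
    (y : Torus n) : TorusContDiff k (fun x => g (x + y)) := by
  obtain ⟨w, rfl⟩ := toTorus_surjective y
  unfold TorusContDiff
  simp_rw [← toTorus_add]
  exact ContDiff.comp (g := fun v : Euc n => g (toTorus v)) h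
    (by fun_prop : ContDiff ℝ k fun v : Euc n => v + w)

theorem TorusContDiff.comp_sub_right {k : WithTop ℕ∞} {g : Torus n → ℝ} (h : TorusContDiff k g)
    (y : Torus n) : TorusContDiff k (fun x => g (x - y)) := by
  simpa [sub_eq_add_neg] using h.comp_add_right (-y)

theorem TorusContDiff.comp_sub_left {k : WithTop ℕ∞} {g : Torus n → ℝ} (h : TorusContDiff k g)
    (y : Torus n) : TorusContDiff k (fun x => g (y - x)) := by
  obtain ⟨w, rfl⟩ := toTorus_surjective y
  unfold TorusContDiff
  simp_rw [← toTorus_sub]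
  exact ContDiff.comp (g := fun v : Euc n => g (toTorus v)) h
    (by fun_prop : ContDiff ℝ k fun v : Euc n => w - v)

theorem TorusContDiff.continuous_partial {g : Torus n → ℝ} (h : TorusContDiff 1 g) (i : Fin n) :
    Continuous (torusPartial i g) :=
  (h.partial (k := 0) (by norm_num) i).continuous

/-- Translation invariance makes `x ↦ ∫ g(x + y) dy` constant; differentiating it under the integral
sign gives the claim. -/
theorem integral_torusPartial {g : Torus n → ℝ} (h : TorusContDiff 1 g) (i : Fin n) :
    ∫ x, torusPartial i g x = 0 := by
  have h1 := (torusContDiff_one_integral (m := (volume : Measure (Torus n)))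
    (H := fun x y => g (x + y)) (u := fun _ => 1)
    (h.continuous.comp continuous_add) (fun y => h.comp_add_right y)
    (fun i => by
      simp_rw [torusPartial_comp_add_right]
      exact (h.continuous_partial i).comp continuous_add) (integrable_const _)).2 i
  simp only [mul_one, torusPartial_comp_add_right] at h1
  have h2 : (fun x : Torus n => ∫ y, g (x + y)) = fun _ => ∫ y, g y :=
    funext fun x => integral_add_left_eq_self g x
  rw [h2] at h1
  have h3 := congrFun h1 0
  simp only [zero_add] at h3
  rw [← h3]
  simp [torusPartial]

theorem TorusContDiff.mul {k : WithTop ℕ∞} {g h : Torus n → ℝ} (hg : TorusContDiff k g)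
    (hh : TorusContDiff k h) : TorusContDiff k (fun x => g x * h x) := ContDiff.mul hg hh

theorem TorusContDiff.sub {k : WithTop ℕ∞} {g h : Torus n → ℝ} (hg : TorusContDiff k g)
    (hh : TorusContDiff k h) : TorusContDiff k (fun x => g x - h x) := ContDiff.sub hg hh

theorem integral_torusPartial_mul {g h : Torus n → ℝ} (hg : TorusContDiff 1 g)
    (hh : TorusContDiff 1 h) (i : Fin n) :
    ∫ x, torusPartial i g x * h x = -∫ x, g x * torusPartial i h x := by
  have h1 := integral_torusPartial (hg.mul hh) i
  simp_rw [torusPartial_mul hg hh] at h1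
  rw [integral_add] at h1
  · linarith
  · exact ((hg.continuous_partial i).mul hh.continuous).integrable_of_compact
  · exact (hg.continuous.mul (hh.continuous_partial i)).integrable_of_compact

end IntegrationByParts

/-! ### Iterated derivatives -/

section MultiDeriv

variable {n : ℕ}

theorem TorusSmooth.torusContDiff {g : Torus n → ℝ} (h : TorusSmooth g) (k : ℕ) :
    TorusContDiff k g :=
  TorusContDiff.of_le (l := ((⊤ : ℕ∞) : WithTop ℕ∞)) h
    (WithTop.coe_le_coe.2 (le_top : (k : ℕ∞) ≤ ⊤))

theorem TorusSmooth.iterate_partial {g : Torus n → ℝ} (h : TorusSmooth g) (i : Fin n) (k : ℕ) :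
    TorusSmooth ((torusPartial i)^[k] g) := by
  induction k with
  | zero => exact h
  | succ k ih => rw [Function.iterate_succ_apply']; exact ih.partial i

theorem TorusSmooth.iterate_partial_comm {g : Torus n → ℝ} (h : TorusSmooth g) (i j : Fin n)
    (k l : ℕ) : (torusPartial i)^[k] ((torusPartial j)^[l] g)
      = (torusPartial j)^[l] ((torusPartial i)^[k] g) := by
  have h1 : ∀ {g : Torus n → ℝ}, TorusSmooth g → ∀ l, torusPartial i ((torusPartial j)^[l] g)
      = (torusPartial j)^[l] (torusPartial i g) := by
    intro g hg l
    induction l with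
    | zero => rfl
    | succ l ih =>
      rw [Function.iterate_succ_apply', Function.iterate_succ_apply', ← ih]
      exact torusPartial_comm ((hg.iterate_partial j l).torusContDiff 2) i j
  induction k with
  | zero => rfl
  | succ k ih =>
    rw [Function.iterate_succ_apply', ih, h1 (h.iterate_partial i k),
      Function.iterate_succ_apply']

/-- The derivative along a list of coordinates. -/
def listDeriv (l : List (Fin n)) (α : Fin n → ℕ) (g : Torus n → ℝ) : Torus n → ℝ :=
  l.foldr (fun i h => (torusPartial i)^[α i] h) g

theorem TorusSmooth.listDeriv {g : Torus n → ℝ} (h : TorusSmooth g) (l : List (Fin n))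
    (α : Fin n → ℕ) : TorusSmooth (listDeriv l α g) := by
  induction l with
  | nil => exact h
  | cons a l ih => exact ih.iterate_partial a _

/-- Arbitrary lists make the induction possible; `multiDeriv` is the case `List.finRange n`, by
definition. -/
theorem TorusSmooth.iterate_listDeriv {g : Torus n → ℝ} (h : TorusSmooth g) (l : List (Fin n))
    (α : Fin n → ℕ) (i : Fin n) (k : ℕ) :
    (torusPartial i)^[k] (_root_.listDeriv l α g) = _root_.listDeriv l α ((torusPartial i)^[k] g) := by
  induction l with
  | nil => rfl
  | cons a l ih =>
    change (torusPartial i)^[k] ((torusPartial a)^[α a] (_root_.listDeriv l α g))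
      = (torusPartial a)^[α a] (_root_.listDeriv l α ((torusPartial i)^[k] g))
    rw [← ih, (h.listDeriv l α).iterate_partial_comm]

theorem TorusSmooth.listDeriv_add {g : Torus n → ℝ} (h : TorusSmooth g) (l : List (Fin n))
    (α β : Fin n → ℕ) :
    _root_.listDeriv l (α + β) g = _root_.listDeriv l α (_root_.listDeriv l β g) := by
  induction l with
  | nil => rfl
  | cons a l ih =>
    change (torusPartial a)^[α a + β a] (_root_.listDeriv l (α + β) g)
      = (torusPartial a)^[α a] (_root_.listDeriv l α ((torusPartial a)^[β a] (_root_.listDeriv l β g)))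
    rw [ih, Function.iterate_add_apply, ← (h.listDeriv l β).iterate_listDeriv]

theorem listDeriv_single (l : List (Fin n)) (hl : l.Nodup) (i : Fin n) (g : Torus n → ℝ) :
    listDeriv l (Pi.single i 1) g = if i ∈ l then torusPartial i g else g := by
  induction l with
  | nil => rfl
  | cons a l ih =>
    change (torusPartial a)^[(Pi.single i 1 : Fin n → ℕ) a] (listDeriv l (Pi.single i 1) g) = _
    rw [ih (List.nodup_cons.1 hl).2]
    by_cases h : a = i
    · subst h
      simp [(List.nodup_cons.1 hl).1]
    · have h' : ¬ i = a := fun h'' => h h''.symm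
      simp [h, h']

theorem multiDeriv_single (i : Fin n) (g : Torus n → ℝ) :
    multiDeriv (Pi.single i 1) g = torusPartial i g := by
  have := listDeriv_single (List.finRange n) (List.nodup_finRange n) i g
  simp only [List.mem_finRange, if_true] at this
  exact this

theorem multiDeriv_single_add {g : Torus n → ℝ} (h : TorusSmooth g) (i j : Fin n) :
    multiDeriv (Pi.single i 1 + Pi.single j 1) g = torusPartial i (torusPartial j g) := by
  rw [← multiDeriv_single j g, ← multiDeriv_single i (multiDeriv (Pi.single j 1) g)]
  exact h.listDeriv_add (List.finRange n) _ _

theorem multiDeriv_zero (g : Torus n → ℝ) : multiDeriv 0 g = g := by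
  unfold multiDeriv
  induction List.finRange n with
  | nil => rfl
  | cons a l ih => simp

end MultiDeriv

/-! ### Mollification on the torus -/

section Mollifier

variable {n : ℕ}

theorem TorusSmooth.of_forall {g : Torus n → ℝ} (h : ∀ k : ℕ, TorusContDiff k g) :
    TorusSmooth g := contDiff_infty.2 h

/-- The convolution `ρ * u`. -/
def torusConv (ρ u : Torus n → ℝ) (x : Torus n) : ℝ := ∫ y, ρ (x - y) * u y

theorem torusConv_contDiff_one {ρ u : Torus n → ℝ} (hρ : TorusContDiff 1 ρ) (hu : Integrable u) :
    TorusContDiff 1 (torusConv ρ u) ∧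
      ∀ i, torusPartial i (torusConv ρ u) = torusConv (torusPartial i ρ) u := by
  have := torusContDiff_one_integral (m := (volume : Measure (Torus n)))
    (H := fun x y => ρ (x - y)) (hρ.continuous.comp continuous_sub)
    (fun y => hρ.comp_sub_right y) (fun i => by
      simp_rw [torusPartial_comp_sub_right]
      exact (hρ.continuous_partial i).comp continuous_sub) hu
  simp only [torusPartial_comp_sub_right] at this
  exact this

theorem torusConv_smooth {ρ u : Torus n → ℝ} (hρ : TorusSmooth ρ) (hu : Integrable u) :
    TorusSmooth (torusConv ρ u) := by
  have key : ∀ k : ℕ, ∀ ρ : Torus n → ℝ, TorusSmooth ρ → TorusContDiff k (torusConv ρ u) := by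
    intro k
    induction k with
    | zero => exact fun ρ hρ => ((torusConv_contDiff_one (hρ.torusContDiff 1) hu).1).of_le (by simp)
    | succ k ih =>
      intro ρ hρ
      have h := torusConv_contDiff_one (hρ.torusContDiff 1) hu
      exact torusContDiff_succ h.1 fun i => by rw [h.2 i]; exact ih _ (hρ.partial i)
  exact TorusSmooth.of_forall fun k => key k ρ hρ

/-- The weak derivative is tested against `y ↦ ρ(x - y)`, whose partial derivatives carry a minus
sign that cancels the sign in the definition. -/
theorem torusPartial_torusConv {ρ u v : Torus n → ℝ} (hρ : TorusSmooth ρ) {i : Fin n}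
    (h : HasWeakDeriv (Pi.single i 1) u v) :
    torusPartial i (torusConv ρ u) = torusConv ρ v := by
  rw [(torusConv_contDiff_one (hρ.torusContDiff 1) h.1).2 i]
  funext x
  have h1 := h.2.2 (fun y => ρ (x - y)) (TorusContDiff.comp_sub_left hρ x)
  simp only [multiDeriv_single, torusPartial_comp_sub_left, smul_eq_mul, neg_mul, integral_neg,
    Finset.sum_pi_single', Finset.mem_univ, if_true, pow_one] at h1
  unfold torusConv
  linarith

theorem torusConv_sub_right {ρ u v : Torus n → ℝ} (hρ : Continuous ρ) (hu : Integrable u)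
    (hv : Integrable v) (x : Torus n) :
    torusConv ρ (u - v) x = torusConv ρ u x - torusConv ρ v x := by
  unfold torusConv
  rw [← integral_sub]
  · simp_rw [Pi.sub_apply, mul_sub]
  · exact integrable_mul_of_continuous_of_compact (hρ.comp (by fun_prop)) hu
  · exact integrable_mul_of_continuous_of_compact (hρ.comp (by fun_prop)) hv

theorem torusConv_continuous {ρ u : Torus n → ℝ} (hρ : Continuous ρ) (hu : Integrable u) :
    Continuous (torusConv ρ u) :=
  continuous_integral_mul_of_compact (K := fun x y => ρ (x - y)) (hρ.comp continuous_sub) hu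

instance torus_isNegInvariant : (volume : Measure (Torus n)).IsNegInvariant :=
  Measure.IsAddHaarMeasure.isNegInvariant_of_regular _

theorem torusConv_eq (ρ u : Torus n → ℝ) (x : Torus n) :
    torusConv ρ u x = ∫ z, ρ z * u (x - z) := by
  unfold torusConv
  rw [← integral_sub_left_eq_self (fun z => ρ z * u (x - z)) volume x]
  simp

/-- For fixed `x`, `ρ(x - y) dy` is a probability measure, so Jensen's inequality bounds `|ρ * u|^p`
by `ρ * |u|^p` pointwise. Tonelli and invariance of Lebesgue measure finish. -/
theorem eLpNorm_torusConv_le {ρ u : Torus n → ℝ} (hρ : Continuous ρ) (h0 : ∀ x, 0 ≤ ρ x)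
    (h1 : ∫ x, ρ x = 1) {p : ENNReal} (hp : 1 ≤ p) (hp' : p ≠ ⊤) (hu : MemLp u p) :
    eLpNorm (torusConv ρ u) p volume ≤ eLpNorm u p volume := by
  have hp0 : p ≠ 0 := (zero_lt_one.trans_le hp).ne'
  have hr : 0 < p.toReal := ENNReal.toReal_pos hp0 hp'
  have hl1 : ∫⁻ x, ENNReal.ofReal (ρ x) = 1 := by
    rw [← ofReal_integral_eq_lintegral_ofReal hρ.integrable_of_compact (ae_of_all _ h0), h1,
      ENNReal.ofReal_one]
  have hpt : ∀ x, ‖torusConv ρ u x‖ₑ ^ p.toReal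
      ≤ ∫⁻ y, ENNReal.ofReal (ρ (x - y)) * ‖u y‖ₑ ^ p.toReal := by
    intro x
    have hm : Measurable fun y => ENNReal.ofReal (ρ (x - y)) :=
      (ENNReal.continuous_ofReal.comp (hρ.comp (by fun_prop))).measurable
    set m := (volume : Measure (Torus n)).withDensity (fun y => ENNReal.ofReal (ρ (x - y))) with hmdef
    have hmp : IsProbabilityMeasure m := by
      refine ⟨?_⟩
      rw [hmdef, withDensity_apply _ MeasurableSet.univ, Measure.restrict_univ,
        lintegral_sub_left_eq_self (fun z => ENNReal.ofReal (ρ z)) x, hl1]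
    have hum : AEStronglyMeasurable u m := hu.1.mono_ac (withDensity_absolutelyContinuous _ _)
    have e1 : ‖torusConv ρ u x‖ₑ ≤ eLpNorm u 1 m := by
      rw [eLpNorm_one_eq_lintegral_enorm, hmdef,
        lintegral_withDensity_eq_lintegral_mul₀ hm.aemeasurable hu.1.enorm]
      refine (enorm_integral_le_lintegral_enorm _).trans (le_of_eq ?_)
      refine lintegral_congr fun y => ?_
      rw [enorm_mul, Real.enorm_of_nonneg (h0 _)]
      rfl
    have e2 := e1.trans (eLpNorm_le_eLpNorm_of_exponent_le hp hum)
    rw [eLpNorm_eq_lintegral_rpow_enorm_toReal hp0 hp'] at e2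
    have e3 := ENNReal.rpow_le_rpow e2 hr.le
    rw [← ENNReal.rpow_mul, one_div, inv_mul_cancel₀ hr.ne', ENNReal.rpow_one, hmdef,
      lintegral_withDensity_eq_lintegral_mul₀ hm.aemeasurable (hu.1.enorm.pow_const _)] at e3
    exact e3
  rw [eLpNorm_eq_lintegral_rpow_enorm_toReal hp0 hp', eLpNorm_eq_lintegral_rpow_enorm_toReal hp0 hp']
  refine ENNReal.rpow_le_rpow ?_ (by positivity)
  refine (lintegral_mono hpt).trans ?_
  rw [lintegral_lintegral_swap]
  · refine lintegral_mono fun y => ?_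
    rw [lintegral_mul_const]
    · rw [lintegral_sub_right_eq_self (fun z => ENNReal.ofReal (ρ z)) y, hl1, one_mul]
    · exact (ENNReal.continuous_ofReal.comp (hρ.comp (by fun_prop))).measurable
  · refine AEMeasurable.mul ?_ ?_
    · exact (ENNReal.continuous_ofReal.comp (hρ.comp (by fun_prop))).measurable.aemeasurable
    · exact (hu.1.enorm.pow_const _).comp_snd

/-- A smooth function on the torus with values in `[0, 1]` and a strict maximum at `0`. -/
def torusBump (x : Torus n) : ℝ := ∏ i, (1 + (AddCircle.toCircle (x i) : ℂ).re) / 2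

theorem torusBump_toTorus (v : Euc n) :
    torusBump (toTorus v) = ∏ i, (1 + Real.cos (2 * Real.pi * v i)) / 2 := by
  unfold torusBump toTorus
  refine Finset.prod_congr rfl fun i _ => ?_
  rw [AddCircle.toCircle_apply_mk, Circle.coe_exp, div_one, Complex.exp_ofReal_mul_I_re]

theorem torusBump_smooth : TorusSmooth (torusBump : Torus n → ℝ) := by
  unfold TorusSmooth
  simp_rw [torusBump_toTorus]
  fun_prop

theorem torusBump_factor_mem (z : UnitAddCircle) :
    0 ≤ (1 + (AddCircle.toCircle z : ℂ).re) / 2 ∧ (1 + (AddCircle.toCircle z : ℂ).re) / 2 ≤ 1 := by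
  have h := Complex.abs_re_le_norm (AddCircle.toCircle z : ℂ)
  rw [Circle.norm_coe, abs_le] at h
  constructor <;> linarith [h.1, h.2]

theorem torusBump_factor_lt {z : UnitAddCircle} (hz : z ≠ 0) :
    (1 + (AddCircle.toCircle z : ℂ).re) / 2 < 1 := by
  refine lt_of_le_of_ne (torusBump_factor_mem z).2 fun h => hz ?_
  have hre : (AddCircle.toCircle z : ℂ).re = 1 := by linarith
  have hn : Complex.normSq (AddCircle.toCircle z : ℂ) = 1 := Circle.normSq_coe _
  rw [Complex.normSq_apply, hre] at hn
  have him : (AddCircle.toCircle z : ℂ).im = 0 := by nlinarith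
  have h1 : AddCircle.toCircle z = 1 := Circle.ext (by
    rw [Circle.coe_one]; exact Complex.ext hre him)
  exact AddCircle.injective_toCircle one_ne_zero (by rw [h1, AddCircle.toCircle_zero])

theorem torusBump_nonneg (x : Torus n) : 0 ≤ torusBump x :=
  Finset.prod_nonneg fun i _ => (torusBump_factor_mem (x i)).1

theorem torusBump_zero : torusBump (0 : Torus n) = 1 := by
  simp [torusBump]

theorem torusBump_lt {x : Torus n} (hx : x ≠ 0) : torusBump x < 1 := by
  obtain ⟨i, hi⟩ := Function.ne_iff.1 hx
  unfold torusBump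
  rw [← Finset.mul_prod_erase _ _ (Finset.mem_univ i)]
  calc _ ≤ (1 + (AddCircle.toCircle (x i) : ℂ).re) / 2 * 1 :=
        mul_le_mul_of_nonneg_left (Finset.prod_le_one (fun j _ => (torusBump_factor_mem (x j)).1)
          fun j _ => (torusBump_factor_mem (x j)).2) (torusBump_factor_mem (x i)).1
    _ < 1 := by rw [mul_one]; exact torusBump_factor_lt hi

/-- An approximate identity of smooth functions on the torus. -/
def torusKernel (k : ℕ) (x : Torus n) : ℝ := (∫ y : Torus n, torusBump y ^ k)⁻¹ * torusBump x ^ k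

theorem torusBump_continuous : Continuous (torusBump : Torus n → ℝ) :=
  TorusContDiff.continuous torusBump_smooth

theorem torusKernel_smooth (k : ℕ) : TorusSmooth (torusKernel k : Torus n → ℝ) :=
  contDiff_const.mul (ContDiff.pow torusBump_smooth k)

theorem torusKernel_continuous (k : ℕ) : Continuous (torusKernel k : Torus n → ℝ) :=
  TorusContDiff.continuous (torusKernel_smooth k)

theorem torusKernel_nonneg (k : ℕ) (x : Torus n) : 0 ≤ torusKernel k x :=
  mul_nonneg (inv_nonneg.2 (integral_nonneg fun y => pow_nonneg (torusBump_nonneg y) k))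
    (pow_nonneg (torusBump_nonneg x) k)

theorem integral_torusKernel (k : ℕ) : ∫ x : Torus n, torusKernel k x = 1 := by
  unfold torusKernel
  rw [integral_const_mul]
  refine inv_mul_cancel₀ (ne_of_gt ?_)
  refine (torusBump_continuous.pow k).integral_pos_of_hasCompactSupport_nonneg_nonzero
    (HasCompactSupport.of_compactSpace _) (fun y => pow_nonneg (torusBump_nonneg y) k) (x := 0) ?_
  simp [torusBump_zero]

/-- Normalised powers of a function with a unique maximum concentrate there. The principle is
applied to the indicator of `Uᶜ`, which vanishes near the maximum point `0`. -/
theorem tendsto_integral_torusKernel_compl {U : Set (Torus n)} (hU : U ∈ 𝓝 (0 : Torus n))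
    (hUm : MeasurableSet U) :
    Tendsto (fun k => ∫ x in Uᶜ, torusKernel k x) atTop (𝓝 0) := by
  have h := tendsto_setIntegral_pow_smul_of_unique_maximum_of_isCompact_of_integrableOn
    (μ := (volume : Measure (Torus n))) (s := Set.univ) (x₀ := 0) (c := torusBump)
    (g := Uᶜ.indicator fun _ => (1 : ℝ)) isCompact_univ torusBump_continuous.continuousOn
    (fun y _ hy => by rw [torusBump_zero]; exact torusBump_lt hy) (fun x _ => torusBump_nonneg x)
    (by rw [torusBump_zero]; exact one_pos) (by simp)
    ((integrable_const _).indicator hUm.compl).integrableOn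
    (ContinuousAt.continuousWithinAt (by
      refine ContinuousAt.congr (continuousAt_const (y := (0 : ℝ))) ?_
      filter_upwards [hU] with x hx
      simp [hx]))
  have h0 : (0 : Torus n) ∈ U := mem_of_mem_nhds hU
  simp only [Measure.restrict_univ, Set.indicator_of_notMem (show (0 : Torus n) ∉ Uᶜ by simpa using h0),
    smul_eq_mul] at h
  refine h.congr fun k => ?_
  rw [← integral_const_mul, ← integral_indicator hUm.compl]
  refine integral_congr_ae (ae_of_all _ fun x => ?_)
  by_cases hx : x ∈ U <;> simp [hx, torusKernel]

theorem tendsto_torusConv_uniform {g : Torus n → ℝ} (hg : Continuous g) {ε : ℝ} (hε : 0 < ε) :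
    ∀ᶠ k in atTop, ∀ x, |torusConv (torusKernel k) g x - g x| ≤ ε := by
  obtain ⟨M, hM⟩ := isCompact_univ.exists_bound_of_continuousOn hg.continuousOn
  replace hM : ∀ x, |g x| ≤ M := fun x => hM x (Set.mem_univ x)
  have hM0 : 0 ≤ M := (abs_nonneg _).trans (hM 0)
  have huc := CompactSpace.uniformContinuous_of_continuous hg
  obtain ⟨r, hr, hgr⟩ := Metric.uniformContinuous_iff.1 huc (ε / 2) (half_pos hε)
  -- Away from the ball the integrand is at most `2M` times the kernel, so mass `ε / (4(M + 1))`
  -- there costs at most `ε / 2`.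
  have hlim := (tendsto_integral_torusKernel_compl (n := n) (Metric.ball_mem_nhds 0 hr)
    measurableSet_ball).eventually_lt_const (show (0 : ℝ) < ε / (4 * (M + 1)) by positivity)
  filter_upwards [hlim] with k hk x
  have hκ := torusKernel_continuous (n := n) k
  have hint : ∀ {φ : Torus n → ℝ}, Continuous φ → Integrable φ := fun h => h.integrable_of_compact
  have e1 : torusConv (torusKernel k) g x - g x = ∫ z, torusKernel k z * (g (x - z) - g x) := by
    rw [torusConv_eq]
    simp_rw [mul_sub]
    rw [integral_sub (hint (by fun_prop)) (hint (by fun_prop)), integral_mul_const,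
      integral_torusKernel, one_mul]
  have e2 : ∀ z, |torusKernel k z * (g (x - z) - g x)|
      ≤ torusKernel k z * (ε / 2) + (Metric.ball (0 : Torus n) r)ᶜ.indicator
        (fun z => torusKernel k z * (2 * M)) z := by
    intro z
    rw [abs_mul, abs_of_nonneg (torusKernel_nonneg k z)]
    by_cases hz : z ∈ Metric.ball (0 : Torus n) r
    · have : dist (x - z) x < r := by
        rw [dist_eq_norm]; simpa using hz
      have h2 := hgr this
      rw [Real.dist_eq] at h2
      simpa [hz] using mul_le_mul_of_nonneg_left h2.le (torusKernel_nonneg k z)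
    · rw [Set.indicator_of_mem (by exact hz)]
      have h2 : |g (x - z) - g x| ≤ 2 * M := by
        refine (abs_sub _ _).trans ?_
        linarith [hM (x - z), hM x]
      have := mul_le_mul_of_nonneg_left h2 (torusKernel_nonneg k z)
      have h3 : 0 ≤ torusKernel k z * (ε / 2) := mul_nonneg (torusKernel_nonneg k z) (by positivity)
      linarith
  rw [e1]
  refine (abs_integral_le_integral_abs).trans ?_
  refine (integral_mono (hint (by fun_prop)) ((hint (by fun_prop)).add
    ((hint (by fun_prop)).indicator measurableSet_ball.compl)) e2).trans ?_
  rw [integral_add' (hint (by fun_prop)) ((hint (by fun_prop)).indicator measurableSet_ball.compl),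
    integral_mul_const, integral_torusKernel, integral_indicator measurableSet_ball.compl,
    integral_mul_const]
  have h4 : (∫ z in (Metric.ball (0 : Torus n) r)ᶜ, torusKernel k z) * (2 * M)
      ≤ ε / (4 * (M + 1)) * (2 * M) := mul_le_mul_of_nonneg_right hk.le (by positivity)
  have h5 : ε / (4 * (M + 1)) * (2 * M) ≤ ε / 2 := by
    rw [div_mul_eq_mul_div, div_le_iff₀ (by positivity)]
    nlinarith
  linarith

/-- Continuous functions are dense in `L^p`, mollification converges uniformly on them, and it
contracts the `L^p` norm: an argument with three errors `ε / 3`. -/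
theorem tendsto_eLpNorm_torusConv {p : ENNReal} (hp : 1 ≤ p) (hp' : p ≠ ⊤) {u : Torus n → ℝ}
    (hu : MemLp u p) :
    Tendsto (fun k => eLpNorm (torusConv (torusKernel k) u - u) p volume) atTop (𝓝 0) := by
  rw [ENNReal.tendsto_atTop_zero]
  intro ε hε
  by_cases hεt : ε = ⊤
  · exact ⟨0, fun k _ => by rw [hεt]; exact le_top⟩
  have hε3 : ε / 3 ≠ 0 := by simp [hε.ne']
  obtain ⟨g, hgc, hg, hgm⟩ : ∃ g : Torus n → ℝ, Continuous g ∧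
      eLpNorm (u - g) p volume ≤ ε / 3 ∧ MemLp g p := by
    obtain ⟨g, hg, hgm⟩ := hu.exists_boundedContinuous_eLpNorm_sub_le hp' hε3
    exact ⟨g, g.continuous, hg, hgm⟩
  have hε3r : 0 < (ε / 3).toReal := ENNReal.toReal_pos hε3 (by
    exact (ENNReal.div_lt_top hεt (by norm_num)).ne)
  obtain ⟨N, hN⟩ := eventually_atTop.1 (tendsto_torusConv_uniform hgc hε3r)
  refine ⟨N, fun k hk => ?_⟩
  have hκ := torusKernel_continuous (n := n) k
  have hui : Integrable u := hu.integrable hp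
  have hgi : Integrable g := hgm.integrable hp
  have hd : MemLp (u - g) p := hu.sub hgm
  have e1 : torusConv (torusKernel k) u - u
      = torusConv (torusKernel k) (u - g) + (torusConv (torusKernel k) g - g) + (g - u) := by
    funext x
    simp only [Pi.sub_apply, Pi.add_apply, torusConv_sub_right hκ hui hgi]
    ring
  have hc1 := (torusConv_continuous hκ (hd.integrable hp)).aestronglyMeasurable (μ := volume)
  have hc2 := ((torusConv_continuous hκ hgi).sub hgc).aestronglyMeasurable (μ := volume)
  rw [e1]
  refine (eLpNorm_add_le (hc1.add hc2) (hgm.1.sub hu.1) hp).trans ?_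
  refine (add_le_add (eLpNorm_add_le hc1 hc2 hp) le_rfl).trans ?_
  have b1 := (eLpNorm_torusConv_le hκ (torusKernel_nonneg k) (integral_torusKernel k) hp hp' hd).trans hg
  have b2 : eLpNorm (torusConv (torusKernel k) g - g) p volume ≤ ε / 3 := by
    have := eLpNorm_le_of_ae_bound (p := p) (μ := (volume : Measure (Torus n)))
      (f := torusConv (torusKernel k) g - g) (C := (ε / 3).toReal) (ae_of_all _ fun x => hN k hk x)
    rwa [measure_univ, ENNReal.one_rpow, one_mul,
      ENNReal.ofReal_toReal (ENNReal.div_lt_top hεt (by norm_num)).ne] at this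
  have b3 : eLpNorm (g - u) p volume ≤ ε / 3 := by
    rw [eLpNorm_sub_comm]; exact hg
  calc _ ≤ ε / 3 + ε / 3 + ε / 3 := add_le_add (add_le_add b1 b2) b3
    _ = ε := ENNReal.add_thirds ε

/-- Reflected translates of the kernel are admissible test functions, so every mollification of `w`
vanishes, and these converge to `w` in `L¹`. -/
theorem ae_eq_zero_of_integral_smooth_mul_eq_zero {w : Torus n → ℝ} (hw : Integrable w)
    (h : ∀ g : Torus n → ℝ, TorusSmooth g → ∫ x, g x * w x = 0) : w =ᵐ[volume] 0 := by
  have h1 : ∀ k, torusConv (torusKernel k) w = 0 := fun k => funext fun x =>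
    h (fun y => torusKernel k (x - y)) (TorusContDiff.comp_sub_left (torusKernel_smooth k) x)
  have h2 := tendsto_eLpNorm_torusConv le_rfl ENNReal.one_ne_top (memLp_one_iff_integrable.2 hw)
  simp_rw [h1, zero_sub, eLpNorm_neg] at h2
  exact (eLpNorm_eq_zero_iff hw.1 one_ne_zero).1 (tendsto_nhds_unique h2 tendsto_const_nhds).symm

end Mollifier

/-! ### The inequalities of Morrey and Poincaré -/

section Morrey

variable {n : ℕ}

/-- The cube centred at the origin covers the torus once, so `g(x) - ∫ g` is the average of `g(x) -
g(x + z)` over it. Each difference is the integral of the derivative along a segment, and `|z i| ≤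
1` there. Morrey and Poincaré both start here. -/
theorem enorm_sub_integral_le {g : Torus n → ℝ} (hg : TorusContDiff 1 g) (x : Torus n) :
    ‖g x - ∫ y, g y‖ₑ ≤ ∫⁻ z in cubeFrom n (-(1 / 2)), ∫⁻ t in Set.Ioc (0 : ℝ) 1,
      ‖∑ i, |torusPartial i g (x + toTorus (t • z))|‖ₑ := by
  have hgx : Continuous fun y => g (x + y) := hg.continuous.comp (by fun_prop)
  have hp : ∀ i, Continuous (torusPartial i g) := hg.continuous_partial
  have h1 : g x - ∫ y, g y = ∫ z in cubeFrom n (-(1 / 2)), (g x - g (x + toTorus z)) := by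
    rw [integral_toTorus (g := fun y => g x - g (x + y)) _
      (continuous_const.sub hgx).aestronglyMeasurable,
      integral_sub (integrable_const _) hgx.integrable_of_compact, integral_const,
      integral_add_left_eq_self g x]
    simp
  rw [h1]
  refine (enorm_integral_le_lintegral_enorm _).trans ?_
  refine setLIntegral_mono' (measurableSet_cubeFrom _) fun z hz => ?_
  have hc : Continuous fun t : ℝ => x + toTorus (t • z) :=
    continuous_const.add (continuous_toTorus.comp (by fun_prop))
  have h2 : ∫ t in (0 : ℝ)..1, ∑ i, z i * torusPartial i g (x + toTorus (t • z))
      = g (x + toTorus z) - g x := by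
    rw [intervalIntegral.integral_eq_sub_of_hasDerivAt
      (fun t _ => hg.hasDerivAt_line x z t)]
    · simp [toTorus_zero]
    · exact (continuous_finsetSum _ fun i _ =>
        continuous_const.mul ((hp i).comp hc)).intervalIntegrable _ _
  rw [← neg_sub, enorm_neg, ← h2, intervalIntegral.integral_of_le zero_le_one]
  refine (enorm_integral_le_lintegral_enorm _).trans ?_
  refine lintegral_mono fun t => ?_
  rw [← ofReal_norm, ← ofReal_norm]
  refine ENNReal.ofReal_le_ofReal ?_
  rw [Real.norm_of_nonneg (Finset.sum_nonneg fun i _ => abs_nonneg _)]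
  refine (norm_sum_le _ _).trans (Finset.sum_le_sum fun i _ => ?_)
  rw [norm_mul]
  refine mul_le_of_le_one_left (norm_nonneg _) ?_
  have := hz i
  rw [Real.norm_eq_abs, abs_le]
  constructor <;> linarith [this.1, this.2]

theorem lintegral_cubeFrom_add {F : Torus n → ENNReal} (hF : Measurable F) (a : ℝ) (x : Torus n) :
    ∫⁻ z in cubeFrom n a, F (x + toTorus z) = ∫⁻ y, F y := by
  rw [(measurePreserving_toTorus a).lintegral_comp (f := fun y => F (x + y))
    (hF.comp (measurable_const_add x)), lintegral_add_left_eq_self]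

/-- The substitution `z ↦ t z` has Jacobian `t^n`, and the shrunken cube stays inside the original
one, which meets each point of the torus only once. -/
theorem lintegral_cubeFrom_smul_le {F : Torus n → ENNReal} (hF : Measurable F) (x : Torus n)
    {t : ℝ} (ht : 0 < t) (ht1 : t ≤ 1) :
    ∫⁻ z in cubeFrom n (-(1 / 2)), F (x + toTorus (t • z))
      ≤ ENNReal.ofReal ((t ^ n)⁻¹) * ∫⁻ y, F y := by
  have hG : Measurable fun z : Euc n => F (x + toTorus z) :=
    hF.comp ((measurable_const_add x).comp continuous_toTorus.measurable)
  have hm := measurableSet_cubeFrom (n := n) (-(1 / 2))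
  have h1 : ∫⁻ z in cubeFrom n (-(1 / 2)), F (x + toTorus (t • z))
      ≤ ∫⁻ z : Euc n, (cubeFrom n (-(1 / 2))).indicator (fun z => F (x + toTorus z)) (t • z) := by
    rw [← lintegral_indicator hm]
    refine lintegral_mono fun z => ?_
    by_cases hz : z ∈ cubeFrom n (-(1 / 2))
    · have hz' : t • z ∈ cubeFrom n (-(1 / 2)) := by
        intro i
        have := hz i
        simp only [PiLp.smul_apply, smul_eq_mul, Set.mem_Ico] at this ⊢
        constructor <;> nlinarith [this.1, this.2]
      rw [Set.indicator_of_mem hz, Set.indicator_of_mem hz']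
    · rw [Set.indicator_of_notMem hz]; exact zero_le
  refine h1.trans (le_of_eq ?_)
  rw [← lintegral_map (f := (cubeFrom n (-(1 / 2))).indicator (fun z => F (x + toTorus z)))
    (hG.indicator hm) (measurable_const_smul t), Measure.map_addHaar_smul _ ht.ne',
    lintegral_smul_measure, lintegral_indicator hm, lintegral_cubeFrom_add hF,
    finrank_euclideanSpace_fin, abs_of_pos (by positivity), smul_eq_mul]

/-- For fixed `t`, Jensen on the unit cube followed by rescaling bounds the average of `|∇g|` on the
cube of side `t` by `t^{-n/p} ‖∇g‖_p`. The condition `n < p` is what makes this power integrable on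
`(0, 1]`. -/
theorem exists_morrey_const (n : ℕ) {p : ℝ} (hp : 1 ≤ p) (hnp : (n : ℝ) < p) :
    ∃ C : ℝ, 0 ≤ C ∧ ∀ g : Torus n → ℝ, TorusContDiff 1 g → ∀ x,
      |g x - ∫ y, g y| ≤ C * ∑ i, (eLpNorm (torusPartial i g) (ENNReal.ofReal p) volume).toReal := by
  have hp0 : 0 < p := by linarith
  have hP1 : 1 ≤ ENNReal.ofReal p := by
    rw [← ENNReal.ofReal_one]; exact ENNReal.ofReal_le_ofReal hp
  set K : ENNReal := ∫⁻ t in Set.Ioc (0 : ℝ) 1, ENNReal.ofReal (t ^ (-(n / p : ℝ))) with hK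
  have hKtop : K ≠ ⊤ := by
    have h1 : IntervalIntegrable (fun t : ℝ => t ^ (-(n / p : ℝ))) volume 0 1 :=
      intervalIntegral.intervalIntegrable_rpow' (by
        have : (n : ℝ) / p < 1 := (div_lt_one hp0).2 hnp
        linarith)
    rw [intervalIntegrable_iff_integrableOn_Ioc_of_le zero_le_one] at h1
    refine ne_top_of_le_ne_top h1.2.ne (lintegral_mono fun t => ?_)
    exact Real.ofReal_le_enorm _
  refine ⟨K.toReal, ENNReal.toReal_nonneg, fun g hg x => ?_⟩
  have hpc : ∀ i, Continuous (torusPartial i g) := hg.continuous_partial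
  have hml : ∀ i, MemLp (torusPartial i g) (ENNReal.ofReal p) volume := fun i =>
    (hpc i).memLp_of_hasCompactSupport (HasCompactSupport.of_compactSpace _)
  set h : Torus n → ℝ := fun y => ∑ i, |torusPartial i g y| with hh
  have hc : Continuous h := continuous_finsetSum _ fun i _ => (hpc i).abs
  have hN : eLpNorm h (ENNReal.ofReal p) volume
      ≤ ∑ i, eLpNorm (torusPartial i g) (ENNReal.ofReal p) volume := by
    have : h = ∑ i, fun y => |torusPartial i g y| := by
      funext y; simp [hh]
    rw [this]
    refine (eLpNorm_sum_le (fun i _ => (hpc i).abs.aestronglyMeasurable) hP1).trans ?_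
    exact Finset.sum_le_sum fun i _ => (eLpNorm_norm (torusPartial i g)).le
  have hcube : IsProbabilityMeasure (volume.restrict (cubeFrom n (-(1 / 2)))) :=
    ⟨by rw [Measure.restrict_apply_univ, volume_cubeFrom]⟩
  have key : ‖g x - ∫ y, g y‖ₑ ≤ K * eLpNorm h (ENNReal.ofReal p) volume := by
    refine (enorm_sub_integral_le hg x).trans ?_
    rw [lintegral_lintegral_swap]
    · rw [hK, ← lintegral_mul_const _ (by fun_prop)]
      refine setLIntegral_mono' measurableSet_Ioc fun t ht => ?_
      have hct : Continuous fun z : Euc n => h (x + toTorus (t • z)) :=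
        hc.comp (continuous_const.add (continuous_toTorus.comp (by fun_prop)))
      have e1 := eLpNorm_le_eLpNorm_of_exponent_le hP1
        (hct.aestronglyMeasurable (μ := volume.restrict (cubeFrom n (-(1 / 2)))))
      rw [eLpNorm_one_eq_lintegral_enorm, eLpNorm_eq_lintegral_rpow_enorm_toReal
        (by simpa using hp0) ENNReal.ofReal_ne_top, ENNReal.toReal_ofReal hp0.le] at e1
      refine e1.trans ?_
      rw [eLpNorm_eq_lintegral_rpow_enorm_toReal
        (by simpa using hp0) ENNReal.ofReal_ne_top, ENNReal.toReal_ofReal hp0.le]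
      have e2 := lintegral_cubeFrom_smul_le (F := fun y => ‖h y‖ₑ ^ p)
        (hc.measurable.enorm.pow_const p) x ht.1 ht.2
      refine (ENNReal.rpow_le_rpow e2 (by positivity)).trans (le_of_eq ?_)
      rw [ENNReal.mul_rpow_of_nonneg _ _ (by positivity),
        ENNReal.ofReal_rpow_of_nonneg (by have := ht.1; positivity) (by positivity)]
      congr 2
      rw [← Real.rpow_natCast, ← Real.rpow_neg ht.1.le, ← Real.rpow_mul ht.1.le]
      congr 1
      field_simp
    · refine Measurable.aemeasurable ?_
      refine Continuous.measurable ?_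
      refine continuous_enorm.comp (hc.comp (continuous_const.add (continuous_toTorus.comp ?_)))
      fun_prop
  have hfin : ∀ i, eLpNorm (torusPartial i g) (ENNReal.ofReal p) volume ≠ ⊤ := fun i => (hml i).2.ne
  have key2 := key.trans (mul_le_mul_right hN K)
  rw [← Real.norm_eq_abs, ← toReal_enorm, ← ENNReal.toReal_sum fun i _ => hfin i,
    ← ENNReal.toReal_mul]
  exact ENNReal.toReal_mono (ENNReal.mul_ne_top hKtop (ENNReal.sum_ne_top.2 fun i _ => hfin i)) key2

/-- Squaring the segment formula by Jensen and integrating in `x` first, translation by `t z` drops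
out, so no power of `t` appears. The factor `n` comes from `(∑ |∂ᵢ g|)² ≤ n ∑ |∂ᵢ g|²`. -/
theorem poincare_torus {g : Torus n → ℝ} (hg : TorusContDiff 1 g) :
    ∫ x, (g x - ∫ y, g y) ^ 2 ≤ n * ∫ x, ∑ i, torusPartial i g x ^ 2 := by
  have hpc : ∀ i, Continuous (torusPartial i g) := hg.continuous_partial
  set h : Torus n → ℝ := fun y => ∑ i, |torusPartial i g y| with hh
  have hc : Continuous h := continuous_finsetSum _ fun i _ => (hpc i).abs
  have hcube : IsProbabilityMeasure (volume.restrict (cubeFrom n (-(1 / 2)))) :=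
    ⟨by rw [Measure.restrict_apply_univ, volume_cubeFrom]⟩
  have hIoc : IsProbabilityMeasure (volume.restrict (Set.Ioc (0 : ℝ) 1)) := ⟨by simp⟩
  set m := (volume.restrict (cubeFrom n (-(1 / 2)))).prod (volume.restrict (Set.Ioc (0 : ℝ) 1))
  have hjc : Continuous fun q : Torus n × (Euc n × ℝ) => h (q.1 + toTorus (q.2.2 • q.2.1)) :=
    hc.comp (continuous_fst.add (continuous_toTorus.comp (by fun_prop)))
  have hpt : ∀ x, ‖g x - ∫ y, g y‖ₑ ^ (2 : ℝ)
      ≤ ∫⁻ q, ‖h (x + toTorus (q.2 • q.1))‖ₑ ^ (2 : ℝ) ∂m := by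
    intro x
    have hct : Continuous fun q : Euc n × ℝ => h (x + toTorus (q.2 • q.1)) :=
      hc.comp (continuous_const.add (continuous_toTorus.comp (by fun_prop)))
    have e1 := eLpNorm_le_eLpNorm_of_exponent_le (one_le_two : (1 : ENNReal) ≤ 2)
        (hct.aestronglyMeasurable (μ := m))
    rw [eLpNorm_one_eq_lintegral_enorm, eLpNorm_eq_lintegral_rpow_enorm_toReal
        two_ne_zero ENNReal.ofNat_ne_top, lintegral_prod _ hct.measurable.enorm.aemeasurable] at e1
    have e2 := ENNReal.rpow_le_rpow ((enorm_sub_integral_le hg x).trans e1) (zero_le_two (α := ℝ))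
    rw [← ENNReal.rpow_mul] at e2
    simpa using e2
  have key : ∫⁻ x, ‖g x - ∫ y, g y‖ₑ ^ (2 : ℝ) ≤ ∫⁻ x, ‖h x‖ₑ ^ (2 : ℝ) := by
    refine (lintegral_mono hpt).trans ?_
    rw [lintegral_lintegral_swap (hjc.measurable.enorm.pow_const _).aemeasurable]
    have : ∀ q : Euc n × ℝ, ∫⁻ x, ‖h (x + toTorus (q.2 • q.1))‖ₑ ^ (2 : ℝ)
        = ∫⁻ x, ‖h x‖ₑ ^ (2 : ℝ) := fun q =>
      lintegral_add_right_eq_self (fun x => ‖h x‖ₑ ^ (2 : ℝ)) _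
    rw [lintegral_congr this]
    simp
  have conv : ∀ {φ : Torus n → ℝ}, Continuous φ →
      ∫⁻ x, ‖φ x‖ₑ ^ (2 : ℝ) = ENNReal.ofReal (∫ x, φ x ^ 2) := by
    intro φ hφ
    rw [ofReal_integral_eq_lintegral_ofReal (by fun_prop : Continuous fun x => φ x ^ 2).integrable_of_compact
      (ae_of_all _ fun x => sq_nonneg _)]
    refine lintegral_congr fun x => ?_
    rw [← ofReal_norm, ENNReal.ofReal_rpow_of_nonneg (norm_nonneg _) zero_le_two]
    simp
  rw [conv (φ := fun x => g x - ∫ y, g y) (hg.continuous.sub continuous_const), conv hc, ENNReal.ofReal_le_ofReal_iff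
    (integral_nonneg fun x => sq_nonneg _)] at key
  refine key.trans ?_
  rw [← integral_const_mul]
  refine integral_mono (hc.pow 2).integrable_of_compact
    (continuous_const.mul (continuous_finsetSum _ fun i _ => (hpc i).pow 2)).integrable_of_compact
    fun x => ?_
  have := sq_sum_le_card_mul_sum_sq (s := Finset.univ) (f := fun i => |torusPartial i g x|)
  simpa using this

end Morrey

/-! ### Weak derivatives -/

section WeakDeriv

variable {n : ℕ}

theorem HasWeakDeriv.apply {α : Fin n → ℕ} {u v : Torus n → Euc n} (h : HasWeakDeriv α u v)
    (j : Fin n) : HasWeakDeriv α (fun x => u x j) (fun x => v x j) := by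
  have hL : ∀ {w : Torus n → Euc n}, Integrable w → Integrable (fun x => w x j) := fun hw =>
    (EuclideanSpace.proj j : Euc n →L[ℝ] ℝ).integrable_comp hw
  have hI : ∀ {w : Torus n → Euc n}, Integrable w → (∫ x, w x) j = ∫ x, w x j := fun hw =>
    ((EuclideanSpace.proj j : Euc n →L[ℝ] ℝ).integral_comp_comm hw).symm
  refine ⟨hL h.1, hL h.2.1, fun g hg => ?_⟩
  have hb : ∀ {c : Torus n → ℝ}, Continuous c → ∀ {w : Torus n → Euc n}, Integrable w →
      Integrable (fun x => c x • w x) := by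
    intro c hc w hw
    obtain ⟨C, hC⟩ := isCompact_univ.exists_bound_of_continuousOn hc.continuousOn
    exact hw.bdd_smul C hc.aestronglyMeasurable (ae_of_all _ fun y => hC y (Set.mem_univ y))
  have h1 := congrArg (fun w : Euc n => w j) (h.2.2 g hg)
  have hgc : Continuous g := TorusContDiff.continuous hg
  have hdc : Continuous (multiDeriv α g) :=
    TorusContDiff.continuous (hg.listDeriv (List.finRange n) α)
  simp only [PiLp.smul_apply] at h1
  rwa [hI (hb hdc h.1), hI (hb hgc h.2.1)] at h1

theorem HasWeakDeriv.congr {α : Fin n → ℕ} {u v u' v' : Torus n → ℝ} (h : HasWeakDeriv α u v)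
    (hu : u =ᵐ[volume] u') (hv : v =ᵐ[volume] v') : HasWeakDeriv α u' v' := by
  refine ⟨h.1.congr hu, h.2.1.congr hv, fun g hg => ?_⟩
  have h1 : ∫ x, multiDeriv α g x • u' x = ∫ x, multiDeriv α g x • u x :=
    integral_congr_ae (by filter_upwards [hu] with x hx; rw [hx])
  have h2 : ∫ x, g x • v' x = ∫ x, g x • v x :=
    integral_congr_ae (by filter_upwards [hv] with x hx; rw [hx])
  rw [h1, h2, h.2.2 g hg]

theorem HasWeakDeriv.ae_unique {α : Fin n → ℕ} {u v v' : Torus n → ℝ} (h : HasWeakDeriv α u v)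
    (h' : HasWeakDeriv α u v') : v =ᵐ[volume] v' := by
  have := ae_eq_zero_of_integral_smooth_mul_eq_zero (h.2.1.sub h'.2.1) fun g hg => by
    have h1 := h.2.2 g hg
    rw [h'.2.2 g hg] at h1
    have h2 : ((-1 : ℝ) ^ ∑ i, α i) ≠ 0 := pow_ne_zero _ (by norm_num)
    have h3 := mul_left_cancel₀ h2 h1
    have hgc : Continuous g := TorusContDiff.continuous hg
    simp only [Pi.sub_apply, mul_sub]
    rw [integral_sub (integrable_mul_of_continuous_of_compact hgc h.2.1)
      (integrable_mul_of_continuous_of_compact hgc h'.2.1)]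
    simp only [smul_eq_mul] at h3
    rw [h3, sub_self]
  filter_upwards [this] with x hx
  simpa [sub_eq_zero] using hx

/-- Uniqueness of weak derivatives makes the arbitrary choice inside `weakDeriv` harmless. -/
theorem HasWeakDeriv.weakDeriv_ae {α : Fin n → ℕ} {u v : Torus n → ℝ} (h : HasWeakDeriv α u v) :
    weakDeriv α u =ᵐ[volume] v := by
  have hex : ∃ v, HasWeakDeriv α u v := ⟨v, h⟩
  rw [weakDeriv, dif_pos hex]
  exact hex.choose_spec.ae_unique h

theorem HasWeakDeriv.weakDeriv_ae_euc {α : Fin n → ℕ} {u v : Torus n → Euc n}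
    (h : HasWeakDeriv α u v) : weakDeriv α u =ᵐ[volume] v := by
  have hex : ∃ v, HasWeakDeriv α u v := ⟨v, h⟩
  rw [weakDeriv, dif_pos hex]
  have := ae_all_iff.2 fun j => (hex.choose_spec.apply j).ae_unique (h.apply j)
  filter_upwards [this] with x hx
  ext j
  exact hx j

theorem HasWeakDeriv.of_zero {u v : Torus n → ℝ} (h : HasWeakDeriv 0 u v) : v =ᵐ[volume] u := by
  refine h.ae_unique ⟨h.1, h.1, fun g hg => ?_⟩
  simp [multiDeriv_zero]

theorem hasWeakDeriv_zero {u : Torus n → ℝ} (h : Integrable u) : HasWeakDeriv 0 u u :=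
  ⟨h, h, fun g hg => by simp [multiDeriv_zero]⟩

/-- Test the first-order identity against `∂ⱼ g`. This lets Morrey be applied to the gradient of a
`W^{2,p}` function. -/
theorem HasWeakDeriv.of_single_add {i j : Fin n} {u v w : Torus n → ℝ}
    (h : HasWeakDeriv (Pi.single i 1 + Pi.single j 1) u v) (hw : HasWeakDeriv (Pi.single i 1) u w) :
    HasWeakDeriv (Pi.single j 1) w v := by
  refine ⟨hw.2.1, h.2.1, fun g hg => ?_⟩
  have h1 := h.2.2 g hg
  have h2 := hw.2.2 _ (hg.partial j)
  rw [multiDeriv_single_add hg] at h1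
  rw [multiDeriv_single] at h2 ⊢
  rw [h2] at h1
  simp [Finset.sum_add_distrib] at h1 ⊢
  linarith

theorem HasWeakDeriv.single_add {i j : Fin n} {u v w : Torus n → ℝ}
    (hw : HasWeakDeriv (Pi.single i 1) u w) (hv : HasWeakDeriv (Pi.single j 1) w v) :
    HasWeakDeriv (Pi.single i 1 + Pi.single j 1) u v := by
  refine ⟨hw.1, hv.2.1, fun g hg => ?_⟩
  have h1 := hv.2.2 g hg
  have h2 := hw.2.2 _ (hg.partial j)
  rw [multiDeriv_single_add hg]
  rw [multiDeriv_single] at h1 h2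
  rw [h2, h1]
  simp [Finset.sum_add_distrib]

theorem TorusContDiff.hasWeakDeriv {g : Torus n → ℝ} (hg : TorusContDiff 1 g) (i : Fin n) :
    HasWeakDeriv (Pi.single i 1) g (torusPartial i g) := by
  refine ⟨hg.continuous.integrable_of_compact, (hg.continuous_partial i).integrable_of_compact,
    fun h hh => ?_⟩
  rw [multiDeriv_single]
  simpa using integral_torusPartial_mul (hh.torusContDiff 1) hg i

theorem zero_mem_multiIndices (k : ℕ) : (0 : Fin n → ℕ) ∈ multiIndices n k := by
  simp [multiIndices]

theorem single_mem_multiIndices (i : Fin n) :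
    (Pi.single i 1 : Fin n → ℕ) ∈ multiIndices n 2 := by
  simp only [multiIndices, Finset.mem_filter, Fintype.mem_piFinset, Finset.mem_range,
    Finset.sum_pi_single', Finset.mem_univ, if_true]
  refine ⟨fun j => ?_, by norm_num⟩
  by_cases h : j = i <;> simp [h]

theorem single_add_mem_multiIndices (i j : Fin n) :
    (Pi.single i 1 + Pi.single j 1 : Fin n → ℕ) ∈ multiIndices n 2 := by
  have hs : ∑ l, (Pi.single i 1 + Pi.single j 1 : Fin n → ℕ) l = 2 := by
    simp [Finset.sum_add_distrib]
  simp only [multiIndices, Finset.mem_filter, Fintype.mem_piFinset, Finset.mem_range]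
  refine ⟨fun l => ?_, hs.le⟩
  have := Finset.single_le_sum (f := (Pi.single i 1 + Pi.single j 1 : Fin n → ℕ))
    (fun l _ => Nat.zero_le _) (Finset.mem_univ l)
  omega

theorem mem_multiIndices_two {α : Fin n → ℕ} (h : α ∈ multiIndices n 2) :
    α = 0 ∨ (∃ i, α = Pi.single i 1) ∨ ∃ i j, α = Pi.single i 1 + Pi.single j 1 := by
  have hs : ∑ l, α l ≤ 2 := (Finset.mem_filter.1 h).2
  have peel : ∀ β : Fin n → ℕ, β ≠ 0 → ∃ i, ∃ γ : Fin n → ℕ, β = Pi.single i 1 + γ ∧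
      ∑ l, β l = 1 + ∑ l, γ l := by
    intro β hβ
    obtain ⟨i, hi⟩ := Function.ne_iff.1 hβ
    have hβe : β = Pi.single i 1 + (β - Pi.single i 1) := by
      funext l
      by_cases hl : l = i
      · subst hl
        have : 1 ≤ β l := Nat.one_le_iff_ne_zero.2 hi
        simp; omega
      · simp [hl]
    refine ⟨i, _, hβe, ?_⟩
    conv_lhs => rw [hβe]
    simp [Finset.sum_add_distrib]
  by_cases h0 : α = 0
  · exact Or.inl h0
  obtain ⟨i, β, rfl, hβ⟩ := peel α h0
  by_cases h1 : β = 0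
  · exact Or.inr (Or.inl ⟨i, by rw [h1, add_zero]⟩)
  obtain ⟨j, γ, rfl, hγ⟩ := peel β h1
  have hγ0 : γ = 0 := by
    funext l
    have := Finset.single_le_sum (f := γ) (fun l _ => Nat.zero_le _) (Finset.mem_univ l)
    simp only [Pi.zero_apply]
    omega
  exact Or.inr (Or.inr ⟨i, j, by rw [hγ0, add_zero]⟩)

end WeakDeriv

/-! ### The embedding of `W^{2,p}` into `C¹` -/

section Embedding

variable {n : ℕ}

theorem tendsto_integral_torusConv {u : Torus n → ℝ} (hu : Integrable u) :
    Tendsto (fun k => ∫ x, torusConv (torusKernel k) u x) atTop (𝓝 (∫ x, u x)) := by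
  refine tendsto_integral_of_L1' u hu.1 (Eventually.of_forall fun k =>
    (torusConv_continuous (torusKernel_continuous k) hu).integrable_of_compact)
    (tendsto_eLpNorm_torusConv le_rfl ENNReal.one_ne_top (memLp_one_iff_integrable.2 hu))

theorem tendsto_toReal_eLpNorm_torusConv {p : ENNReal} (hp : 1 ≤ p) (hp' : p ≠ ⊤)
    {u : Torus n → ℝ} (hu : MemLp u p) :
    Tendsto (fun k => (eLpNorm (torusConv (torusKernel k) u - u) p volume).toReal) atTop (𝓝 0) := by
  have := (ENNReal.tendsto_toReal ENNReal.zero_ne_top).comp (tendsto_eLpNorm_torusConv hp hp' hu)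
  rwa [ENNReal.toReal_zero] at this

theorem memLp_torusConv {p : ENNReal} {u : Torus n → ℝ} (hu : Integrable u) (k : ℕ) :
    MemLp (torusConv (torusKernel k) u) p volume :=
  (torusConv_continuous (torusKernel_continuous k) hu).memLp_of_hasCompactSupport
    (HasCompactSupport.of_compactSpace _)

/-- Morrey applied to differences of mollifications makes them uniformly Cauchy, since their means
and the `L^p` norms of their gradients converge. The uniform limit is continuous, coincides with the
`L¹` limit `u` almost everywhere, and inherits the bound. -/
theorem exists_continuous_rep {p C : ℝ} (hp : 1 ≤ p) (hC0 : 0 ≤ C)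
    (hC : ∀ g : Torus n → ℝ, TorusContDiff 1 g → ∀ x,
      |g x - ∫ y, g y| ≤ C * ∑ i, (eLpNorm (torusPartial i g) (ENNReal.ofReal p) volume).toReal)
    {u : Torus n → ℝ} {w : Fin n → Torus n → ℝ}
    (h : ∀ i, HasWeakDeriv (Pi.single i 1) u (w i)) (hu : Integrable u)
    (hw : ∀ i, MemLp (w i) (ENNReal.ofReal p)) :
    ∃ U : Torus n → ℝ, Continuous U ∧ u =ᵐ[volume] U ∧
      TendstoUniformly (fun k => torusConv (torusKernel k) u) U atTop ∧
      ∀ x, |U x| ≤ |∫ y, u y| + C * ∑ i, (eLpNorm (w i) (ENNReal.ofReal p) volume).toReal := by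
  have hP1 : 1 ≤ ENNReal.ofReal p := by
    rw [← ENNReal.ofReal_one]; exact ENNReal.ofReal_le_ofReal hp
  have hPt : ENNReal.ofReal p ≠ ⊤ := ENNReal.ofReal_ne_top
  set a : ℕ → Torus n → ℝ := fun k => torusConv (torusKernel k) u with ha
  have ha1 : ∀ k, TorusContDiff 1 (a k) := fun k =>
    (torusConv_smooth (torusKernel_smooth k) hu).torusContDiff 1
  have hap : ∀ k i, torusPartial i (a k) = torusConv (torusKernel k) (w i) := fun k i =>
    torusPartial_torusConv (torusKernel_smooth k) (h i)
  -- The error of the `k`-th mollification against `u` itself, in the mean and in the gradient; by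
  -- the triangle inequality two mollifications differ by at most `e k + e l`.
  set e : ℕ → ℝ := fun k => |∫ x, a k x - ∫ x, u x| + C * ∑ i,
    (eLpNorm (torusConv (torusKernel k) (w i) - w i) (ENNReal.ofReal p) volume).toReal with he
  have he0 : Tendsto e atTop (𝓝 0) := by
    have h1 : Tendsto (fun k => |∫ x, a k x - ∫ x, u x|) atTop (𝓝 0) := by
      have h2 := ((tendsto_integral_torusConv hu).sub_const (∫ x, u x)).abs
      simp only [sub_self, abs_zero] at h2
      refine h2.congr fun k => ?_
      rw [integral_sub (ha1 k).continuous.integrable_of_compact (integrable_const _)]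
      simp [ha]
    have h2 := (tendsto_finsetSum (Finset.univ : Finset (Fin n)) fun i _ =>
      tendsto_toReal_eLpNorm_torusConv hP1 hPt (hw i)).const_mul C
    simpa [he] using h1.add h2
  have hd : ∀ k l x, |a k x - a l x| ≤ e k + e l := by
    intro k l x
    have h1 := hC _ ((ha1 k).sub (ha1 l)) x
    have hfin : ∀ k i, eLpNorm (torusConv (torusKernel k) (w i) - w i) (ENNReal.ofReal p) volume ≠ ⊤ :=
      fun k i => ((memLp_torusConv (h i).2.1 k).sub (hw i)).2.ne
    have h2 : ∀ i, (eLpNorm (torusPartial i fun x => a k x - a l x) (ENNReal.ofReal p) volume).toReal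
        ≤ (eLpNorm (torusConv (torusKernel k) (w i) - w i) (ENNReal.ofReal p) volume).toReal +
          (eLpNorm (torusConv (torusKernel l) (w i) - w i) (ENNReal.ofReal p) volume).toReal := by
      intro i
      have e1 : (torusPartial i fun x => a k x - a l x)
          = (torusConv (torusKernel k) (w i) - w i) - (torusConv (torusKernel l) (w i) - w i) := by
        funext y
        rw [torusPartial_sub (ha1 k) (ha1 l), hap, hap]
        simp
      rw [e1, ← ENNReal.toReal_add (hfin k i) (hfin l i)]
      refine ENNReal.toReal_mono (ENNReal.add_ne_top.2 ⟨hfin k i, hfin l i⟩) ?_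
      exact eLpNorm_sub_le ((memLp_torusConv (p := ENNReal.ofReal p) (h i).2.1 k).sub (hw i)).1
        ((memLp_torusConv (p := ENNReal.ofReal p) (h i).2.1 l).sub (hw i)).1 hP1
    have h3 := mul_le_mul_of_nonneg_left (Finset.sum_le_sum fun i (_ : i ∈ Finset.univ) => h2 i) hC0
    rw [Finset.sum_add_distrib, mul_add] at h3
    have hik := (ha1 k).continuous.integrable_of_compact (m := volume)
    have hil := (ha1 l).continuous.integrable_of_compact (m := volume)
    rw [integral_sub hik hil] at h1
    have h4 : |∫ x, a k x - ∫ x, u x| = |(∫ x, a k x) - ∫ x, u x| := by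
      rw [integral_sub hik (integrable_const _)]; simp
    have h5 : |∫ x, a l x - ∫ x, u x| = |(∫ x, a l x) - ∫ x, u x| := by
      rw [integral_sub hil (integrable_const _)]; simp
    simp only [he, h4, h5]
    have h6 : |a k x - a l x| ≤ |a k x - a l x - ((∫ y, a k y) - ∫ y, a l y)|
        + (|(∫ x, a k x) - ∫ x, u x| + |(∫ x, a l x) - ∫ x, u x|) := by
      have t1 := abs_add_le (a k x - a l x - ((∫ y, a k y) - ∫ y, a l y))
        ((∫ y, a k y) - ∫ y, a l y)
      have t2 := abs_sub ((∫ x, a k x) - ∫ x, u x) ((∫ x, a l x) - ∫ x, u x)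
      simp only [sub_add_cancel, sub_sub_sub_cancel_right] at t1 t2
      linarith
    linarith
  have hlim : ∀ x, ∃ l, Tendsto (fun k => a k x) atTop (𝓝 l) := by
    intro x
    refine cauchySeq_tendsto_of_complete (Metric.cauchySeq_iff.2 fun ε hε => ?_)
    obtain ⟨N, hN⟩ := eventually_atTop.1 (he0.eventually_lt_const (half_pos hε))
    refine ⟨N, fun k hk l hl => ?_⟩
    rw [Real.dist_eq]
    linarith [hd k l x, hN k hk, hN l hl]
  choose U hU using hlim
  have hdU : ∀ k x, |a k x - U x| ≤ e k := by
    intro k x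
    have h1 : Tendsto (fun l => |a k x - a l x|) atTop (𝓝 |a k x - U x|) :=
      ((hU x).const_sub _).abs
    have h2 : Tendsto (fun l => e k + e l) atTop (𝓝 (e k)) := by
      simpa using he0.const_add (e k)
    exact le_of_tendsto_of_tendsto' h1 h2 fun l => hd k l x
  have hunif : TendstoUniformly a U atTop := by
    rw [Metric.tendstoUniformly_iff]
    intro ε hε
    filter_upwards [he0.eventually_lt_const hε] with k hk x
    rw [dist_comm, Real.dist_eq]
    exact (hdU k x).trans_lt hk
  have hUc : Continuous U := hunif.continuous (Frequently.of_forall fun k => (ha1 k).continuous)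
  refine ⟨U, hUc, ?_, hunif, ?_⟩
  · have h1 := tendsto_eLpNorm_torusConv le_rfl ENNReal.one_ne_top (memLp_one_iff_integrable.2 hu)
    have h2 : Tendsto (fun k => ENNReal.ofReal (e k)) atTop (𝓝 0) := by
      simpa using ENNReal.tendsto_ofReal he0
    have h3 := h1.add h2
    rw [add_zero] at h3
    have h4 : ∀ k, eLpNorm (u - U) 1 volume
        ≤ eLpNorm (torusConv (torusKernel k) u - u) 1 volume + ENNReal.ofReal (e k) := by
      intro k
      have e1 : u - U = (a k - U) - (a k - u) := by simp
      rw [e1]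
      refine (eLpNorm_sub_le ((ha1 k).continuous.sub hUc).aestronglyMeasurable
        ((ha1 k).continuous.aestronglyMeasurable.sub hu.1) le_rfl).trans ?_
      rw [add_comm]
      refine add_le_add le_rfl ?_
      have := eLpNorm_le_of_ae_bound (p := 1) (μ := (volume : Measure (Torus n)))
        (f := a k - U) (C := e k) (ae_of_all _ fun x => hdU k x)
      simpa using this
    have h5 : eLpNorm (u - U) 1 volume = 0 :=
      le_antisymm (ge_of_tendsto' h3 h4) zero_le
    have h6 := (eLpNorm_eq_zero_iff (hu.1.sub hUc.aestronglyMeasurable) one_ne_zero).1 h5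
    filter_upwards [h6] with x hx
    simpa [sub_eq_zero] using hx
  · intro x
    have h1 : ∀ k, |a k x| ≤ |∫ y, a k y|
        + C * ∑ i, (eLpNorm (w i) (ENNReal.ofReal p) volume).toReal := by
      intro k
      have h2 := hC _ (ha1 k) x
      have h3 := abs_add_le (a k x - ∫ y, a k y) (∫ y, a k y)
      rw [sub_add_cancel] at h3
      have h4 : ∀ i, (eLpNorm (torusPartial i (a k)) (ENNReal.ofReal p) volume).toReal
          ≤ (eLpNorm (w i) (ENNReal.ofReal p) volume).toReal := by
        intro i
        rw [hap]
        exact ENNReal.toReal_mono (hw i).2.ne (eLpNorm_torusConv_le (torusKernel_continuous k)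
          (torusKernel_nonneg k) (integral_torusKernel k) hP1 hPt (hw i))
      have h5 := mul_le_mul_of_nonneg_left (Finset.sum_le_sum fun i (_ : i ∈ Finset.univ) => h4 i) hC0
      linarith
    exact le_of_tendsto_of_tendsto' (hU x).abs
      ((tendsto_integral_torusConv hu).abs.add_const _) h1

/-- The mollifications of `u` and of its weak gradient both converge uniformly, so the limit of the
functions is differentiable with the limit of the gradients as its gradient. -/
theorem exists_contDiff_rep {p C : ℝ} (hp : 1 ≤ p) (hC0 : 0 ≤ C)
    (hC : ∀ g : Torus n → ℝ, TorusContDiff 1 g → ∀ x,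
      |g x - ∫ y, g y| ≤ C * ∑ i, (eLpNorm (torusPartial i g) (ENNReal.ofReal p) volume).toReal)
    {u : Torus n → ℝ} {w : Fin n → Torus n → ℝ} {z : Fin n → Fin n → Torus n → ℝ}
    (h : ∀ i, HasWeakDeriv (Pi.single i 1) u (w i)) (hu : Integrable u)
    (h' : ∀ i j, HasWeakDeriv (Pi.single j 1) (w i) (z i j))
    (hw : ∀ i, MemLp (w i) (ENNReal.ofReal p)) (hz : ∀ i j, MemLp (z i j) (ENNReal.ofReal p)) :
    ∃ U : Torus n → ℝ, TorusContDiff 1 U ∧ u =ᵐ[volume] U ∧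
      (∀ i, w i =ᵐ[volume] torusPartial i U) ∧
      (∀ x, |U x| ≤ |∫ y, u y| + C * ∑ i, (eLpNorm (w i) (ENNReal.ofReal p) volume).toReal) ∧
      ∀ i x, |torusPartial i U x| ≤ |∫ y, w i y|
        + C * ∑ j, (eLpNorm (z i j) (ENNReal.ofReal p) volume).toReal := by
  obtain ⟨U, hUc, huU, hUu, hUb⟩ := exists_continuous_rep hp hC0 hC h hu hw
  choose W hWc hwW hWu hWb using fun i =>
    exists_continuous_rep hp hC0 hC (h' i) (h i).2.1 (hz i)
  have hder : ∀ v : Euc n, HasFDerivAt (fun v : Euc n => U (toTorus v))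
      (∑ i, W i (toTorus v) • (EuclideanSpace.proj i : Euc n →L[ℝ] ℝ)) v := by
    refine hasFDerivAt_of_tendstoUniformly (l := atTop)
      (f := fun k v => torusConv (torusKernel k) u (toTorus v))
      (f' := fun k v => ∑ i, torusConv (torusKernel k) (w i) (toTorus v) •
        (EuclideanSpace.proj i : Euc n →L[ℝ] ℝ)) ?_ ?_ ?_
    · rw [Metric.tendstoUniformly_iff]
      intro ε hε
      have hpos : 0 < ε / (n + 1) := by positivity
      have := eventually_all.2 fun i =>
        Metric.tendstoUniformly_iff.1 (hWu i) (ε / (n + 1)) hpos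
      filter_upwards [this] with k hk v
      rw [dist_eq_norm, ← Finset.sum_sub_distrib]
      have hb : ∀ i, ‖W i (toTorus v) • (EuclideanSpace.proj i : Euc n →L[ℝ] ℝ)
          - torusConv (torusKernel k) (w i) (toTorus v) • (EuclideanSpace.proj i : Euc n →L[ℝ] ℝ)‖
          ≤ ε / (n + 1) := by
        intro i
        rw [← sub_smul, norm_smul]
        have h1 : ‖(EuclideanSpace.proj i : Euc n →L[ℝ] ℝ)‖ ≤ 1 :=
          ContinuousLinearMap.opNorm_le_bound _ zero_le_one fun v => by
            simpa using PiLp.norm_apply_le v i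
        have h2 := hk i (toTorus v)
        rw [dist_eq_norm] at h2
        calc _ ≤ ε / (n + 1) * 1 := mul_le_mul h2.le h1 (norm_nonneg _) hpos.le
          _ = _ := mul_one _
      refine (norm_sum_le _ _).trans_lt ?_
      refine (Finset.sum_le_sum fun i _ => hb i).trans_lt ?_
      simp only [Finset.sum_const, Finset.card_univ, Fintype.card_fin, nsmul_eq_mul]
      rw [mul_div_assoc', div_lt_iff₀ (by positivity)]
      nlinarith
    · intro k v
      have h1 := ((torusConv_smooth (torusKernel_smooth k) hu).torusContDiff 1).hasFDerivAt v
      simp_rw [fun i => torusPartial_torusConv (torusKernel_smooth k) (h i)] at h1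
      exact h1
    · exact fun v => hUu.tendsto_at (toTorus v)
  obtain ⟨h1, h2⟩ := torusContDiff_one_of_hasFDerivAt hWc hder
  exact ⟨U, h1, huU, fun i => by rw [h2 i]; exact hwW i, hUb, fun i x => by rw [h2 i]; exact hWb i x⟩

theorem MemSobolev.hasWeakDeriv {k : ℕ} {p : ℝ} {u : Torus n → Euc n} (h : MemSobolev k p u)
    {α : Fin n → ℕ} (hα : α ∈ multiIndices n k) :
    HasWeakDeriv α u (weakDeriv α u) ∧ MemLp (weakDeriv α u) (ENNReal.ofReal p) := by
  obtain ⟨v, hv, hvp⟩ := h α hα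
  have hex : ∃ v, HasWeakDeriv α u v := ⟨v, hv⟩
  refine ⟨?_, (memLp_congr_ae hv.weakDeriv_ae_euc).2 hvp⟩
  rw [weakDeriv, dif_pos hex]
  exact hex.choose_spec

theorem MemSobolev.toReal_eLpNorm_le {k : ℕ} {p : ℝ} (hp : 0 < p) {u : Torus n → Euc n}
    (h : MemSobolev k p u) {α : Fin n → ℕ} (hα : α ∈ multiIndices n k) :
    (eLpNorm (weakDeriv α u) (ENNReal.ofReal p) volume).toReal ≤ sobolevNorm k p u := by
  have h1 := (h.hasWeakDeriv hα).2
  rw [h1.eLpNorm_eq_integral_rpow_norm (by simpa using hp) ENNReal.ofReal_ne_top,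
    ENNReal.toReal_ofReal hp.le]
  have h0 : ∀ β, 0 ≤ ∫ x, ‖weakDeriv β u x‖ ^ p := fun β =>
    integral_nonneg fun x => Real.rpow_nonneg (norm_nonneg _) p
  rw [ENNReal.toReal_ofReal (Real.rpow_nonneg (h0 α) _), sobolevNorm, one_div]
  refine Real.rpow_le_rpow (h0 α) ?_ (by positivity)
  exact Finset.single_le_sum (f := fun β => ∫ x, ‖weakDeriv β u x‖ ^ p) (fun β _ => h0 β) hα

/-- `W^{2,p} ⊆ C¹` for `p > n`. -/
theorem exists_sobolev_embedding_const {p : ℝ} (hp : 1 ≤ p) (hnp : (n : ℝ) < p) :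
    ∃ C : ℝ, 0 < C ∧ ∀ u : Torus n → Euc n, MemSobolev 2 p u →
      ∃ U : Torus n → Euc n, u =ᵐ[volume] U ∧ (∀ j, TorusContDiff 1 fun x => U x j) ∧
        (∀ x j, |U x j| ≤ C * sobolevNorm 2 p u) ∧
        ∀ i j x, |torusPartial i (fun x => U x j) x| ≤ C * sobolevNorm 2 p u := by
  obtain ⟨C, hC0, hC⟩ := exists_morrey_const n hp hnp
  have hp0 : 0 < p := by linarith
  have hP1 : 1 ≤ ENNReal.ofReal p := by
    rw [← ENNReal.ofReal_one]; exact ENNReal.ofReal_le_ofReal hp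
  -- The `1` pays for the mean, the `C * n` for the Morrey oscillation with `n` partial derivatives,
  -- each of `L^p` norm at most `N`.
  refine ⟨1 + C * n, by positivity, fun u hu => ?_⟩
  set N := sobolevNorm 2 p u with hN
  have hml : ∀ {α : Fin n → ℕ}, α ∈ multiIndices n 2 → ∀ j,
      MemLp (fun x => weakDeriv α u x j) (ENNReal.ofReal p) volume ∧
      (eLpNorm (fun x => weakDeriv α u x j) (ENNReal.ofReal p) volume).toReal ≤ N := by
    intro α hα j
    have h1 := (hu.hasWeakDeriv hα).2
    have hle : eLpNorm (fun x => weakDeriv α u x j) (ENNReal.ofReal p) volume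
        ≤ eLpNorm (weakDeriv α u) (ENNReal.ofReal p) volume :=
      eLpNorm_mono fun x => PiLp.norm_apply_le _ j
    refine ⟨⟨((EuclideanSpace.proj j : Euc n →L[ℝ] ℝ).continuous.comp_aestronglyMeasurable h1.1),
      hle.trans_lt h1.2⟩, ?_⟩
    exact (ENNReal.toReal_mono h1.2.ne hle).trans (hu.toReal_eLpNorm_le hp0 hα)
  have hint : ∀ {w : Torus n → ℝ}, MemLp w (ENNReal.ofReal p) volume →
      |∫ x, w x| ≤ (eLpNorm w (ENNReal.ofReal p) volume).toReal := by
    intro w hw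
    rw [← Real.norm_eq_abs, ← toReal_enorm]
    refine ENNReal.toReal_mono hw.2.ne ?_
    refine (enorm_integral_le_lintegral_enorm _).trans ?_
    rw [← eLpNorm_one_eq_lintegral_enorm]
    exact eLpNorm_le_eLpNorm_of_exponent_le hP1 hw.1
  have hsum : ∀ c : Fin n → ℝ, (∀ i, c i ≤ N) → C * ∑ i, c i ≤ C * n * N := by
    intro c hc
    have := Finset.sum_le_sum fun i (_ : i ∈ Finset.univ) => hc i
    rw [Finset.sum_const, Finset.card_univ, Fintype.card_fin, nsmul_eq_mul] at this
    rw [mul_assoc]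
    exact mul_le_mul_of_nonneg_left this hC0
  have h1 := fun i => (hu.hasWeakDeriv (single_mem_multiIndices i)).1
  have hrep := fun j => exists_contDiff_rep hp hC0 hC (fun i => (h1 i).apply j)
    ((hu.hasWeakDeriv (zero_mem_multiIndices 2)).1.apply j).1
    (fun i l => ((hu.hasWeakDeriv (single_add_mem_multiIndices i l)).1.apply j).of_single_add
      ((h1 i).apply j))
    (fun i => (hml (single_mem_multiIndices i) j).1)
    (fun i l => (hml (single_add_mem_multiIndices i l) j).1)
  choose U hU huU hwU hb hb' using hrep
  refine ⟨fun x => WithLp.toLp 2 fun j => U j x, ?_, hU, fun x j => ?_, fun i j x => ?_⟩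
  · filter_upwards [ae_all_iff.2 huU] with x hx
    ext j
    exact hx j
  · refine (hb j x).trans ?_
    have h2 : |∫ y, u y j| ≤ N := by
      have h3 : (fun y => u y j) =ᵐ[volume] fun y => weakDeriv 0 u y j :=
        ((hu.hasWeakDeriv (zero_mem_multiIndices 2)).1.apply j).of_zero.symm
      rw [integral_congr_ae h3]
      exact (hint (hml (zero_mem_multiIndices 2) j).1).trans (hml (zero_mem_multiIndices 2) j).2
    have h4 := hsum _ fun i => (hml (single_mem_multiIndices i) j).2
    linarith
  · refine (hb' j i x).trans ?_
    have h2 := (hint (hml (single_mem_multiIndices i) j).1).trans (hml (single_mem_multiIndices i) j).2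
    have h4 := hsum _ fun l => (hml (single_add_mem_multiIndices i l) j).2
    linarith

end Embedding

/-! ### Bochner's identity and the spectral gap -/

section Bochner

variable {n : ℕ}

theorem TorusContDiff.exp_neg {k : WithTop ℕ∞} {W : Torus n → ℝ} (hW : TorusContDiff k W) :
    TorusContDiff k (fun x => Real.exp (-W x)) := ContDiff.exp (ContDiff.neg hW)

/-- The adjoint of `∂ᵢ` in the weighted space is `-(∂ᵢ - ∂ᵢW)`. -/
theorem integral_torusPartial_mul_exp {W g h : Torus n → ℝ} (hW : TorusContDiff 1 W)
    (hg : TorusContDiff 1 g) (hh : TorusContDiff 1 h) (i : Fin n) :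
    ∫ x, torusPartial i g x * h x * Real.exp (-W x)
      = -∫ x, g x * (torusPartial i h x - torusPartial i W x * h x) * Real.exp (-W x) := by
  have h1 := integral_torusPartial_mul hg (hh.mul hW.exp_neg) i
  simp_rw [torusPartial_mul hh hW.exp_neg, torusPartial_exp_neg hW] at h1
  calc _ = ∫ x, torusPartial i g x * (h x * Real.exp (-W x)) := by simp_rw [mul_assoc]
    _ = _ := by
      rw [h1]
      congr 1
      refine integral_congr_ae (ae_of_all _ fun x => ?_)
      simp only []
      ring

/-- The `(i, j)` part of Bochner's identity `∫ (Lφ)² e^{-W} = ∫ (|∇²φ|² + ⟨∇φ, ∇²W ∇φ⟩) e^{-W}`. One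
integration by parts moves `∂ᵢ` onto the factor `δ` belonging to `j`. Commuting it past `∂ⱼW`
creates the Hessian of `W`, and a second integration by parts, in `j`, removes the third derivative
of `φ`. -/
theorem bochner_pair {W φ : Torus n → ℝ} (hW : TorusContDiff 2 W) (hφ : TorusSmooth φ)
    (i j : Fin n) :
    ∫ x, (torusPartial i (torusPartial i φ) x - torusPartial i W x * torusPartial i φ x) *
        (torusPartial j (torusPartial j φ) x - torusPartial j W x * torusPartial j φ x) *
        Real.exp (-W x)
      = ∫ x, (torusPartial i (torusPartial j φ) x ^ 2 + torusPartial i (torusPartial j W) x *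
        torusPartial i φ x * torusPartial j φ x) * Real.exp (-W x) := by
  have hW1 : TorusContDiff 1 W := hW.of_le (by norm_num)
  have hWj : TorusContDiff 1 (torusPartial j W) := hW.partial (by norm_num) j
  have hWjc := hWj.continuous
  have hWij : Continuous (torusPartial i (torusPartial j W)) := hWj.continuous_partial i
  have hWc := hW.continuous
  have hc : ∀ {g : Torus n → ℝ}, TorusSmooth g → TorusContDiff 1 g := fun h => h.torusContDiff 1
  have hφi := hφ.partial i
  have hφj := hφ.partial j
  have hψ := hφj.partial i
  have hφjj := hφj.partial j
  have cφi := (hc hφi).continuous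
  have cφj := (hc hφj).continuous
  have cψ := (hc hψ).continuous
  have cψj := (hc (hψ.partial j)).continuous
  have hI : ∀ {g : Torus n → ℝ}, Continuous g → Integrable g := fun h => h.integrable_of_compact
  set δ : Torus n → ℝ := fun x => torusPartial j (torusPartial j φ) x
    - torusPartial j W x * torusPartial j φ x with hδ
  have hδ1 : TorusContDiff 1 δ := (hc hφjj).sub (hWj.mul (hc hφj))
  have s1 := integral_torusPartial_mul_exp hW1 hδ1 (hc hφi) i
  have s2 := integral_torusPartial_mul_exp hW1 (hc hψ) (hc hφi) j
  have hcomm1 : torusPartial j (torusPartial i φ) = torusPartial i (torusPartial j φ) :=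
    torusPartial_comm (hφ.torusContDiff 2) j i
  have hcomm2 : torusPartial i (torusPartial j (torusPartial j φ))
      = torusPartial j (torusPartial i (torusPartial j φ)) :=
    torusPartial_comm (hφj.torusContDiff 2) i j
  have hδi : ∀ x, torusPartial i δ x = torusPartial j (torusPartial i (torusPartial j φ)) x
      - (torusPartial i (torusPartial j W) x * torusPartial j φ x
        + torusPartial j W x * torusPartial i (torusPartial j φ) x) := by
    intro x
    rw [hδ, torusPartial_sub (hc hφjj) (hWj.mul (hc hφj)), torusPartial_mul hWj (hc hφj), hcomm2]
  rw [hcomm1] at s2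
  simp_rw [hδi] at s1
  have e1 : ∫ x, (torusPartial j (torusPartial i (torusPartial j φ)) x
      - (torusPartial i (torusPartial j W) x * torusPartial j φ x
        + torusPartial j W x * torusPartial i (torusPartial j φ) x)) * torusPartial i φ x
        * Real.exp (-W x)
      = (∫ x, torusPartial j (torusPartial i (torusPartial j φ)) x * torusPartial i φ x
        * Real.exp (-W x)) - ∫ x, (torusPartial i (torusPartial j W) x * torusPartial j φ x
        + torusPartial j W x * torusPartial i (torusPartial j φ) x) * torusPartial i φ x
        * Real.exp (-W x) := by
    rw [← integral_sub (hI (by fun_prop)) (hI (by fun_prop))]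
    congr 1; funext x; ring
  rw [e1, s2] at s1
  have e2 : (∫ x, torusPartial i (torusPartial j φ) x * (torusPartial i (torusPartial j φ) x
        - torusPartial j W x * torusPartial i φ x) * Real.exp (-W x))
      + ∫ x, (torusPartial i (torusPartial j W) x * torusPartial j φ x
        + torusPartial j W x * torusPartial i (torusPartial j φ) x) * torusPartial i φ x
        * Real.exp (-W x)
      = ∫ x, (torusPartial i (torusPartial j φ) x ^ 2 + torusPartial i (torusPartial j W) x *
        torusPartial i φ x * torusPartial j φ x) * Real.exp (-W x) := by
    rw [← integral_add (hI (by fun_prop)) (hI (by fun_prop))]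
    congr 1; funext x; ring
  rw [← e2]
  have e3 : ∫ x, (torusPartial i (torusPartial i φ) x - torusPartial i W x * torusPartial i φ x) *
        δ x * Real.exp (-W x)
      = ∫ x, δ x * (torusPartial i (torusPartial i φ) x - torusPartial i W x * torusPartial i φ x)
        * Real.exp (-W x) := by
    congr 1; funext x; ring
  rw [e3]
  linarith

/-- The Poincaré inequality for the gradient, with respect to the weight `e^{-W}`. -/
theorem spectral_gap_smooth (hn : 0 < n) {W φ : Torus n → ℝ} (hW : TorusContDiff 2 W)
    (hφ : TorusSmooth φ) {B : ℝ} (hB : ∀ x, |W x| ≤ B) :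
    ∫ x, (∑ i, torusPartial i φ x ^ 2) * Real.exp (-W x)
      ≤ n * Real.exp (2 * B) * ∫ x, ((∑ i, ∑ j, torusPartial i (torusPartial j φ) x ^ 2)
        + ∑ i, ∑ j, torusPartial i (torusPartial j W) x * torusPartial i φ x * torusPartial j φ x)
        * Real.exp (-W x) := by
  have hW1 : TorusContDiff 1 W := hW.of_le (by norm_num)
  have hWc := hW.continuous
  have hWi : ∀ i, Continuous (torusPartial i W) := hW1.continuous_partial
  have hWij : ∀ i j, Continuous (torusPartial i (torusPartial j W)) := fun i j =>
    (hW.partial (k := 1) (by norm_num) j).continuous_partial i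
  have hc : ∀ {g : Torus n → ℝ}, TorusSmooth g → TorusContDiff 1 g := fun h => h.torusContDiff 1
  have cφ := (hc hφ).continuous
  have cφi : ∀ i, Continuous (torusPartial i φ) := fun i => (hc (hφ.partial i)).continuous
  have cφij : ∀ i j, Continuous (torusPartial i (torusPartial j φ)) := fun i j =>
    (hc ((hφ.partial j).partial i)).continuous
  have hI : ∀ {g : Torus n → ℝ}, Continuous g → Integrable g := fun h => h.integrable_of_compact
  set D : Fin n → Torus n → ℝ := fun i x =>
    torusPartial i (torusPartial i φ) x - torusPartial i W x * torusPartial i φ x with hD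
  have cD : ∀ i, Continuous (D i) := fun i => (cφij i i).sub ((hWi i).mul (cφi i))
  set c := ∫ y, φ y with hcdef
  -- the integral of the square of the generator
  have hQ : ∫ x, ((∑ i, ∑ j, torusPartial i (torusPartial j φ) x ^ 2)
        + ∑ i, ∑ j, torusPartial i (torusPartial j W) x * torusPartial i φ x * torusPartial j φ x)
        * Real.exp (-W x) = ∫ x, (∑ i, D i x) ^ 2 * Real.exp (-W x) := by
    have e1 : ∀ x, ((∑ i, ∑ j, torusPartial i (torusPartial j φ) x ^ 2)
        + ∑ i, ∑ j, torusPartial i (torusPartial j W) x * torusPartial i φ x * torusPartial j φ x)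
        * Real.exp (-W x) = ∑ i, ∑ j, (torusPartial i (torusPartial j φ) x ^ 2
          + torusPartial i (torusPartial j W) x * torusPartial i φ x * torusPartial j φ x)
          * Real.exp (-W x) := by
      intro x
      simp_rw [← Finset.sum_mul, Finset.sum_add_distrib]
    have e2 : ∀ x, (∑ i, D i x) ^ 2 * Real.exp (-W x)
        = ∑ i, ∑ j, D i x * D j x * Real.exp (-W x) := by
      intro x
      rw [sq, Finset.sum_mul_sum]
      simp_rw [Finset.sum_mul]
    simp_rw [e1, e2]
    rw [integral_finsetSum _ fun i _ => hI (continuous_finsetSum _ fun j _ => by fun_prop),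
      integral_finsetSum _ fun i _ => hI (continuous_finsetSum _ fun j _ => by fun_prop)]
    refine Finset.sum_congr rfl fun i _ => ?_
    rw [integral_finsetSum _ fun j _ => hI (by fun_prop),
      integral_finsetSum _ fun j _ => hI (by fun_prop)]
    exact Finset.sum_congr rfl fun j _ => (bochner_pair hW hφ i j).symm
  -- The Dirichlet form is minus the pairing of `φ` with the generator `∑ D i`. A constant may be
  -- subtracted from `φ`; the unweighted mean is the one in the Poincaré inequality.
  have ha : ∫ x, (∑ i, torusPartial i φ x ^ 2) * Real.exp (-W x)
      = -∫ x, (φ x - c) * (∑ i, D i x) * Real.exp (-W x) := by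
    simp_rw [Finset.mul_sum, Finset.sum_mul]
    rw [integral_finsetSum _ fun i _ => hI (by fun_prop),
      integral_finsetSum _ fun i _ => hI (by fun_prop), ← Finset.sum_neg_distrib]
    refine Finset.sum_congr rfl fun i _ => ?_
    have hφc : TorusContDiff 1 (fun x => φ x - c) := (hc hφ).sub contDiff_const
    have h1 := integral_torusPartial_mul_exp hW1 hφc (hc (hφ.partial i)) i
    have h2 : ∀ x, torusPartial i (fun x => φ x - c) x = torusPartial i φ x := by
      intro x
      rw [torusPartial_sub (h := fun _ => c) (hc hφ)
        (show TorusContDiff 1 fun _ => c from contDiff_const)]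
      simp [torusPartial]
    simp_rw [h2] at h1
    simp_rw [sq]
    exact h1
  set a := ∫ x, (∑ i, torusPartial i φ x ^ 2) * Real.exp (-W x) with hadef
  set P : ℝ := n * Real.exp (2 * B) with hP
  have hn' : (0 : ℝ) < n := by exact_mod_cast hn
  have hP0 : 0 < P := by positivity
  -- Bounded perturbation of the weight: it lies between `e^{-B}` and `e^B`, and inserting or
  -- removing it costs `e^B` on each side, hence `e^{2B}` in `P`.
  have hPoin : ∫ x, (φ x - c) ^ 2 * Real.exp (-W x) ≤ P * a := by
    have h1 : ∫ x, (φ x - c) ^ 2 * Real.exp (-W x) ≤ Real.exp B * ∫ x, (φ x - c) ^ 2 := by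
      rw [← integral_const_mul]
      refine integral_mono (hI (by fun_prop)) (hI (by fun_prop)) fun x => ?_
      simp only []
      rw [mul_comm]
      refine mul_le_mul_of_nonneg_right (Real.exp_le_exp.2 ?_) (sq_nonneg _)
      linarith [(abs_le.1 (hB x)).1]
    have h2 : ∫ x, ∑ i, torusPartial i φ x ^ 2 ≤ Real.exp B * a := by
      rw [hadef, ← integral_const_mul]
      refine integral_mono (hI (by fun_prop)) (hI (by fun_prop)) fun x => ?_
      simp only []
      have h3 : 0 ≤ ∑ i, torusPartial i φ x ^ 2 := Finset.sum_nonneg fun i _ => sq_nonneg _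
      have h4 : 1 ≤ Real.exp B * Real.exp (-W x) := by
        rw [← Real.exp_add]
        exact Real.one_le_exp (by linarith [(abs_le.1 (hB x)).2])
      nlinarith
    have h3 := poincare_torus (hc hφ)
    have h4 : Real.exp (2 * B) = Real.exp B * Real.exp B := by rw [← Real.exp_add]; ring_nf
    have h5 : 0 < Real.exp B := Real.exp_pos B
    calc _ ≤ Real.exp B * (n * (Real.exp B * a)) :=
          h1.trans (mul_le_mul_of_nonneg_left (h3.trans (mul_le_mul_of_nonneg_left h2 hn'.le)) h5.le)
      _ = P * a := by rw [hP, h4]; ring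
  rw [hQ]
  set Q := ∫ x, (∑ i, D i x) ^ 2 * Real.exp (-W x) with hQdef
  -- Young's inequality with weight `P`, chosen so that Poincaré turns the first term into `a / 2`;
  -- absorbing it leaves `a ≤ P * Q`.
  have hfin : a ≤ (2 * P)⁻¹ * (∫ x, (φ x - c) ^ 2 * Real.exp (-W x)) + P / 2 * Q := by
    rw [ha, ← integral_neg, hQdef, ← integral_const_mul, ← integral_const_mul,
      ← integral_add (hI (by fun_prop)) (hI (by fun_prop))]
    refine integral_mono (hI (by fun_prop)) (hI (by fun_prop)) fun x => ?_
    simp only []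
    have hE := Real.exp_pos (-W x)
    have : -((φ x - c) * ∑ i, D i x) ≤ (2 * P)⁻¹ * (φ x - c) ^ 2 + P / 2 * (∑ i, D i x) ^ 2 := by
      have h1 : 0 ≤ (2 * P)⁻¹ * ((φ x - c) + P * ∑ i, D i x) ^ 2 := by positivity
      have h2 : (2 * P)⁻¹ * ((φ x - c) + P * ∑ i, D i x) ^ 2
          = (2 * P)⁻¹ * (φ x - c) ^ 2 + (φ x - c) * ∑ i, D i x + P / 2 * (∑ i, D i x) ^ 2 := by
        field_simp
        ring
      linarith
    nlinarith
  have h6 : (2 * P)⁻¹ * (∫ x, (φ x - c) ^ 2 * Real.exp (-W x)) ≤ a / 2 := by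
    have := mul_le_mul_of_nonneg_left hPoin (show 0 ≤ (2 * P)⁻¹ by positivity)
    have h7 : (2 * P)⁻¹ * (P * a) = a / 2 := by field_simp
    linarith
  linarith

theorem integrable_mul_mul_of_memLp_two {c a b : Torus n → ℝ} (hc : Continuous c)
    (ha : MemLp a 2) (hb : MemLp b 2) : Integrable fun x => c x * (a x * b x) :=
  integrable_mul_of_continuous_of_compact hc (ha.integrable_mul hb)

theorem tendsto_integral_mul_mul {c a' b' : Torus n → ℝ} (hc : Continuous c)
    {a b : ℕ → Torus n → ℝ} (ha : ∀ k, MemLp (a k) 2) (hb : ∀ k, MemLp (b k) 2)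
    (ha' : MemLp a' 2) (hb' : MemLp b' 2)
    (hta : Tendsto (fun k => eLpNorm (a k - a') 2 volume) atTop (𝓝 0))
    (htb : Tendsto (fun k => eLpNorm (b k - b') 2 volume) atTop (𝓝 0)) :
    Tendsto (fun k => ∫ x, c x * (a k x * b k x)) atTop (𝓝 (∫ x, c x * (a' x * b' x))) := by
  obtain ⟨C, hC⟩ := isCompact_univ.exists_bound_of_continuousOn hc.continuousOn
  have hC' : ∀ x, ‖c x‖ ≤ C := fun x => hC x (Set.mem_univ x)
  have hcm : ∀ {a : Torus n → ℝ}, MemLp a 2 → MemLp (fun x => c x * a x) 2 := fun h =>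
    MemLp.of_le_mul h (hc.aestronglyMeasurable.mul h.1) (c := C) (ae_of_all _ fun x => by
      rw [norm_mul]; exact mul_le_mul_of_nonneg_right (hC' x) (norm_nonneg _))
  have hinner : ∀ {f g : Torus n → ℝ} (hf : MemLp f 2) (hg : MemLp g 2),
      inner ℝ (hg.toLp g) (hf.toLp f) = ∫ x, f x * g x := by
    intro f g hf hg
    rw [L2.inner_def]
    refine integral_congr_ae ?_
    filter_upwards [hf.coeFn_toLp, hg.coeFn_toLp] with x h1 h2
    simp [h1, h2]
  have e1 : ∀ {a b : Torus n → ℝ} (ha : MemLp a 2) (hb : MemLp b 2),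
      ∫ x, c x * (a x * b x) = inner ℝ (hb.toLp b) ((hcm ha).toLp _) := by
    intro a b ha hb
    rw [hinner (hcm ha) hb]
    simp_rw [mul_assoc]
  rw [e1 ha' hb']
  simp_rw [fun k => e1 (ha k) (hb k)]
  refine Tendsto.inner ?_ ?_
  · exact (Lp.tendsto_Lp_iff_tendsto_eLpNorm'' b hb b' hb').2 htb
  · refine (Lp.tendsto_Lp_iff_tendsto_eLpNorm'' (fun k x => c x * a k x) (fun k => hcm (ha k))
      (fun x => c x * a' x) (hcm ha')).2 ?_
    have h2 : ∀ k, eLpNorm ((fun x => c x * a k x) - fun x => c x * a' x) 2 volume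
        ≤ ENNReal.ofReal C * eLpNorm (a k - a') 2 volume := fun k =>
      eLpNorm_le_mul_eLpNorm_of_ae_le_mul (ae_of_all _ fun x => by
        simp only [Pi.sub_apply, ← mul_sub]
        rw [norm_mul]
        exact mul_le_mul_of_nonneg_right (hC' x) (norm_nonneg _)) 2
    have h3 : Tendsto (fun k => ENNReal.ofReal C * eLpNorm (a k - a') 2 volume) atTop (𝓝 0) := by
      simpa using ENNReal.Tendsto.const_mul hta (Or.inr ENNReal.ofReal_ne_top)
    exact tendsto_of_tendsto_of_tendsto_of_le_of_le tendsto_const_nhds h3 (fun k => zero_le) h2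

theorem MemSobolev.hasWeakDeriv_real {k : ℕ} {p : ℝ} {u : Torus n → ℝ} (h : MemSobolev k p u)
    {α : Fin n → ℕ} (hα : α ∈ multiIndices n k) :
    HasWeakDeriv α u (weakDeriv α u) ∧ MemLp (weakDeriv α u) (ENNReal.ofReal p) := by
  obtain ⟨v, hv, hvp⟩ := h α hα
  have hex : ∃ v, HasWeakDeriv α u v := ⟨v, hv⟩
  refine ⟨?_, (memLp_congr_ae hv.weakDeriv_ae).2 hvp⟩
  rw [weakDeriv, dif_pos hex]
  exact hex.choose_spec

/-- As a finite sum of integrals of a continuous coefficient times two `L²` functions, the form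
passes to the limit term by term. -/
theorem integral_hessian_expand {W : Torus n → ℝ} (hW : TorusContDiff 2 W)
    {w : Fin n → Torus n → ℝ} {z : Fin n → Fin n → Torus n → ℝ} (hw : ∀ i, MemLp (w i) 2)
    (hz : ∀ i j, MemLp (z i j) 2) :
    Integrable (fun x => ((∑ i, ∑ j, z i j x ^ 2)
        + ∑ i, ∑ j, torusPartial i (torusPartial j W) x * w i x * w j x) * Real.exp (-W x)) ∧
    ∫ x, ((∑ i, ∑ j, z i j x ^ 2)
        + ∑ i, ∑ j, torusPartial i (torusPartial j W) x * w i x * w j x) * Real.exp (-W x)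
      = (∑ i, ∑ j, ∫ x, Real.exp (-W x) * (z i j x * z i j x)) + ∑ i, ∑ j,
        ∫ x, (Real.exp (-W x) * torusPartial i (torusPartial j W) x) * (w i x * w j x) := by
  have hE : Continuous fun x => Real.exp (-W x) := by
    have := hW.continuous; fun_prop
  have hWij : ∀ i j, Continuous (torusPartial i (torusPartial j W)) := fun i j =>
    (hW.partial (k := 1) (by norm_num) j).continuous_partial i
  have i1 := fun i j => integrable_mul_mul_of_memLp_two hE (hz i j) (hz i j)
  have i2 : ∀ i j, Integrable fun x =>
      (Real.exp (-W x) * torusPartial i (torusPartial j W) x) * (w i x * w j x) := fun i j =>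
    integrable_mul_mul_of_memLp_two (hE.mul (hWij i j)) (hw i) (hw j)
  have e : ∀ x, ((∑ i, ∑ j, z i j x ^ 2)
        + ∑ i, ∑ j, torusPartial i (torusPartial j W) x * w i x * w j x) * Real.exp (-W x)
      = (∑ i, ∑ j, Real.exp (-W x) * (z i j x * z i j x)) + ∑ i, ∑ j,
        (Real.exp (-W x) * torusPartial i (torusPartial j W) x) * (w i x * w j x) := by
    intro x
    rw [add_mul]
    simp_rw [Finset.sum_mul]
    congr 1 <;> refine Finset.sum_congr rfl fun i _ => Finset.sum_congr rfl fun j _ => by ring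
  simp_rw [e]
  have s1 : Integrable fun x => ∑ i, ∑ j, Real.exp (-W x) * (z i j x * z i j x) :=
    integrable_finsetSum _ fun i _ => integrable_finsetSum _ fun j _ => i1 i j
  have s2 : Integrable fun x => ∑ i, ∑ j,
      (Real.exp (-W x) * torusPartial i (torusPartial j W) x) * (w i x * w j x) :=
    integrable_finsetSum _ fun i _ => integrable_finsetSum _ fun j _ => i2 i j
  refine ⟨s1.add s2, ?_⟩
  rw [integral_add s1 s2]
  congr 1
  · rw [integral_finsetSum _ fun i _ => integrable_finsetSum _ fun j _ => i1 i j]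
    exact Finset.sum_congr rfl fun i _ => integral_finsetSum _ fun j _ => i1 i j
  · rw [integral_finsetSum _ fun i _ => integrable_finsetSum _ fun j _ => i2 i j]
    exact Finset.sum_congr rfl fun i _ => integral_finsetSum _ fun j _ => i2 i j

theorem integral_grad_expand {W : Torus n → ℝ} (hW : Continuous W)
    {w : Fin n → Torus n → ℝ} (hw : ∀ i, MemLp (w i) 2) :
    Integrable (fun x => (∑ i, w i x ^ 2) * Real.exp (-W x)) ∧
    ∫ x, (∑ i, w i x ^ 2) * Real.exp (-W x) = ∑ i, ∫ x, Real.exp (-W x) * (w i x * w i x) := by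
  have hE : Continuous fun x => Real.exp (-W x) := by fun_prop
  have i1 := fun i => integrable_mul_mul_of_memLp_two hE (hw i) (hw i)
  have e : ∀ x, (∑ i, w i x ^ 2) * Real.exp (-W x)
      = ∑ i, Real.exp (-W x) * (w i x * w i x) := by
    intro x
    rw [Finset.sum_mul]
    exact Finset.sum_congr rfl fun i _ => by ring
  simp_rw [e]
  exact ⟨integrable_finsetSum _ fun i _ => i1 i, integral_finsetSum _ fun i _ => i1 i⟩

/-- Mollification commutes with weak derivatives and converges in `L²`, and both sides are
continuous for that convergence. -/
theorem spectral_gap_weak (hn : 0 < n) {W φ : Torus n → ℝ} (hW : TorusContDiff 2 W)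
    (hφ : MemSobolev 2 2 φ) {B : ℝ} (hB : ∀ x, |W x| ≤ B) :
    ∫ x, (∑ i, weakDeriv (Pi.single i 1) φ x ^ 2) * Real.exp (-W x)
      ≤ n * Real.exp (2 * B) *
        ∫ x, ((∑ i, ∑ j, weakDeriv (Pi.single i 1 + Pi.single j 1) φ x ^ 2)
        + ∑ i, ∑ j, torusPartial i (torusPartial j W) x * weakDeriv (Pi.single i 1) φ x *
          weakDeriv (Pi.single j 1) φ x) * Real.exp (-W x) := by
  have h2 : ENNReal.ofReal 2 = 2 := by simp
  have hd1 := fun i => hφ.hasWeakDeriv_real (single_mem_multiIndices (n := n) i)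
  have hd2 := fun i j => hφ.hasWeakDeriv_real (single_add_mem_multiIndices (n := n) i j)
  simp only [h2] at hd1 hd2
  set w : Fin n → Torus n → ℝ := fun i => weakDeriv (Pi.single i 1) φ
  set z : Fin n → Fin n → Torus n → ℝ := fun i j => weakDeriv (Pi.single i 1 + Pi.single j 1) φ
  have hφi : Integrable φ := (hd1 ⟨0, hn⟩).1.1
  set φk : ℕ → Torus n → ℝ := fun k => torusConv (torusKernel k) φ
  have hs : ∀ k, TorusSmooth (φk k) := fun k => torusConv_smooth (torusKernel_smooth k) hφi
  have p1 : ∀ k i, torusPartial i (φk k) = torusConv (torusKernel k) (w i) := fun k i =>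
    torusPartial_torusConv (torusKernel_smooth k) (hd1 i).1
  have p2 : ∀ k i j, torusPartial i (torusPartial j (φk k)) = torusConv (torusKernel k) (z i j) := by
    intro k i j
    rw [torusPartial_comm ((hs k).torusContDiff 2), p1]
    exact torusPartial_torusConv (torusKernel_smooth k) ((hd2 i j).1.of_single_add (hd1 i).1)
  have hgap := fun k => spectral_gap_smooth hn hW (hs k) hB
  -- Second derivatives are rewritten first: `p1` would otherwise rewrite the inner derivative and
  -- hide the pattern of `p2`.
  simp only [p2] at hgap
  simp only [p1] at hgap
  have mw : ∀ k i, MemLp (torusConv (torusKernel k) (w i)) 2 := fun k i =>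
    memLp_torusConv (hd1 i).1.2.1 k
  have mz : ∀ k i j, MemLp (torusConv (torusKernel k) (z i j)) 2 := fun k i j =>
    memLp_torusConv (hd2 i j).1.2.1 k
  have tw := fun i => tendsto_eLpNorm_torusConv one_le_two ENNReal.ofNat_ne_top (hd1 i).2
  have tz := fun i j => tendsto_eLpNorm_torusConv one_le_two ENNReal.ofNat_ne_top (hd2 i j).2
  have hE : Continuous fun x => Real.exp (-W x) := by
    have := hW.continuous; fun_prop
  have hWij : ∀ i j, Continuous (torusPartial i (torusPartial j W)) := fun i j =>
    (hW.partial (k := 1) (by norm_num) j).continuous_partial i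
  rw [(integral_grad_expand hW.continuous fun i => (hd1 i).2).2,
    (integral_hessian_expand hW (fun i => (hd1 i).2) fun i j => (hd2 i j).2).2]
  simp_rw [fun k => (integral_grad_expand hW.continuous (mw k)).2,
    fun k => (integral_hessian_expand hW (mw k) (mz k)).2] at hgap
  refine le_of_tendsto_of_tendsto' (b := atTop) ?_ ?_ hgap
  · exact tendsto_finsetSum _ fun i _ => tendsto_integral_mul_mul hE (fun k => mw k i)
      (fun k => mw k i) (hd1 i).2 (hd1 i).2 (tw i) (tw i)
  · refine Tendsto.const_mul _ (Tendsto.add ?_ ?_)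
    · exact tendsto_finsetSum _ fun i _ => tendsto_finsetSum _ fun j _ =>
        tendsto_integral_mul_mul hE (fun k => mz k i j) (fun k => mz k i j) (hd2 i j).2
          (hd2 i j).2 (tz i j) (tz i j)
    · exact tendsto_finsetSum _ fun i _ => tendsto_finsetSum _ fun j _ =>
        tendsto_integral_mul_mul (hE.mul (hWij i j)) (fun k => mw k i) (fun k => mw k j)
          (hd1 i).2 (hd1 j).2 (tw i) (tw j)

/-- The Gibbs measure `e^{-W} dx / Z`. -/
abbrev gibbs (W : Torus n → ℝ) : Measure (Torus n) :=
  (volume : Measure (Torus n)).tilted (fun x => -W x)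

theorem integral_gibbs (W g : Torus n → ℝ) :
    ∫ x, g x ∂(gibbs W) = (∫ x, Real.exp (-W x))⁻¹ * ∫ x, g x * Real.exp (-W x) := by
  rw [integral_tilted, ← integral_const_mul]
  refine integral_congr_ae (ae_of_all _ fun x => ?_)
  simp only [smul_eq_mul]
  ring

theorem partition_pos {W : Torus n → ℝ} (hW : Continuous W) : 0 < ∫ x, Real.exp (-W x) :=
  integral_exp_pos (by fun_prop : Continuous fun x => Real.exp (-W x)).integrable_of_compact

theorem spectral_gap_gibbs (hn : 0 < n) {W φ : Torus n → ℝ} (hW : TorusContDiff 2 W)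
    (hφ : MemSobolev 2 2 φ) {B : ℝ} (hB : ∀ x, |W x| ≤ B) :
    ∫ x, ∑ i, weakDeriv (Pi.single i 1) φ x ^ 2 ∂(gibbs W)
      ≤ n * Real.exp (2 * B) * hessianForm (gibbs W) W φ := by
  unfold hessianForm
  rw [integral_gibbs, integral_gibbs]
  have := mul_le_mul_of_nonneg_left (spectral_gap_weak hn hW hφ hB)
    (inv_nonneg.2 (partition_pos hW.continuous).le)
  calc _ ≤ _ := this
    _ = _ := by ring

theorem TorusSmooth.memSobolev {g : Torus n → ℝ} (hg : TorusSmooth g) (p : ℝ) :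
    MemSobolev 2 p g := by
  intro α hα
  have hc : ∀ {g : Torus n → ℝ}, TorusSmooth g → MemLp g (ENNReal.ofReal p) volume := fun h =>
    (h.torusContDiff 1).continuous.memLp_of_hasCompactSupport (HasCompactSupport.of_compactSpace _)
  rcases mem_multiIndices_two hα with rfl | ⟨i, rfl⟩ | ⟨i, j, rfl⟩
  · exact ⟨g, hasWeakDeriv_zero (hg.torusContDiff 1).continuous.integrable_of_compact, hc hg⟩
  · exact ⟨_, (hg.torusContDiff 1).hasWeakDeriv i, hc (hg.partial i)⟩
  · exact ⟨_, ((hg.torusContDiff 1).hasWeakDeriv i).single_add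
      (((hg.partial i).torusContDiff 1).hasWeakDeriv j), hc ((hg.partial i).partial j)⟩

/-- The infimum over the empty set is `0` in `ℝ`, so positivity of the gap needs an admissible
function. With zero gradient the bump would be constant by Poincaré, yet it is `1` at the origin and
`0` at the centre `(1/2, …, 1/2)`. -/
theorem exists_torusPartial_torusBump_ne_zero (hn : 0 < n) :
    ∃ i : Fin n, ¬ weakDeriv (Pi.single i 1) (torusBump : Torus n → ℝ) =ᵐ[volume] 0 := by
  by_contra! hcon
  have hs : TorusContDiff 1 (torusBump : Torus n → ℝ) := torusBump_smooth.torusContDiff 1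
  have h0 : ∀ i, torusPartial i (torusBump : Torus n → ℝ) = 0 := fun i =>
    (Continuous.ae_eq_iff_eq volume (hs.continuous_partial i) continuous_const).1
      ((hs.hasWeakDeriv i).weakDeriv_ae.symm.trans (hcon i))
  have h1 := poincare_torus hs
  simp only [h0, Pi.zero_apply, ne_eq, OfNat.ofNat_ne_zero, not_false_eq_true, zero_pow,
    Finset.sum_const_zero, integral_zero, mul_zero] at h1
  have hc := hs.continuous
  set c := ∫ y : Torus n, torusBump y
  have hcont : Continuous fun x : Torus n => (torusBump x - c) ^ 2 := by fun_prop
  have h2 : ∫ x : Torus n, (torusBump x - c) ^ 2 = 0 :=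
    le_antisymm h1 (integral_nonneg fun x => sq_nonneg _)
  have h3 := (integral_eq_zero_iff_of_nonneg (fun x => sq_nonneg _) hcont.integrable_of_compact).1 h2
  have h4 := (Continuous.ae_eq_iff_eq volume hcont
    (continuous_const (y := (0 : ℝ)))).1 h3
  have h5 : ∀ x : Torus n, torusBump x = c := fun x => by
    have := congrFun h4 x
    simpa [sub_eq_zero] using this
  have h6 := (h5 0).trans (h5 (toTorus (WithLp.toLp 2 fun _ => 1 / 2))).symm
  rw [torusBump_zero, torusBump_toTorus] at h6
  have h7 : (2 : ℝ) * Real.pi * (1 / 2) = Real.pi := by ring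
  simp only [h7, Real.cos_pi, add_neg_cancel, zero_div, Finset.prod_const, Finset.card_univ,
    Fintype.card_fin, zero_pow hn.ne'] at h6
  exact one_ne_zero h6

theorem absolutelyContinuous_gibbs {W : Torus n → ℝ} (hW : Continuous W) :
    (volume : Measure (Torus n)) ≪ gibbs W :=
  absolutelyContinuous_tilted (by fun_prop : Continuous fun x => Real.exp (-W x)).integrable_of_compact

/-- The Bochner bound applied to every Rayleigh quotient. It involves only `n` and `B`, hence is
uniform over all potentials with the same bound. The second part restates the infimum as an
inequality without division. -/
theorem le_rayleighInf_gibbs (hn : 0 < n) {W : Torus n → ℝ} (hW : TorusContDiff 2 W) {B : ℝ}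
    (hB : ∀ x, |W x| ≤ B) :
    (n * Real.exp (2 * B))⁻¹ ≤ rayleighInf (gibbs W) W ∧
      ∀ φ : Torus n → ℝ, MemSobolev 2 2 φ →
        rayleighInf (gibbs W) W * ∫ x, ∑ i, weakDeriv (Pi.single i 1) φ x ^ 2 ∂(gibbs W)
          ≤ hessianForm (gibbs W) W φ := by
  have hn' : (0 : ℝ) < n := by exact_mod_cast hn
  have hP : 0 < n * Real.exp (2 * B) := by positivity
  have hpos : ∀ φ : Torus n → ℝ, MemSobolev 2 2 φ →
      (∃ i, ¬ weakDeriv (Pi.single i 1) φ =ᵐ[volume] 0) →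
      0 < ∫ x, ∑ i, weakDeriv (Pi.single i 1) φ x ^ 2 ∂(gibbs W) := by
    rintro φ hφ ⟨i, hi⟩
    rw [integral_gibbs]
    refine mul_pos (inv_pos.2 (partition_pos hW.continuous)) ?_
    have hd1 := fun i => (hφ.hasWeakDeriv_real (single_mem_multiIndices (n := n) i)).2
    simp only [ENNReal.ofReal_ofNat] at hd1
    have hint := (integral_grad_expand hW.continuous hd1).1
    have hnn : ∀ x, 0 ≤ (∑ i, weakDeriv (Pi.single i 1) φ x ^ 2) * Real.exp (-W x) := fun x =>
      mul_nonneg (Finset.sum_nonneg fun i _ => sq_nonneg _) (Real.exp_pos _).le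
    refine lt_of_le_of_ne (integral_nonneg hnn) fun h0 => hi ?_
    have h1 := (integral_eq_zero_iff_of_nonneg hnn hint).1 h0.symm
    filter_upwards [h1] with x hx
    have h2 := (mul_eq_zero.1 hx).resolve_right (Real.exp_pos _).ne'
    have h3 := (Finset.sum_eq_zero_iff_of_nonneg fun i _ => sq_nonneg _).1 h2 i (Finset.mem_univ i)
    simpa using h3
  have hlb : ∀ r ∈ {r : ℝ | ∃ φ : Torus n → ℝ, MemSobolev 2 2 φ ∧
      (∃ i, ¬ weakDeriv (Pi.single i 1) φ =ᵐ[volume] 0) ∧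
      r = hessianForm (gibbs W) W φ /
        ∫ x, ∑ i, weakDeriv (Pi.single i 1) φ x ^ 2 ∂(gibbs W)},
      (n * Real.exp (2 * B))⁻¹ ≤ r := by
    rintro r ⟨φ, hφ, hne, rfl⟩
    have h1 := spectral_gap_gibbs hn hW hφ hB
    rw [le_div_iff₀ (hpos φ hφ hne), inv_mul_le_iff₀ hP]
    exact h1
  refine ⟨le_csInf ⟨_, torusBump, torusBump_smooth.memSobolev 2,
    exists_torusPartial_torusBump_ne_zero hn, rfl⟩ hlb, fun φ hφ => ?_⟩
  by_cases hne : ∃ i, ¬ weakDeriv (Pi.single i 1) φ =ᵐ[volume] 0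
  · rw [← le_div_iff₀ (hpos φ hφ hne)]
    exact csInf_le ⟨_, hlb⟩ ⟨φ, hφ, hne, rfl⟩
  -- For zero gradient no quotient is available; the Bochner bound still shows that the form is
  -- nonnegative.
  · push Not at hne
    have h0 : ∫ x, ∑ i, weakDeriv (Pi.single i 1) φ x ^ 2 ∂(gibbs W) = 0 := by
      rw [integral_gibbs]
      refine mul_eq_zero_of_right _ (integral_eq_zero_of_ae ?_)
      filter_upwards [ae_all_iff.2 hne] with x hx
      simp [hx]
    have h1 := spectral_gap_gibbs hn hW hφ hB
    rw [h0] at h1 ⊢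
    rw [mul_zero]
    exact (mul_nonneg_iff_of_pos_left hP).1 h1

end Bochner

/-! ### Perturbations of the identity -/

section Perturbation

variable {n : ℕ}

/-- The Jacobian matrix of a vector field. -/
def jacobianMatrix (U : Torus n → Euc n) (x : Torus n) : Matrix (Fin n) (Fin n) ℝ :=
  Matrix.of fun j i => torusPartial i (fun x => U x j) x

/-- A `C¹` vector field whose first derivatives are bounded by `κ`. -/
def DerivBounded (κ : ℝ) (U : Torus n → Euc n) : Prop :=
  (∀ j, TorusContDiff 1 fun x => U x j) ∧ ∀ i j x, |jacobianMatrix U x i j| ≤ κ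

/-- The map `x ↦ x + U(x)` of the torus. -/
def perturbation (U : Torus n → Euc n) (x : Torus n) : Torus n := x + toTorus (U x)

theorem exists_det_one_add_close (n : ℕ) {ε : ℝ} (hε : 0 < ε) :
    ∃ κ : ℝ, 0 < κ ∧ ∀ A : Matrix (Fin n) (Fin n) ℝ, (∀ i j, |A i j| ≤ κ) →
      |(1 + A).det - 1| ≤ ε := by
  have hc : Continuous fun A : Fin n → Fin n → ℝ => (1 + Matrix.of A).det :=
    Continuous.matrix_det (continuous_const.add continuous_id)
  have h0 := Metric.continuousAt_iff.1 (hc.continuousAt (x := 0)) ε hε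
  obtain ⟨κ, hκ, h⟩ := h0
  refine ⟨κ / 2, half_pos hκ, fun A hA => ?_⟩
  have h1 : dist (fun i j => A i j) (0 : Fin n → Fin n → ℝ) < κ := by
    refine lt_of_le_of_lt ?_ (half_lt_self hκ)
    refine (dist_pi_le_iff (half_pos hκ).le).2 fun i => (dist_pi_le_iff (half_pos hκ).le).2 fun j => ?_
    simpa [Real.dist_eq] using hA i j
  have h2 := h h1
  rw [Real.dist_eq] at h2
  have h3 : (1 + Matrix.of (0 : Fin n → Fin n → ℝ)).det = 1 := by
    have : Matrix.of (0 : Fin n → Fin n → ℝ) = 0 := rfl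
    rw [this, add_zero, Matrix.det_one]
  rw [h3] at h2
  exact h2.le

theorem continuous_jacobianMatrix {U : Torus n → Euc n}
    (hU : ∀ j, TorusContDiff 1 fun x => U x j) : Continuous (jacobianMatrix U) :=
  continuous_matrix fun j i => (hU j).continuous_partial i

theorem continuous_field {U : Torus n → Euc n} (hU : ∀ j, TorusContDiff 1 fun x => U x j) :
    Continuous U := by
  have h : Continuous fun x j => U x j := continuous_pi fun j => (hU j).continuous
  exact (PiLp.continuous_toLp 2 _).comp h

theorem continuous_perturbation {U : Torus n → Euc n}
    (hU : ∀ j, TorusContDiff 1 fun x => U x j) : Continuous (perturbation U) :=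
  continuous_id.add (continuous_toTorus.comp (continuous_field hU))

theorem hasFDerivAt_field {U : Torus n → Euc n} (hU : ∀ j, TorusContDiff 1 fun x => U x j)
    (v : Euc n) : HasFDerivAt (fun v : Euc n => U (toTorus v))
      (Matrix.toEuclideanCLM (𝕜 := ℝ) (n := Fin n) (jacobianMatrix U (toTorus v))) v := by
  rw [← hasFDerivWithinAt_univ]
  refine hasFDerivWithinAt_euclidean.2 fun j => ?_
  rw [hasFDerivWithinAt_univ]
  refine ((hU j).hasFDerivAt v).congr_fderiv ?_
  ext w
  simp [jacobianMatrix, Matrix.mulVec, dotProduct]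

theorem euclidean_norm_le_sum (v : Euc n) : ‖v‖ ≤ ∑ i, |v i| := by
  conv_lhs => rw [← (EuclideanSpace.basisFun (Fin n) ℝ).sum_repr v]
  refine (norm_sum_le _ _).trans (Finset.sum_le_sum fun i _ => ?_)
  simp [norm_smul]

theorem norm_toEuclideanCLM_le {A : Matrix (Fin n) (Fin n) ℝ} {κ : ℝ} (hκ : 0 ≤ κ)
    (hA : ∀ i j, |A i j| ≤ κ) : ‖Matrix.toEuclideanCLM (𝕜 := ℝ) (n := Fin n) A‖ ≤ n ^ 2 * κ := by
  refine ContinuousLinearMap.opNorm_le_bound _ (by positivity) fun w => ?_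
  refine (euclidean_norm_le_sum _).trans ?_
  have h1 : ∀ i, |(Matrix.toEuclideanCLM (𝕜 := ℝ) (n := Fin n) A w) i| ≤ n * κ * ‖w‖ := by
    intro i
    have : (Matrix.toEuclideanCLM (𝕜 := ℝ) (n := Fin n) A w) i = ∑ j, A i j * w j := by
      simp [Matrix.mulVec, dotProduct]
    rw [this]
    refine (Finset.abs_sum_le_sum_abs _ _).trans ?_
    have : ∀ j ∈ Finset.univ, |A i j * w j| ≤ κ * ‖w‖ := fun j _ => by
      rw [abs_mul]
      exact mul_le_mul (hA i j) (PiLp.norm_apply_le w j) (abs_nonneg _) hκ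
    refine (Finset.sum_le_sum this).trans (le_of_eq ?_)
    simp; ring
  refine (Finset.sum_le_sum fun i _ => h1 i).trans (le_of_eq ?_)
  simp; ring

theorem lipschitz_field {U : Torus n → Euc n} {κ : ℝ} (hκ : 0 ≤ κ) (hU : DerivBounded κ U)
    (hs : n ^ 2 * κ ≤ 1 / 2) : LipschitzWith (1 / 2) fun v : Euc n => U (toTorus v) := by
  refine lipschitzWith_of_nnnorm_fderiv_le (𝕜 := ℝ)
    (fun v => (hasFDerivAt_field hU.1 v).differentiableAt) fun v => ?_
  rw [(hasFDerivAt_field hU.1 v).fderiv, ← NNReal.coe_le_coe, coe_nnnorm]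
  refine (norm_toEuclideanCLM_le hκ (hU.2 · · _)).trans ?_
  simpa using hs

/-- The lift of `x ↦ x + U(x)` to Euclidean space. -/
def liftedPerturbation (U : Torus n → Euc n) (v : Euc n) : Euc n := v + U (toTorus v)

theorem toTorus_liftedPerturbation (U : Torus n → Euc n) (v : Euc n) :
    toTorus (liftedPerturbation U v) = perturbation U (toTorus v) := toTorus_add _ _

/-- A preimage of `y` is a fixed point of the contraction `v ↦ y - U(v)`; two points with the same
image satisfy `‖v - w‖ ≤ ‖v - w‖ / 2`. -/
theorem liftedPerturbation_bijective {U : Torus n → Euc n}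
    (hL : LipschitzWith (1 / 2) fun v : Euc n => U (toTorus v)) :
    Function.Bijective (liftedPerturbation U) := by
  constructor
  · intro v w h
    have h1 : v - w = U (toTorus w) - U (toTorus v) := by
      have : v + U (toTorus v) = w + U (toTorus w) := h
      rw [sub_eq_sub_iff_add_eq_add, this, add_comm]
    have h2 := hL.dist_le_mul w v
    rw [dist_eq_norm, ← h1, dist_eq_norm, norm_sub_rev w v] at h2
    have h3 : ‖v - w‖ ≤ 0 := by
      norm_num at h2
      linarith [norm_nonneg (v - w)]
    exact sub_eq_zero.1 (norm_le_zero_iff.1 h3)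
  · intro y
    have hc : ContractingWith (1 / 2) fun v : Euc n => y - U (toTorus v) := by
      refine ⟨by rw [← NNReal.coe_lt_coe]; norm_num, LipschitzWith.of_dist_le_mul fun v w => ?_⟩
      rw [dist_sub_left]
      exact hL.dist_le_mul v w
    refine ⟨ContractingWith.fixedPoint _ hc, ?_⟩
    have := hc.fixedPoint_isFixedPt
    have h2 : y - U (toTorus (ContractingWith.fixedPoint _ hc)) = ContractingWith.fixedPoint _ hc := this
    unfold liftedPerturbation
    nth_rewrite 1 [← h2]
    abel

/-- The lift commutes with lattice translations: if two images agree on the torus, their lifts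
differ by a lattice vector `k`, and shifting one preimage by `k` reduces to injectivity of the lift.
-/
theorem perturbation_bijective {U : Torus n → Euc n}
    (hL : LipschitzWith (1 / 2) fun v : Euc n => U (toTorus v)) :
    Function.Bijective (perturbation U) := by
  have hb := liftedPerturbation_bijective hL
  constructor
  · intro x y h
    obtain ⟨v, rfl⟩ := toTorus_surjective x
    obtain ⟨w, rfl⟩ := toTorus_surjective y
    rw [← toTorus_liftedPerturbation, ← toTorus_liftedPerturbation] at h
    set k := liftedPerturbation U v - liftedPerturbation U w with hk
    have hk0 : toTorus k = 0 := by rw [hk, toTorus_sub, h, sub_self]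
    have h1 : toTorus (w + k) = toTorus w := by rw [toTorus_add, hk0, add_zero]
    have h2 : liftedPerturbation U (w + k) = liftedPerturbation U v := by
      have : liftedPerturbation U (w + k) = liftedPerturbation U w + k := by
        unfold liftedPerturbation
        rw [h1]; abel
      rw [this, hk]; abel
    rw [← h1, hb.1 h2]
  · intro y
    obtain ⟨w, rfl⟩ := toTorus_surjective y
    obtain ⟨v, rfl⟩ := hb.2 w
    exact ⟨toTorus v, (toTorus_liftedPerturbation U v).symm⟩

theorem det_toEuclideanCLM (A : Matrix (Fin n) (Fin n) ℝ) :
    (Matrix.toEuclideanCLM (𝕜 := ℝ) (n := Fin n) A).det = A.det := by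
  have : ((Matrix.toEuclideanCLM (𝕜 := ℝ) (n := Fin n) A : Euc n →L[ℝ] Euc n) : Euc n →ₗ[ℝ] Euc n)
      = Matrix.toLin (PiLp.basisFun 2 ℝ (Fin n)) (PiLp.basisFun 2 ℝ (Fin n)) A := by
    rw [Matrix.coe_toEuclideanCLM_eq_toEuclideanLin]
    exact congrArg (fun L => L A) (Matrix.toLpLin_eq_toLin 2 2)
  rw [ContinuousLinearMap.det, this, LinearMap.det_toLin]

theorem toTorus_eq_zero_iff {v : Euc n} : toTorus v = 0 ↔
    v ∈ Submodule.span ℤ (Set.range (EuclideanSpace.basisFun (Fin n) ℝ).toBasis) := by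
  rw [Module.Basis.mem_span_iff_repr_mem]
  simp only [toTorus, funext_iff, Pi.zero_apply, AddCircle.coe_eq_zero_iff]
  refine forall_congr' fun i => ?_
  simp

/-- Change of variables for a perturbation of the identity. -/
theorem lintegral_perturbation {U : Torus n → Euc n} (hU : ∀ j, TorusContDiff 1 fun x => U x j)
    (hL : LipschitzWith (1 / 2) fun v : Euc n => U (toTorus v)) {F : Torus n → ENNReal}
    (hF : Measurable F) :
    ∫⁻ x, ENNReal.ofReal |(1 + jacobianMatrix U x).det| * F (perturbation U x) = ∫⁻ x, F x := by
  have hb := liftedPerturbation_bijective hL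
  set b := (EuclideanSpace.basisFun (Fin n) ℝ).toBasis with hbdef
  have hQ : ZSpan.fundamentalDomain b = cubeFrom n 0 := by
    ext v; simp [ZSpan.mem_fundamentalDomain, cubeFrom, hbdef]
  have hfd := ZSpan.isAddFundamentalDomain b (volume : Measure (Euc n))
  rw [hQ] at hfd
  have hm := measurableSet_cubeFrom (n := n) 0
  have hder : ∀ v, HasFDerivAt (liftedPerturbation U) (Matrix.toEuclideanCLM (𝕜 := ℝ) (n := Fin n)
      (1 + jacobianMatrix U (toTorus v))) v := by
    intro v
    rw [map_add, map_one]
    exact (hasFDerivAt_id v).add (hasFDerivAt_field hU v)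
  have hadd : ∀ (g : Submodule.span ℤ (Set.range b)) (v : Euc n),
      liftedPerturbation U (g +ᵥ v) = g +ᵥ liftedPerturbation U v := by
    intro g v
    have h0 : toTorus (g : Euc n) = 0 := toTorus_eq_zero_iff.2 g.2
    change (g : Euc n) + v + U (toTorus ((g : Euc n) + v)) = (g : Euc n) + (v + U (toTorus v))
    rw [toTorus_add, h0, zero_add, add_assoc]
  -- The lift is bijective and commutes with the lattice, so it maps the unit cube to another
  -- fundamental domain. A periodic function has the same integral over both, which turns the
  -- Euclidean formula into one on the torus.
  have hfd2 : IsAddFundamentalDomain (Submodule.span ℤ (Set.range b))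
      (liftedPerturbation U '' cubeFrom n 0) (volume : Measure (Euc n)) := by
    refine IsAddFundamentalDomain.mk' ?_ fun y => ?_
    · refine (hm.image_of_continuousOn_injOn ?_ hb.1.injOn).nullMeasurableSet
      exact fun v _ => (hder v).continuousAt.continuousWithinAt
    · obtain ⟨v, rfl⟩ := hb.2 y
      obtain ⟨g, hg, hu⟩ := ZSpan.exist_unique_vadd_mem_fundamentalDomain b v
      rw [hQ] at hg
      refine ⟨g, ⟨g +ᵥ v, hg, hadd g v⟩, ?_⟩
      rintro g' ⟨w, hw, hw'⟩
      rw [← hadd] at hw'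
      rw [hb.1 hw'] at hw
      exact hu g' (by rw [hQ]; exact hw)
  have h1 := lintegral_image_eq_lintegral_abs_det_fderiv_mul (volume : Measure (Euc n)) hm
    (fun v _ => (hder v).hasFDerivWithinAt) hb.1.injOn (fun w => F (toTorus w))
  simp only [det_toEuclideanCLM, toTorus_liftedPerturbation] at h1
  have h2 : ∫⁻ w in liftedPerturbation U '' cubeFrom n 0, F (toTorus w)
      = ∫⁻ w in cubeFrom n 0, F (toTorus w) := by
    have : VAddInvariantMeasure (Submodule.span ℤ (Set.range b)) (Euc n) volume :=
      inferInstanceAs <| VAddInvariantMeasure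
        (Submodule.span ℤ (Set.range b)).toAddSubgroup (Euc n) volume
    refine hfd2.setLIntegral_eq hfd _ fun g w => ?_
    have h0 : toTorus (g : Euc n) = 0 := toTorus_eq_zero_iff.2 g.2
    change F (toTorus ((g : Euc n) + w)) = _
    rw [toTorus_add, h0, zero_add]
  have hJ : Continuous fun x => (1 + jacobianMatrix U x).det :=
    Continuous.matrix_det (continuous_const.add (continuous_jacobianMatrix hU))
  have hmeas : Measurable fun x => ENNReal.ofReal |(1 + jacobianMatrix U x).det|
      * F (perturbation U x) :=
    (ENNReal.continuous_ofReal.comp hJ.abs).measurable.mul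
      (hF.comp (continuous_perturbation hU).measurable)
  rw [h2, (measurePreserving_toTorus 0).lintegral_comp hF,
    (measurePreserving_toTorus 0).lintegral_comp hmeas] at h1
  exact h1.symm

/-- `μ` has the continuous, positive density `ρ`. -/
structure HasPosDensity (μ : Measure (Torus n)) (ρ : Torus n → ℝ) : Prop where
  continuous : Continuous ρ
  pos : ∀ x, 0 < ρ x
  eq : μ = volume.withDensity fun x => ENNReal.ofReal (ρ x)

theorem HasPosDensity.absolutelyContinuous {μ : Measure (Torus n)} {ρ : Torus n → ℝ}
    (h : HasPosDensity μ ρ) : μ ≪ volume := by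
  rw [h.eq]; exact withDensity_absolutelyContinuous _ _

theorem HasPosDensity.isFiniteMeasure {μ : Measure (Torus n)} {ρ : Torus n → ℝ}
    (h : HasPosDensity μ ρ) : IsFiniteMeasure μ := by
  rw [h.eq]
  exact isFiniteMeasure_withDensity_ofReal h.continuous.integrable_of_compact.2

theorem HasPosDensity.entropy_eq {μ : Measure (Torus n)} {ρ : Torus n → ℝ}
    (h : HasPosDensity μ ρ) : entropy μ = ((∫ x, Real.log (ρ x) ∂μ : ℝ) : EReal) := by
  have := h.isFiniteMeasure
  have h1 : (fun x => Real.log (μ.rnDeriv volume x).toReal) =ᵐ[μ] fun x => Real.log (ρ x) := by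
    refine h.absolutelyContinuous.ae_le ?_
    have h2 := Measure.rnDeriv_withDensity (volume : Measure (Torus n))
      (ENNReal.continuous_ofReal.comp h.continuous).measurable
    rw [Function.comp_def, ← h.eq] at h2
    filter_upwards [h2] with x hx
    rw [hx, ENNReal.toReal_ofReal (h.pos x).le]
  have h3 : Integrable (fun x => Real.log (ρ x)) μ :=
    (h.continuous.log fun x => (h.pos x).ne').integrable_of_compact
  rw [entropy, if_pos ⟨h.absolutelyContinuous, h3.congr h1.symm⟩, integral_congr_ae h1]

theorem exists_homeomorph_perturbation {U : Torus n → Euc n}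
    (hU : ∀ j, TorusContDiff 1 fun x => U x j)
    (hL : LipschitzWith (1 / 2) fun v : Euc n => U (toTorus v)) :
    ∃ e : Torus n ≃ₜ Torus n, ∀ x, e x = perturbation U x :=
  ⟨Continuous.homeoOfEquivCompactToT2 (f := Equiv.ofBijective _ (perturbation_bijective hL))
    (continuous_perturbation hU), fun _ => rfl⟩

/-- The new density at `T x` is `ρ(x) / det DT(x)`. Its logarithm splits, so the whole change in
entropy is the integral of `log det DT`. -/
theorem HasPosDensity.map_perturbation {μ : Measure (Torus n)} {ρ : Torus n → ℝ}
    (h : HasPosDensity μ ρ) {U : Torus n → Euc n} (hU : ∀ j, TorusContDiff 1 fun x => U x j)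
    (hL : LipschitzWith (1 / 2) fun v : Euc n => U (toTorus v))
    (hJ : ∀ x, 0 < (1 + jacobianMatrix U x).det) :
    (∃ ρ', HasPosDensity (μ.map (perturbation U)) ρ') ∧
      entropy (μ.map (perturbation U)) =
        ((∫ x, Real.log (ρ x) ∂μ - ∫ x, Real.log (1 + jacobianMatrix U x).det ∂μ : ℝ) : EReal) := by
  obtain ⟨e, he⟩ := exists_homeomorph_perturbation hU hL
  have hTc := continuous_perturbation hU
  have hJc : Continuous fun x => (1 + jacobianMatrix U x).det :=
    Continuous.matrix_det (continuous_const.add (continuous_jacobianMatrix hU))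
  set q : Torus n → ℝ := fun x => ρ x / (1 + jacobianMatrix U x).det with hq
  have hqc : Continuous q := h.continuous.div hJc fun x => (hJ x).ne'
  set ρ' : Torus n → ℝ := fun y => q (e.symm y) with hρ'
  have hρ'c : Continuous ρ' := hqc.comp e.symm.continuous
  have hρ'T : ∀ x, ρ' (perturbation U x) = q x := fun x => by
    rw [hρ', ← he]; simp
  have hd : HasPosDensity (μ.map (perturbation U)) ρ' := by
    refine ⟨hρ'c, fun y => div_pos (h.pos _) (hJ _), ?_⟩
    refine Measure.ext fun s hs => ?_
    rw [Measure.map_apply hTc.measurable hs, withDensity_apply _ hs, h.eq,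
      withDensity_apply _ (hTc.measurable hs), ← lintegral_indicator hs,
      ← lintegral_perturbation hU hL, ← lintegral_indicator (hTc.measurable hs)]
    · refine lintegral_congr fun x => ?_
      rw [abs_of_pos (hJ x)]
      by_cases hx : perturbation U x ∈ s
      · rw [Set.indicator_of_mem hx, Set.indicator_of_mem (show x ∈ perturbation U ⁻¹' s from hx),
          hρ'T, ← ENNReal.ofReal_mul (hJ x).le]
        congr 1
        rw [hq]
        field_simp [(hJ x).ne']
      · rw [Set.indicator_of_notMem hx,
          Set.indicator_of_notMem (show x ∉ perturbation U ⁻¹' s from hx), mul_zero]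
    · exact (ENNReal.continuous_ofReal.comp hρ'c).measurable.indicator hs
  refine ⟨⟨ρ', hd⟩, ?_⟩
  have := h.isFiniteMeasure
  rw [hd.entropy_eq, integral_map hTc.aemeasurable
    (hρ'c.log fun y => (hd.pos y).ne').aestronglyMeasurable, ← integral_sub
      (h.continuous.log fun x => (h.pos x).ne').integrable_of_compact
      (hJc.log fun x => (hJ x).ne').integrable_of_compact]
  congr 2
  funext x
  rw [hρ'T, hq, Real.log_div (h.pos x).ne' (hJ x).ne']

theorem hasPosDensity_gibbs {W : Torus n → ℝ} (hW : Continuous W) :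
    HasPosDensity (gibbs W) fun x => Real.exp (-W x) / ∫ x, Real.exp (-W x) :=
  ⟨by fun_prop, fun x => div_pos (Real.exp_pos _) (partition_pos hW), rfl⟩

/-- Comparison of `T_# m` with `m` for the density `ρ` of `m`. -/
theorem HasPosDensity.lintegral_map_le {μ : Measure (Torus n)} {ρ : Torus n → ℝ}
    (h : HasPosDensity μ ρ) {U : Torus n → Euc n} (hU : ∀ j, TorusContDiff 1 fun x => U x j)
    (hL : LipschitzWith (1 / 2) fun v : Euc n => U (toTorus v)) {a b : ℝ} (ha : 0 ≤ a)
    (hb : 0 ≤ b)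
    (hlow : ∀ x, a * (ρ (perturbation U x) * |(1 + jacobianMatrix U x).det|) ≤ ρ x)
    (hupp : ∀ x, ρ x ≤ b * (ρ (perturbation U x) * |(1 + jacobianMatrix U x).det|))
    {g : Torus n → ENNReal} (hg : Measurable g) :
    ENNReal.ofReal a * ∫⁻ x, g x ∂μ ≤ ∫⁻ x, g x ∂(μ.map (perturbation U)) ∧
      ∫⁻ x, g x ∂(μ.map (perturbation U)) ≤ ENNReal.ofReal b * ∫⁻ x, g x ∂μ := by
  have hTc := continuous_perturbation hU
  have hJc : Continuous fun x => (1 + jacobianMatrix U x).det :=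
    Continuous.matrix_det (continuous_const.add (continuous_jacobianMatrix hU))
  have hρm : Measurable fun x => ENNReal.ofReal (ρ x) :=
    (ENNReal.continuous_ofReal.comp h.continuous).measurable
  have e1 : ∫⁻ x, g x ∂(μ.map (perturbation U))
      = ∫⁻ x, ENNReal.ofReal (ρ x) * g (perturbation U x) := by
    rw [lintegral_map hg hTc.measurable, h.eq,
      lintegral_withDensity_eq_lintegral_mul (g := fun x => g (perturbation U x)) _ hρm
        (hg.comp hTc.measurable)]
    rfl
  have hFm : Measurable fun x => ENNReal.ofReal (ρ x) * g x := hρm.mul hg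
  -- Changing variables in the integral against `μ` puts `g ∘ T` in both integrals, so only their
  -- densities remain to be compared pointwise.
  have e2 : ∫⁻ x, g x ∂μ = ∫⁻ x, ENNReal.ofReal |(1 + jacobianMatrix U x).det|
      * (ENNReal.ofReal (ρ (perturbation U x)) * g (perturbation U x)) := by
    rw [lintegral_perturbation hU hL hFm, h.eq,
      lintegral_withDensity_eq_lintegral_mul _ hρm hg]
    rfl
  have e3 : ∀ c : ℝ, 0 ≤ c → ENNReal.ofReal c * ∫⁻ x, g x ∂μ
      = ∫⁻ x, ENNReal.ofReal (c * (ρ (perturbation U x) * |(1 + jacobianMatrix U x).det|))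
        * g (perturbation U x) := by
    intro c hc
    have hm : Measurable fun x => ENNReal.ofReal |(1 + jacobianMatrix U x).det|
      * (ENNReal.ofReal (ρ (perturbation U x)) * g (perturbation U x)) :=
      (ENNReal.continuous_ofReal.comp hJc.abs).measurable.mul (hFm.comp hTc.measurable)
    rw [e2, ← lintegral_const_mul _ hm]
    refine lintegral_congr fun x => ?_
    rw [ENNReal.ofReal_mul hc, ENNReal.ofReal_mul (h.pos _).le]
    ring
  rw [e1, e3 a ha, e3 b hb]
  exact ⟨lintegral_mono fun x => mul_le_mul_left (ENNReal.ofReal_le_ofReal (hlow x)) _,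
    lintegral_mono fun x => mul_le_mul_left (ENNReal.ofReal_le_ofReal (hupp x)) _⟩

end Perturbation

/-! ### Second variations along a vector field -/

section LogDet

variable {n : ℕ}

theorem hasDerivAt_det_one_add_smul_zero (B : Matrix (Fin n) (Fin n) ℝ) :
    HasDerivAt (fun s : ℝ => (1 + s • B).det) B.trace 0 := by
  have h1 : (fun s : ℝ => (1 + s • B).det) = fun s => 1 + B.trace * s +
      (Matrix.det (1 + (Polynomial.X : Polynomial ℝ) • B.map Polynomial.C)).divX.divX.eval s * s ^ 2 :=
    funext fun s => Matrix.det_one_add_smul s B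
  rw [h1]
  set q := (Matrix.det (1 + (Polynomial.X : Polynomial ℝ) • B.map Polynomial.C)).divX.divX
  have h2 := (((hasDerivAt_id (0 : ℝ)).const_mul B.trace).const_add 1).add
    ((q.hasDerivAt 0).mul ((hasDerivAt_id (0 : ℝ)).pow 2))
  refine h2.congr_deriv ?_
  simp

/-- Jacobi's formula: factoring out `1 + tA` moves the base point to the identity, where the
derivative of the determinant is the trace. -/
theorem hasDerivAt_det_one_add_smul {A : Matrix (Fin n) (Fin n) ℝ} {t : ℝ}
    (h : (1 + t • A).det ≠ 0) :
    HasDerivAt (fun s : ℝ => (1 + s • A).det)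
      ((1 + t • A).det * ((1 + t • A)⁻¹ * A).trace) t := by
  have hu : IsUnit (1 + t • A).det := isUnit_iff_ne_zero.2 h
  have h1 : (fun s : ℝ => (1 + s • A).det)
      = fun s => (1 + t • A).det * (1 + (s - t) • ((1 + t • A)⁻¹ * A)).det := by
    funext s
    rw [← Matrix.det_mul, mul_add, mul_one, mul_smul_comm, Matrix.mul_nonsing_inv_cancel_left _ _ hu,
      sub_smul]
    congr 1
    abel
  rw [h1]
  have h2 := (hasDerivAt_det_one_add_smul_zero ((1 + t • A)⁻¹ * A))
  rw [← sub_self t] at h2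
  exact (h2.comp_sub_const t t).const_mul _

theorem continuousAt_matrix_inv_of_det_ne_zero {A : Matrix (Fin n) (Fin n) ℝ} (h : A.det ≠ 0) :
    ContinuousAt (fun B : Matrix (Fin n) (Fin n) ℝ => B⁻¹) A := by
  refine continuousAt_matrix_inv A ?_
  rw [Ring.inverse_eq_inv']
  exact continuousAt_inv₀ h

/-- By the resolvent identity the difference quotient is exactly `-tr (Rₛ A Rₜ A)`, with `R` the
inverse; continuity of the inverse gives the limit. -/
theorem hasDerivAt_trace_resolvent {A : Matrix (Fin n) (Fin n) ℝ} {t : ℝ}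
    (h : (1 + t • A).det ≠ 0) :
    HasDerivAt (fun s : ℝ => ((1 + s • A)⁻¹ * A).trace)
      (-((1 + t • A)⁻¹ * A * ((1 + t • A)⁻¹ * A)).trace) t := by
  have hc : Continuous fun s : ℝ => 1 + s • A := by fun_prop
  have hR : ContinuousAt (fun s : ℝ => (1 + s • A)⁻¹) t :=
    ContinuousAt.comp (g := fun B : Matrix (Fin n) (Fin n) ℝ => B⁻¹)
      (continuousAt_matrix_inv_of_det_ne_zero h) hc.continuousAt
  have hlim : ContinuousAt (fun s : ℝ => -((1 + s • A)⁻¹ * A * ((1 + t • A)⁻¹ * A)).trace) t := by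
    have h1 : Continuous fun B : Matrix (Fin n) (Fin n) ℝ =>
        -(B * A * ((1 + t • A)⁻¹ * A)).trace := by fun_prop
    exact h1.continuousAt.comp hR
  rw [hasDerivAt_iff_tendsto_slope]
  refine (hlim.tendsto.mono_left nhdsWithin_le_nhds).congr' ?_
  have hne : ∀ᶠ s in 𝓝[≠] t, (1 + s • A).det ≠ 0 :=
    nhdsWithin_le_nhds ((hc.matrix_det.continuousAt).eventually_ne h)
  filter_upwards [hne, self_mem_nhdsWithin] with s hs hst
  have hst' : s - t ≠ 0 := sub_ne_zero.2 hst
  have hus : IsUnit (1 + s • A).det := isUnit_iff_ne_zero.2 hs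
  have hut : IsUnit (1 + t • A).det := isUnit_iff_ne_zero.2 h
  have key : (1 + s • A)⁻¹ - (1 + t • A)⁻¹ = -((s - t) • ((1 + s • A)⁻¹ * A * (1 + t • A)⁻¹)) := by
    have h1 : (1 + t • A) - (1 + s • A) = -((s - t) • A) := by
      rw [sub_smul]; abel
    calc (1 + s • A)⁻¹ - (1 + t • A)⁻¹
        = (1 + s • A)⁻¹ * ((1 + t • A) - (1 + s • A)) * (1 + t • A)⁻¹ := by
          rw [mul_sub, Matrix.nonsing_inv_mul _ hus, sub_mul, mul_assoc,
            Matrix.mul_nonsing_inv _ hut, mul_one, one_mul]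
      _ = _ := by rw [h1]; simp
  rw [slope_def_field, ← Matrix.trace_sub, ← sub_mul, key]
  simp only [neg_mul, smul_mul_assoc, Matrix.trace_neg, Matrix.trace_smul, smul_eq_mul, mul_assoc]
  field_simp

theorem continuousOn_resolvent {X : Type*} [TopologicalSpace X]
    {A : X → Matrix (Fin n) (Fin n) ℝ} (hA : Continuous A) {I : Set ℝ}
    (hI : ∀ t ∈ I, ∀ x, (1 + t • A x).det ≠ 0) :
    ContinuousOn (fun z : ℝ × X => (1 + z.1 • A z.2)⁻¹) (I ×ˢ Set.univ) := by
  intro z hz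
  have hc : Continuous fun z : ℝ × X => 1 + z.1 • A z.2 := by fun_prop
  exact (ContinuousAt.comp (f := fun z : ℝ × X => 1 + z.1 • A z.2) (x := z)
    (g := fun B : Matrix (Fin n) (Fin n) ℝ => B⁻¹)
    (continuousAt_matrix_inv_of_det_ne_zero (hI z.1 hz.1 z.2)) hc.continuousAt).continuousWithinAt

theorem hasDerivAt_integral_log_det {m : Measure (Torus n)} [IsFiniteMeasure m]
    {A : Torus n → Matrix (Fin n) (Fin n) ℝ} (hA : Continuous A) {r : ℝ} (hr : 0 < r)
    (hdet : ∀ t ∈ Set.Ioo (-r) r, ∀ x, 0 < (1 + t • A x).det) :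
    (∀ t ∈ Set.Ioo (-r) r, HasDerivAt (fun t => ∫ x, Real.log (1 + t • A x).det ∂m)
      (∫ x, ((1 + t • A x)⁻¹ * A x).trace ∂m) t) ∧
    HasDerivAt (fun t : ℝ => ∫ x, ((1 + t • A x)⁻¹ * A x).trace ∂m)
      (-∫ x, (A x * A x).trace ∂m) 0 := by
  have hres := continuousOn_resolvent hA fun t ht x => (hdet t ht x).ne'
  have hA2 : ContinuousOn (fun z : ℝ × Torus n => A z.2) (Set.Ioo (-r) r ×ˢ Set.univ) :=
    (hA.comp continuous_snd).continuousOn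
  have hRA : ContinuousOn (fun z : ℝ × Torus n => (1 + z.1 • A z.2)⁻¹ * A z.2)
      (Set.Ioo (-r) r ×ˢ Set.univ) :=
    (continuous_mul (M := Matrix (Fin n) (Fin n) ℝ)).comp_continuousOn (hres.prodMk hA2)
  have htr : ContinuousOn (fun z : ℝ × Torus n => ((1 + z.1 • A z.2)⁻¹ * A z.2).trace)
      (Set.Ioo (-r) r ×ˢ Set.univ) :=
    (Continuous.matrix_trace continuous_id).comp_continuousOn hRA
  have htr2 : ContinuousOn (fun z : ℝ × Torus n =>
      -((1 + z.1 • A z.2)⁻¹ * A z.2 * ((1 + z.1 • A z.2)⁻¹ * A z.2)).trace)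
      (Set.Ioo (-r) r ×ˢ Set.univ) :=
    ((Continuous.matrix_trace continuous_id).comp_continuousOn
      ((continuous_mul (M := Matrix (Fin n) (Fin n) ℝ)).comp_continuousOn (hRA.prodMk hRA))).neg
  constructor
  · intro t ht
    refine hasDerivAt_integral_of_compact (F := fun t x => Real.log (1 + t • A x).det)
      (F' := fun t x => ((1 + t • A x)⁻¹ * A x).trace) isOpen_Ioo ?_ htr ?_ ht
    · intro t ht
      exact Continuous.log (by fun_prop) fun x => (hdet t ht x).ne'
    · intro t ht x
      have h1 := (hasDerivAt_det_one_add_smul (hdet t ht x).ne').log (hdet t ht x).ne'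
      rwa [mul_div_cancel_left₀ _ (hdet t ht x).ne'] at h1
  · have h0 : (0 : ℝ) ∈ Set.Ioo (-r) r := by simp [hr]
    have h1 := hasDerivAt_integral_of_compact (m := m)
      (F := fun t x => ((1 + t • A x)⁻¹ * A x).trace)
      (F' := fun t x => -((1 + t • A x)⁻¹ * A x * ((1 + t • A x)⁻¹ * A x)).trace) isOpen_Ioo
      (fun t ht => htr.comp_continuous (f := fun x => (t, x)) (by fun_prop)
        (fun x => ⟨ht, Set.mem_univ _⟩)) htr2
      (fun t ht x => hasDerivAt_trace_resolvent (hdet t ht x).ne') h0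
    refine h1.congr_deriv ?_
    simp [integral_neg]

/-- The coefficient `c` allows two uses: first `c = 1` on `V`, then `c = Φⱼ` on `∂ⱼV`, since the
first derivative again has this form. -/
theorem hasDerivAt_integral_line {m : Measure (Torus n)} [IsFiniteMeasure m] {V : Torus n → ℝ}
    (hV : TorusContDiff 1 V) {Φ : Torus n → Euc n} (hΦ : Continuous Φ) {c : Torus n → ℝ}
    (hc : Continuous c) (t : ℝ) :
    HasDerivAt (fun t => ∫ x, c x * V (x + toTorus (t • Φ x)) ∂m)
      (∫ x, c x * ∑ i, Φ x i * torusPartial i V (x + toTorus (t • Φ x)) ∂m) t := by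
  have hp : ∀ i, Continuous (torusPartial i V) := hV.continuous_partial
  have hline : Continuous fun z : ℝ × Torus n => z.2 + toTorus (z.1 • Φ z.2) :=
    continuous_snd.add (continuous_toTorus.comp (continuous_fst.smul (hΦ.comp continuous_snd)))
  have hVc := hV.continuous
  refine hasDerivAt_integral_of_compact (U := Set.univ)
    (F := fun t x => c x * V (x + toTorus (t • Φ x)))
    (F' := fun t x => c x * ∑ i, Φ x i * torusPartial i V (x + toTorus (t • Φ x))) isOpen_univ
    (fun t _ => ?_) ?_ (fun t _ x => ?_) (Set.mem_univ t)
  · exact hc.mul (hVc.comp (hline.comp (by fun_prop : Continuous fun x => (t, x))))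
  · refine Continuous.continuousOn ((hc.comp continuous_snd).mul
      (continuous_finsetSum _ fun i _ => Continuous.mul ?_ ((hp i).comp hline)))
    have : Continuous fun x => Φ x i := by fun_prop
    exact this.comp continuous_snd
  · exact (hV.hasDerivAt_line x (Φ x) t).const_mul _

theorem hasDerivAt_integral_potential {m : Measure (Torus n)} [IsFiniteMeasure m]
    {V : Torus n → ℝ} (hV : TorusContDiff 2 V) {Φ : Torus n → Euc n} (hΦ : Continuous Φ) :
    ∃ g' : ℝ → ℝ, (∀ t, HasDerivAt (fun t => ∫ x, V (x + toTorus (t • Φ x)) ∂m) (g' t) t) ∧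
      HasDerivAt g' (∫ x, ∑ i, ∑ j, torusPartial i (torusPartial j V) x * Φ x i * Φ x j ∂m) 0 := by
  have hV1 : TorusContDiff 1 V := hV.of_le (by norm_num)
  have hVj : ∀ j, TorusContDiff 1 (torusPartial j V) := fun j => hV.partial (by norm_num) j
  have hΦj : ∀ j, Continuous fun x => Φ x j := fun j => by fun_prop
  have hline : ∀ t : ℝ, Continuous fun x => x + toTorus (t • Φ x) := fun t =>
    continuous_id.add (continuous_toTorus.comp (by fun_prop))
  refine ⟨fun t => ∑ j, ∫ x, Φ x j * torusPartial j V (x + toTorus (t • Φ x)) ∂m, fun t => ?_, ?_⟩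
  · have h1 := hasDerivAt_integral_line (m := m) hV1 hΦ (c := fun _ => 1) continuous_const t
    simp only [one_mul] at h1
    have hi : ∀ j, Integrable (fun x => Φ x j * torusPartial j V (x + toTorus (t • Φ x))) m :=
      fun j => ((hΦj j).mul ((hVj j).continuous.comp (hline t))).integrable_of_compact
    rwa [integral_finsetSum _ fun j _ => hi j] at h1
  · have h1 := HasDerivAt.fun_sum (u := Finset.univ) fun j _ =>
      hasDerivAt_integral_line (m := m) (hVj j) hΦ (hΦj j) 0
    refine h1.congr_deriv ?_
    have hWij : ∀ i j, Continuous (torusPartial i (torusPartial j V)) := fun i j =>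
      (hVj j).continuous_partial i
    simp only [zero_smul, toTorus_zero, add_zero]
    rw [← integral_finsetSum _ fun j _ => Continuous.integrable_of_compact (by fun_prop)]
    congr 1
    funext x
    simp_rw [Finset.mul_sum]
    rw [Finset.sum_comm]
    exact Finset.sum_congr rfl fun i _ => Finset.sum_congr rfl fun j _ => by ring

theorem jacobianMatrix_smul {U : Torus n → Euc n} (hU : ∀ j, TorusContDiff 1 fun x => U x j)
    (t : ℝ) (x : Torus n) : jacobianMatrix (fun x => t • U x) x = t • jacobianMatrix U x := by
  ext j i
  have h : TorusContDiff 1 (fun _ : Torus n => t) := contDiff_const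
  have h1 := torusPartial_mul h (hU j) i x
  have h0 : torusPartial i (fun _ : Torus n => t) x = 0 := by simp [torusPartial]
  simpa [jacobianMatrix, h0] using h1

/-- The potential energy contributes the Hessian of `V`. The entropy is a constant minus `∫ log
det(1 + tDΦ) dμ`, and the second derivative of `log det` at `0` is `-tr (DΦ)²`, whence the positive
trace term. -/
theorem exists_secondVariation {μ : Measure (Torus n)} {ρ : Torus n → ℝ}
    (h : HasPosDensity μ ρ) {Φ : Torus n → Euc n} (hΦ : ∀ j, TorusContDiff 1 fun x => Φ x j)
    {V : Torus n → ℝ} (hV : TorusContDiff 2 V) :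
    ∃ g g' : ℝ → ℝ, (∀ᶠ t in 𝓝 (0 : ℝ), ∃ s : ℝ, entropy (pushAlong μ Φ t) = (s : EReal) ∧
        g t = ∫ x, V x ∂(pushAlong μ Φ t) + s) ∧
      (∀ᶠ t in 𝓝 (0 : ℝ), HasDerivAt g (g' t) t) ∧
      HasDerivAt g' (∫ x, ((jacobianMatrix Φ x * jacobianMatrix Φ x).trace +
        ∑ i, ∑ j, torusPartial i (torusPartial j V) x * Φ x i * Φ x j) ∂μ) 0 := by
  have := h.isFiniteMeasure
  have hΦc := continuous_field hΦ
  have hAc := continuous_jacobianMatrix hΦ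
  obtain ⟨K, hK0, hK⟩ : ∃ K : ℝ, 0 < K ∧ ∀ i j x, |jacobianMatrix Φ x i j| ≤ K := by
    have h1 : ∀ q : Fin n × Fin n, ∃ K, ∀ x, |jacobianMatrix Φ x q.1 q.2| ≤ K := fun q => by
      obtain ⟨K, hK⟩ := isCompact_univ.exists_bound_of_continuousOn
        ((hΦ q.1).continuous_partial q.2).continuousOn
      exact ⟨K, fun x => hK x (Set.mem_univ x)⟩
    choose K hK using h1
    refine ⟨1 + ∑ q, |K q|, by positivity, fun i j x => (hK (i, j) x).trans ?_⟩
    have := Finset.single_le_sum (f := fun q => |K q|) (fun q _ => abs_nonneg _)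
      (Finset.mem_univ (i, j))
    linarith [le_abs_self (K (i, j))]
  obtain ⟨κ, hκ, hdet⟩ := exists_det_one_add_close n (ε := 1 / 2) (by norm_num)
  -- The first bound keeps the determinant within `1/2` of `1`; the second keeps `n² |t| K ≤ 1/2`,
  -- so that `tΦ` is a contraction and `id + tΦ` a bijection.
  set r : ℝ := min (κ / K) (1 / (2 * (n ^ 2 + 1) * K)) with hr
  have hr0 : 0 < r := by positivity
  have hsmall : ∀ t ∈ Set.Ioo (-r) r, ∀ i j x, |(t • jacobianMatrix Φ x) i j| ≤ |t| * K := by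
    intro t _ i j x
    rw [Matrix.smul_apply, smul_eq_mul, abs_mul]
    exact mul_le_mul_of_nonneg_left (hK i j x) (abs_nonneg _)
  have hpos : ∀ t ∈ Set.Ioo (-r) r, ∀ x, 0 < (1 + t • jacobianMatrix Φ x).det := by
    intro t ht x
    have h1 : |t| * K ≤ κ := by
      rw [← le_div_iff₀ hK0]
      exact ((abs_lt.2 ht).le).trans (min_le_left _ _)
    have h2 := hdet (t • jacobianMatrix Φ x) fun i j => (hsmall t ht i j x).trans h1
    linarith [(abs_le.1 h2).1]
  have hmem : ∀ᶠ t in 𝓝 (0 : ℝ), t ∈ Set.Ioo (-r) r := Ioo_mem_nhds (by linarith) hr0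
  obtain ⟨hL1, hL2⟩ := hasDerivAt_integral_log_det (m := μ) hAc hr0 hpos
  obtain ⟨p', hp1, hp2⟩ := hasDerivAt_integral_potential (m := μ) hV hΦc
  refine ⟨fun t => ∫ x, V (x + toTorus (t • Φ x)) ∂μ +
      (∫ x, Real.log (ρ x) ∂μ - ∫ x, Real.log (1 + t • jacobianMatrix Φ x).det ∂μ),
    fun t => p' t - ∫ x, ((1 + t • jacobianMatrix Φ x)⁻¹ * jacobianMatrix Φ x).trace ∂μ, ?_, ?_, ?_⟩
  · filter_upwards [hmem] with t ht
    have hUt : ∀ j, TorusContDiff 1 fun x => (t • Φ x) j := fun j =>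
      ContDiff.const_smul (R := ℝ) t (hΦ j)
    have h1 : |t| * K ≤ 1 / (2 * (n ^ 2 + 1)) := by
      rw [← le_div_iff₀ hK0, div_div]
      exact ((abs_lt.2 ht).le).trans (min_le_right _ _)
    have hL : LipschitzWith (1 / 2) fun v : Euc n => t • Φ (toTorus v) := by
      refine lipschitz_field (U := fun x => t • Φ x) (κ := |t| * K) (by positivity)
        ⟨hUt, fun i j x => ?_⟩ ?_
      · rw [jacobianMatrix_smul hΦ]
        exact hsmall t ht i j x
      · have h2 : (n : ℝ) ^ 2 * (|t| * K) ≤ n ^ 2 * (1 / (2 * (n ^ 2 + 1))) :=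
          mul_le_mul_of_nonneg_left h1 (by positivity)
        refine h2.trans ?_
        rw [mul_one_div, div_le_div_iff₀ (by positivity) (by norm_num)]
        nlinarith
    have h3 := (h.map_perturbation hUt hL (fun x => by
      rw [jacobianMatrix_smul hΦ]; exact hpos t ht x)).2
    simp only [jacobianMatrix_smul hΦ] at h3
    refine ⟨_, h3, ?_⟩
    have hpc : Continuous (perturbation fun x => t • Φ x) := continuous_perturbation hUt
    have hpush : pushAlong μ Φ t = μ.map (perturbation fun x => t • Φ x) := rfl
    rw [hpush, integral_map hpc.aemeasurable hV.continuous.aestronglyMeasurable]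
    rfl
  · filter_upwards [hmem] with t ht
    exact (hp1 t).add ((hL1 t ht).const_sub _)
  · refine (hp2.sub hL2).congr_deriv ?_
    rw [sub_neg_eq_add, add_comm, integral_add]
    · exact Continuous.integrable_of_compact (by fun_prop)
    · have hWij : ∀ i j, Continuous (torusPartial i (torusPartial j V)) := fun i j =>
        (hV.partial (k := 1) (by norm_num) j).continuous_partial i
      have hΦj : ∀ j, Continuous fun x => Φ x j := fun j => by fun_prop
      exact Continuous.integrable_of_compact (by fun_prop)

end LogDet

/-! ### Potentials -/

section Potential

variable {n : ℕ}

/-- `f ∈ C^k(𝕋ⁿ × 𝕋ⁿ)`. -/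
def JointContDiff (k : WithTop ℕ∞) (f : Torus n → Torus n → ℝ) : Prop :=
  ContDiff ℝ k (fun v : Euc n × Euc n => f (toTorus v.1) (toTorus v.2))

/-- The partial derivative in the first variable. -/
def partialLeft (i : Fin n) (f : Torus n → Torus n → ℝ) (x y : Torus n) : ℝ :=
  torusPartial i (fun x => f x y) x

theorem JointContDiff.continuous {k : WithTop ℕ∞} {f : Torus n → Torus n → ℝ}
    (h : JointContDiff k f) : Continuous fun z : Torus n × Torus n => f z.1 z.2 :=
  (isOpenQuotientMap_toTorus.prodMap isOpenQuotientMap_toTorus).isQuotientMap.continuous_iff.2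
    (ContDiff.continuous h)

theorem JointContDiff.left {k : WithTop ℕ∞} {f : Torus n → Torus n → ℝ}
    (h : JointContDiff k f) (y : Torus n) : TorusContDiff k fun x => f x y := by
  obtain ⟨w, rfl⟩ := toTorus_surjective y
  exact ContDiff.comp (g := fun v : Euc n × Euc n => f (toTorus v.1) (toTorus v.2)) h
    (contDiff_id.prodMk contDiff_const : ContDiff ℝ k fun v : Euc n => (v, w))

theorem JointContDiff.swap_neg {k : WithTop ℕ∞} {f : Torus n → Torus n → ℝ}
    (h : JointContDiff k f) : JointContDiff k fun y x => -f x y :=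
  (ContDiff.comp (g := fun v : Euc n × Euc n => f (toTorus v.1) (toTorus v.2)) h
    (contDiff_snd.prodMk contDiff_fst : ContDiff ℝ k fun v : Euc n × Euc n => (v.2, v.1))).neg

theorem JointContDiff.partialLeft {k l : WithTop ℕ∞} {f : Torus n → Torus n → ℝ}
    (h : JointContDiff l f) (hkl : k + 1 ≤ l) (i : Fin n) :
    JointContDiff k (partialLeft i f) := by
  have hd : Differentiable ℝ fun v : Euc n × Euc n => f (toTorus v.1) (toTorus v.2) :=
    ContDiff.differentiable h (by rintro rfl; simp at hkl)
  have h1 : (fun v : Euc n × Euc n => _root_.partialLeft i f (toTorus v.1) (toTorus v.2))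
      = fun v => fderiv ℝ (fun v : Euc n × Euc n => f (toTorus v.1) (toTorus v.2)) v
        (EuclideanSpace.single i 1, 0) := by
    funext v
    have h2 : HasFDerivAt (fun a : Euc n => f (toTorus a) (toTorus v.2))
        ((fderiv ℝ (fun v : Euc n × Euc n => f (toTorus v.1) (toTorus v.2)) v).comp
          (ContinuousLinearMap.inl ℝ (Euc n) (Euc n))) v.1 := by
      have h3 : HasFDerivAt (fun a : Euc n => (a, v.2)) (ContinuousLinearMap.inl ℝ (Euc n) (Euc n))
          v.1 := hasFDerivAt_prodMk_left v.1 v.2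
      exact HasFDerivAt.comp (g := fun v : Euc n × Euc n => f (toTorus v.1) (toTorus v.2)) v.1
        (hd v).hasFDerivAt h3
    exact torusPartial_toTorus (g := fun x => f x (toTorus v.2)) h2
  unfold JointContDiff
  rw [h1]
  exact (ContDiff.fderiv_right h hkl).clm_apply contDiff_const

theorem potential_contDiff_one {f : Torus n → Torus n → ℝ} (h : JointContDiff 1 f)
    (ν : Measure (Torus n)) [IsFiniteMeasure ν] :
    TorusContDiff 1 (fun x => ∫ y, f x y ∂ν) ∧
      ∀ i, torusPartial i (fun x => ∫ y, f x y ∂ν) = fun x => ∫ y, partialLeft i f x y ∂ν := by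
  have h1 := torusContDiff_one_integral (m := ν) (H := f) (u := fun _ => 1) h.continuous h.left
    (fun i => (h.partialLeft (k := 0) (by norm_num) i).continuous) (integrable_const _)
  simp only [mul_one] at h1
  exact h1

theorem potential_contDiff_two {f : Torus n → Torus n → ℝ} (h : JointContDiff 2 f)
    (ν : Measure (Torus n)) [IsFiniteMeasure ν] :
    TorusContDiff 2 (fun x => ∫ y, f x y ∂ν) ∧
      ∀ i j x, torusPartial i (torusPartial j fun x => ∫ y, f x y ∂ν) x
        = ∫ y, partialLeft i (partialLeft j f) x y ∂ν := by
  have h1 := potential_contDiff_one (h.of_le (by norm_num : (1 : WithTop ℕ∞) ≤ 2)) ν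
  have h2 := fun i => potential_contDiff_one (h.partialLeft (k := 1) (by norm_num) i) ν
  refine ⟨torusContDiff_succ (k := 1) h1.1 fun i => by rw [h1.2 i]; exact (h2 i).1,
    fun i j x => ?_⟩
  rw [h1.2 j, (h2 j).2 i]

theorem exists_bound_of_jointContinuous {f : Torus n → Torus n → ℝ}
    (h : Continuous fun z : Torus n × Torus n => f z.1 z.2) :
    ∃ B : ℝ, 0 ≤ B ∧ ∀ x y, |f x y| ≤ B := by
  obtain ⟨B, hB⟩ := isCompact_univ.exists_bound_of_continuousOn h.continuousOn
  exact ⟨B, (abs_nonneg _).trans (hB (0, 0) (Set.mem_univ _)),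
    fun x y => hB (x, y) (Set.mem_univ _)⟩

theorem abs_integral_le_of_abs_le {ν : Measure (Torus n)} [IsProbabilityMeasure ν]
    {g : Torus n → ℝ} {B : ℝ} (h : ∀ y, |g y| ≤ B) : |∫ y, g y ∂ν| ≤ B := by
  have := norm_integral_le_of_norm_le_const (μ := ν) (f := g) (C := B) (ae_of_all _ h)
  simpa using this

theorem exists_radius_of_jointContinuous {f : Torus n → Torus n → ℝ}
    (h : Continuous fun z : Torus n × Torus n => f z.1 z.2) {ε : ℝ} (hε : 0 < ε) :
    ∃ r : ℝ, 0 < r ∧ ∀ (v : Euc n), ‖v‖ ≤ r → ∀ x y,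
      |f (x + toTorus v) y - f x y| ≤ ε ∧ |f x (y + toTorus v) - f x y| ≤ ε := by
  obtain ⟨r, hr, hu⟩ := Metric.uniformContinuous_iff.1
    (CompactSpace.uniformContinuous_of_continuous h) ε hε
  refine ⟨r / 2, half_pos hr, fun v hv x y => ?_⟩
  have hd : ∀ x : Torus n, dist (x + toTorus v) x < r := fun x => by
    rw [dist_eq_norm, add_sub_cancel_left]
    exact ((norm_toTorus_le v).trans hv).trans_lt (half_lt_self hr)
  constructor
  · have := hu (a := (x + toTorus v, y)) (b := (x, y)) (by
      rw [Prod.dist_eq, dist_self]; exact max_lt (hd x) hr)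
    exact this.le
  · have := hu (a := (x, y + toTorus v)) (b := (x, y)) (by
      rw [Prod.dist_eq, dist_self]; exact max_lt hr (hd y))
    exact this.le

end Potential

/-! ### Equilibria are Gibbs measures -/

section Equilibrium

variable {n : ℕ}

theorem entropy_gibbs {W : Torus n → ℝ} (hW : Continuous W) :
    entropy (gibbs W)
      = ((-∫ x, W x ∂(gibbs W) - Real.log (∫ x, Real.exp (-W x)) : ℝ) : EReal) := by
  have hexp : Integrable (fun x => Real.exp (-W x)) (volume : Measure (Torus n)) :=
    (by fun_prop : Continuous fun x => Real.exp (-W x)).integrable_of_compact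
  have hp : IsProbabilityMeasure (gibbs W) := isProbabilityMeasure_tilted hexp
  rw [(hasPosDensity_gibbs hW).entropy_eq]
  congr 1
  have h1 : ∀ x, Real.log (Real.exp (-W x) / ∫ x, Real.exp (-W x))
      = -W x - Real.log (∫ x, Real.exp (-W x)) := fun x => by
    rw [Real.log_div (Real.exp_pos _).ne' (partition_pos hW).ne', Real.log_exp]
  simp_rw [h1]
  rw [integral_sub (by fun_prop : Continuous fun x => -W x).integrable_of_compact
    (integrable_const _), integral_neg]
  simp

theorem entropy_eq_coe_iff {m : Measure (Torus n)} {s : ℝ} (h : entropy m = (s : EReal)) :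
    m ≪ volume ∧ Integrable (llr m volume) m ∧ s = ∫ x, llr m volume x ∂m := by
  unfold entropy at h
  split_ifs at h with h1
  · exact ⟨h1.1, h1.2, (EReal.coe_injective h).symm⟩
  · exact absurd h (EReal.coe_ne_top s).symm

/-- Gibbs variational principle: `∫ W dm + H(m) = KL(m | gibbs W) - log Z`. Comparison with `gibbs
W` itself forces the divergence to vanish. Competitors of finite entropy suffice. -/
theorem eq_gibbs_of_minimal {m : Measure (Torus n)} [IsProbabilityMeasure m] {W : Torus n → ℝ}
    (hW : Continuous W) {s : ℝ} (hs : entropy m = (s : EReal))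
    (hmin : ∀ m' : Measure (Torus n), IsProbabilityMeasure m' → ∀ s' : ℝ,
      entropy m' = (s' : EReal) → ∫ x, W x ∂m + s ≤ ∫ x, W x ∂m' + s') :
    m = gibbs W := by
  have hexp : Integrable (fun x => Real.exp (-W x)) (volume : Measure (Torus n)) :=
    (by fun_prop : Continuous fun x => Real.exp (-W x)).integrable_of_compact
  have hp : IsProbabilityMeasure (gibbs W) := isProbabilityMeasure_tilted hexp
  obtain ⟨hac, hint, hsl⟩ := entropy_eq_coe_iff hs
  have h1 := hmin _ hp _ (entropy_gibbs hW)
  have hWm : Integrable (fun x => -W x) m := hW.neg.integrable_of_compact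
  have h2 := integral_llr_tilted_right hac hWm hexp hint
  rw [integral_neg, ← hsl] at h2
  have hac2 : m ≪ gibbs W := hac.trans (absolutelyContinuous_gibbs hW)
  have hint2 : Integrable (llr m (gibbs W)) m :=
    integrable_llr_tilted_right hac hWm hint hexp
  have h3 := InformationTheory.toReal_klDiv hac2 hint2
  simp only [probReal_univ, add_sub_cancel_right] at h3
  have h4 : (InformationTheory.klDiv m (gibbs W)).toReal = 0 := by
    refine le_antisymm ?_ ENNReal.toReal_nonneg
    rw [h3, h2]
    linarith
  rw [ENNReal.toReal_eq_zero_iff] at h4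
  exact InformationTheory.klDiv_eq_zero_iff.1
    (h4.resolve_right (InformationTheory.klDiv_ne_top hac2 hint2))

theorem entropy_volume : entropy (volume : Measure (Torus n)) = ((0 : ℝ) : EReal) := by
  have h : HasPosDensity (volume : Measure (Torus n)) fun _ => 1 :=
    ⟨continuous_const, fun _ => one_pos, by simp⟩
  rw [h.entropy_eq]
  simp

theorem entropy_eq_coe_or_top (m : Measure (Torus n)) :
    (∃ s : ℝ, entropy m = (s : EReal)) ∨ entropy m = ⊤ := by
  unfold entropy
  split_ifs with h
  · exact Or.inl ⟨_, rfl⟩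
  · exact Or.inr rfl

theorem payoff_of_entropy_eq {f : Torus n → Torus n → ℝ} {μ ν : Measure (Torus n)} {a b : ℝ}
    (ha : entropy μ = (a : EReal)) (hb : entropy ν = (b : EReal)) :
    payoff f μ ν = ((∫ x, ∫ y, f x y ∂ν ∂μ + a - b : ℝ) : EReal) := by
  rw [payoff, ha, hb]
  norm_cast

theorem IsMNE.exists_entropy_eq {f : Torus n → Torus n → ℝ} {μ ν : Measure (Torus n)}
    (h : IsMNE f μ ν) :
    ∃ a b : ℝ, entropy μ = (a : EReal) ∧ entropy ν = (b : EReal) := by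
  obtain ⟨hμ, hν, h1, h2⟩ := h
  rcases entropy_eq_coe_or_top ν with ⟨b, hb⟩ | hb
  · rcases entropy_eq_coe_or_top μ with ⟨a, ha⟩ | ha
    · exact ⟨a, b, ha, hb⟩
    · exfalso
      have h3 := h2 volume inferInstance
      rw [payoff_of_entropy_eq entropy_volume hb, payoff, ha, hb, EReal.coe_add_top,
        EReal.top_sub_coe, top_le_iff] at h3
      exact EReal.coe_ne_top _ h3
  · exfalso
    have h3 := h1 volume inferInstance
    rcases entropy_eq_coe_or_top μ with ⟨a, ha⟩ | ha
    · rw [payoff_of_entropy_eq ha entropy_volume, payoff, ha, hb, EReal.sub_top, le_bot_iff] at h3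
      exact EReal.coe_ne_bot _ h3
    -- With both entropies infinite, the convention `⊤ - ⊤ = ⊥` in `EReal` makes the payoff `⊥`, so
    -- the maximising player gains by deviating to Lebesgue measure.
    · rw [payoff, payoff, entropy_volume, ha, hb, EReal.coe_add_top, EReal.top_sub_coe,
        EReal.sub_top, le_bot_iff] at h3
      exact top_ne_bot h3

/-- With the opponent fixed, each player minimises a free energy up to a constant; for the
maximiser, Fubini and a change of sign bring the payoff to that form. -/
theorem IsMNE.eq_gibbs {f : Torus n → Torus n → ℝ} (hf : JointContDiff 2 f)
    {μ ν : Measure (Torus n)} (h : IsMNE f μ ν) :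
    μ = gibbs (fun x => ∫ y, f x y ∂ν) ∧ ν = gibbs (fun y => ∫ x, -f x y ∂μ) := by
  obtain ⟨a, b, ha, hb⟩ := h.exists_entropy_eq
  obtain ⟨hμ, hν, h1, h2⟩ := h
  have hfi : ∀ (m : Measure (Torus n)) [IsProbabilityMeasure m] (m' : Measure (Torus n))
      [IsProbabilityMeasure m'], ∫ x, ∫ y, f x y ∂m' ∂m = ∫ y, ∫ x, f x y ∂m ∂m' := by
    intro m _ m' _
    exact integral_integral_swap (f := f) (hf.continuous.integrable_of_compact)
  constructor
  · refine eq_gibbs_of_minimal (potential_contDiff_two hf ν).1.continuous ha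
      fun m' hm' s' hs' => ?_
    have h3 := h2 m' hm'
    rw [payoff_of_entropy_eq ha hb, payoff_of_entropy_eq hs' hb, EReal.coe_le_coe_iff] at h3
    linarith
  · refine eq_gibbs_of_minimal (potential_contDiff_two hf.swap_neg μ).1.continuous hb
      fun m' hm' s' hs' => ?_
    have h3 := h1 m' hm'
    rw [payoff_of_entropy_eq ha hb, payoff_of_entropy_eq ha hs', EReal.coe_le_coe_iff,
      hfi μ m', hfi μ ν] at h3
    simp_rw [integral_neg]
    linarith

end Equilibrium

/-! ### Gradients with a classical representative -/

section Gradient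

variable {n : ℕ}

theorem IsWeakGradient.congr {φ : Torus n → ℝ} {Φ Ψ : Torus n → Euc n} (h : IsWeakGradient φ Φ)
    (hΦ : Φ =ᵐ[volume] Ψ) : IsWeakGradient φ Ψ := fun i =>
  (h i).congr (EventuallyEq.refl _ _) (by filter_upwards [hΦ] with x hx; rw [hx])

theorem Continuous.memLp_torus {g : Torus n → ℝ} (hg : Continuous g) (p : ENNReal) :
    MemLp g p volume :=
  hg.memLp_of_hasCompactSupport (HasCompactSupport.of_compactSpace _)

/-- A weak gradient of class `C¹` has a symmetric Jacobian matrix, which is the weak Hessian of the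
potential. -/
theorem IsWeakGradient.memSobolev_two {φ : Torus n → ℝ} {Φ : Torus n → Euc n}
    (h : IsWeakGradient φ Φ) (hΦ : ∀ j, TorusContDiff 1 fun x => Φ x j) :
    MemSobolev 2 2 φ ∧ (∀ i, weakDeriv (Pi.single i 1) φ =ᵐ[volume] fun x => Φ x i) ∧
      (∀ i j, weakDeriv (Pi.single i 1 + Pi.single j 1) φ =ᵐ[volume]
        fun x => jacobianMatrix Φ x i j) ∧
      ∀ i j x, jacobianMatrix Φ x i j = jacobianMatrix Φ x j i := by
  have h2 : ∀ i j, HasWeakDeriv (Pi.single i 1 + Pi.single j 1) φ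
      fun x => jacobianMatrix Φ x i j := fun i j => (h i).single_add ((hΦ i).hasWeakDeriv j)
  have hJ : ∀ i j, Continuous fun x => jacobianMatrix Φ x i j := fun i j =>
    (hΦ i).continuous_partial j
  refine ⟨fun α hα => ?_, fun i => (h i).weakDeriv_ae, fun i j => (h2 i j).weakDeriv_ae,
    fun i j => ?_⟩
  · rcases mem_multiIndices_two hα with rfl | ⟨i, rfl⟩ | ⟨i, j, rfl⟩
    · rcases isEmpty_or_nonempty (Fin n) with hne | ⟨⟨i₀⟩⟩
      · have hs : Subsingleton (Torus n) := inferInstanceAs (Subsingleton (Fin n → UnitAddCircle))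
        have hc : Continuous φ := continuous_of_const fun x y => congrArg φ (Subsingleton.elim x y)
        exact ⟨φ, hasWeakDeriv_zero hc.integrable_of_compact, hc.memLp_torus _⟩
      -- The definition of a weak gradient gives only `φ ∈ L¹`. As the gradient is continuous,
      -- Morrey with exponent `n + 1` makes `φ` almost everywhere continuous, hence square
      -- integrable.
      obtain ⟨C, hC0, hC⟩ := exists_morrey_const n (p := n + 1) (by simp) (by simp)
      obtain ⟨U, hU, hφU, -⟩ := exists_continuous_rep (by simp) hC0 hC h (h i₀).1
        fun i => (hΦ i).continuous.memLp_torus _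
      exact ⟨φ, hasWeakDeriv_zero (h i₀).1, (memLp_congr_ae hφU).2 (hU.memLp_torus _)⟩
    · exact ⟨_, h i, (hΦ i).continuous.memLp_torus _⟩
    · exact ⟨_, h2 i j, (hJ i j).memLp_torus _⟩
  -- Symmetry of the Hessian: both entries are weak derivatives for the same multi-index, so they
  -- agree almost everywhere, and everywhere by continuity.
  · have h3 := h2 j i
    rw [add_comm] at h3
    exact congrFun ((Continuous.ae_eq_iff_eq volume (hJ i j) (hJ j i)).1 ((h2 i j).ae_unique h3))

end Gradient

/-! ### Small displacements -/

section Displacement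

variable {n : ℕ}

/-- The Sobolev embedding replaces the displacement by a `C¹`-small one off a null set. Only the
push-forward of `m` matters, and `m` does not charge null sets. -/
theorem exists_sobolev_radius {p : ℝ} (hp : 1 ≤ p) (hnp : (n : ℝ) < p) {κ : ℝ} (hκ : 0 < κ) :
    ∃ δ : ℝ, 0 < δ ∧ ∀ (m : Measure (Torus n)) (T : Torus n → Torus n), m ≪ volume →
      SobolevCloseToId p δ m T → ∃ U : Torus n → Euc n, DerivBounded κ U ∧ (∀ x, ‖U x‖ ≤ κ) ∧
        m.map T = m.map (perturbation U) := by
  obtain ⟨C, hC0, hC⟩ := exists_sobolev_embedding_const hp hnp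
  -- Each component is then at most `κ / (n + 1)`, and summing `n` of them keeps `‖U x‖ ≤ κ`.
  refine ⟨κ / (C * (n + 1)), by positivity, fun m T hm ⟨u, hT, hu, hle⟩ => ?_⟩
  obtain ⟨U, huU, hU, hb, hb'⟩ := hC u hu
  have h1 : C * sobolevNorm 2 p u ≤ κ / (n + 1) := by
    refine (mul_le_mul_of_nonneg_left hle hC0.le).trans_eq ?_
    field_simp
  have h2 : κ / (n + 1) ≤ κ := div_le_self hκ.le (by simp)
  refine ⟨U, ⟨hU, fun i j x => (hb' j i x).trans (h1.trans h2)⟩, fun x => ?_,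
    Measure.map_congr ?_⟩
  · refine (euclidean_norm_le_sum _).trans
      ((Finset.sum_le_sum fun j _ => (hb x j).trans h1).trans ?_)
    rw [Finset.sum_const, Finset.card_univ, Fintype.card_fin, nsmul_eq_mul, mul_div_assoc',
      div_le_iff₀ (by positivity)]
    nlinarith
  · filter_upwards [hT, hm.ae_le huU] with x hx hxU
    rw [hx, hxU, perturbation]

/-- The measures `m` and `m'` differ by a factor in `[1 - ε, (1 - ε)⁻¹]`. -/
def MeasureClose (ε : ℝ) (m m' : Measure (Torus n)) : Prop :=
  ∀ g : Torus n → ℝ, Continuous g → (∀ x, 0 ≤ g x) →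
    (1 - ε) * ∫ x, g x ∂m ≤ ∫ x, g x ∂m' ∧ (1 - ε) * ∫ x, g x ∂m' ≤ ∫ x, g x ∂m

/-- The density and the Jacobian each vary by about `ε / 2`. Upwards `e^{ε/2} · e^{ε/2}` is beaten
by `1 - ε ≤ e^{-ε}`; downwards `(1 - ε/2)² ≥ 1 - ε`. -/
theorem measureClose_gibbs {W : Torus n → ℝ} (hW : Continuous W) {U : Torus n → Euc n}
    (hU : ∀ j, TorusContDiff 1 fun x => U x j)
    (hL : LipschitzWith (1 / 2) fun v : Euc n => U (toTorus v)) {ε : ℝ} (hε : 0 < ε) (hε1 : ε < 1)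
    (hJ : ∀ x, |(1 + jacobianMatrix U x).det - 1| ≤ ε / 2)
    (hWU : ∀ x, |W (perturbation U x) - W x| ≤ ε / 2) :
    MeasureClose ε (gibbs W) ((gibbs W).map (perturbation U)) := by
  intro g hg hg0
  have hZ := partition_pos hW
  have hd := hasPosDensity_gibbs hW
  have := hd.isFiniteMeasure
  have hε' : 0 < 1 - ε := by linarith
  have hJ' : ∀ x, 1 - ε / 2 ≤ |(1 + jacobianMatrix U x).det| ∧
      |(1 + jacobianMatrix U x).det| ≤ 1 + ε / 2 := fun x => by
    have h1 := abs_le.1 (hJ x)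
    rw [abs_of_pos (by linarith : 0 < (1 + jacobianMatrix U x).det)]
    exact ⟨by linarith, by linarith⟩
  have key := hd.lintegral_map_le hU hL (a := 1 - ε) (b := (1 - ε)⁻¹) hε'.le
    (inv_nonneg.2 hε'.le) (fun x => ?_) (fun x => ?_)
    (ENNReal.continuous_ofReal.comp hg).measurable
  · simp only [Function.comp_def] at key
    have e1 := ofReal_integral_eq_lintegral_ofReal (μ := gibbs W) hg.integrable_of_compact
      (ae_of_all _ hg0)
    have e2 := ofReal_integral_eq_lintegral_ofReal (μ := (gibbs W).map (perturbation U))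
      hg.integrable_of_compact (ae_of_all _ hg0)
    have n1 : 0 ≤ ∫ x, g x ∂(gibbs W) := integral_nonneg hg0
    have n2 : 0 ≤ ∫ x, g x ∂((gibbs W).map (perturbation U)) := integral_nonneg hg0
    rw [← e1, ← e2, ← ENNReal.ofReal_mul hε'.le, ← ENNReal.ofReal_mul (inv_nonneg.2 hε'.le),
      ENNReal.ofReal_le_ofReal_iff n2, ENNReal.ofReal_le_ofReal_iff (by positivity)] at key
    exact ⟨key.1, (le_inv_mul_iff₀ hε').1 key.2⟩
  · have h1 : Real.exp (-W (perturbation U x)) ≤ Real.exp (-W x) * Real.exp (ε / 2) := by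
      rw [← Real.exp_add]
      exact Real.exp_le_exp.2 (by linarith [(abs_le.1 (hWU x)).1])
    have h2 : |(1 + jacobianMatrix U x).det| ≤ Real.exp (ε / 2) :=
      (hJ' x).2.trans (by linarith [Real.add_one_le_exp (ε / 2)])
    have h3 : 1 - ε ≤ Real.exp (-ε) := by linarith [Real.add_one_le_exp (-ε)]
    have h4 : (1 - ε) * (Real.exp (-W (perturbation U x)) * |(1 + jacobianMatrix U x).det|)
        ≤ Real.exp (-W x) := by
      calc _ ≤ Real.exp (-ε) * (Real.exp (-W x) * Real.exp (ε / 2) * Real.exp (ε / 2)) := by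
            gcongr
        _ = Real.exp (-W x) := by
            rw [← Real.exp_add, ← Real.exp_add, ← Real.exp_add]
            congr 1; ring
    rw [div_mul_eq_mul_div, mul_div_assoc']
    exact div_le_div_of_nonneg_right h4 hZ.le
  · have h1 : Real.exp (-W x) * (1 - ε / 2) ≤ Real.exp (-W (perturbation U x)) := by
      calc _ ≤ Real.exp (-W x) * Real.exp (-(ε / 2)) := by
            gcongr
            linarith [Real.add_one_le_exp (-(ε / 2))]
        _ ≤ _ := by
            rw [← Real.exp_add]
            exact Real.exp_le_exp.2 (by linarith [(abs_le.1 (hWU x)).2])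
    have h2 : (1 - ε) * Real.exp (-W x)
        ≤ Real.exp (-W (perturbation U x)) * |(1 + jacobianMatrix U x).det| := by
      calc _ ≤ Real.exp (-W x) * (1 - ε / 2) * (1 - ε / 2) := by
            nlinarith [Real.exp_pos (-W x), mul_nonneg (Real.exp_pos (-W x)).le (sq_nonneg ε)]
        _ ≤ _ := mul_le_mul h1 (hJ' x).1 (by linarith) (Real.exp_pos _).le
    rw [le_inv_mul_iff₀ hε', div_mul_eq_mul_div, mul_div_assoc']
    exact div_le_div_of_nonneg_right h2 hZ.le

end Displacement

/-! ### Lower bound of the second variation -/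

section LowerBound

variable {n : ℕ}

theorem abs_quadraticForm_le {a : Fin n → Fin n → ℝ} {M : ℝ} (ha : ∀ i j, |a i j| ≤ M)
    (v : Fin n → ℝ) : |∑ i, ∑ j, a i j * v i * v j| ≤ n * M * ∑ i, v i ^ 2 := by
  rcases isEmpty_or_nonempty (Fin n) with hne | ⟨⟨i₀⟩⟩
  · simp
  have hM : 0 ≤ M := (abs_nonneg _).trans (ha i₀ i₀)
  calc _ ≤ ∑ i, ∑ j, M * (|v i| * |v j|) := by
        refine (Finset.abs_sum_le_sum_abs _ _).trans (Finset.sum_le_sum fun i _ =>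
          (Finset.abs_sum_le_sum_abs _ _).trans (Finset.sum_le_sum fun j _ => ?_))
        rw [mul_assoc, abs_mul, abs_mul]
        exact mul_le_mul_of_nonneg_right (ha i j) (by positivity)
    _ = M * (∑ i, |v i|) ^ 2 := by
        rw [sq, Finset.sum_mul_sum, Finset.mul_sum]
        simp_rw [Finset.mul_sum]
    _ ≤ M * (n * ∑ i, |v i| ^ 2) := by
        gcongr
        simpa using sq_sum_le_card_mul_sum_sq (s := Finset.univ) (f := fun i => |v i|)
    _ = _ := by simp_rw [sq_abs]; ring

/-- Measures can be compared only on nonnegative integrands, so `n M |Φ|²`, which dominates the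
negative part of the Hessian term, is added first. One factor `1 - ε` is lost moving the form from
the Gibbs measure to `μ`, another moving `∫ |Φ|²` back; replacing `V` by `V'` costs `n θ`. -/
theorem le_secondVariation {V V' : Torus n → ℝ} (hn : 0 < n) (hV : TorusContDiff 2 V)
    (hV' : TorusContDiff 2 V') {M θ ε : ℝ} (hε : ε < 1)
    (hM : ∀ i j x, |torusPartial i (torusPartial j V) x| ≤ M)
    (hθ : ∀ i j x, |torusPartial i (torusPartial j V') x - torusPartial i (torusPartial j V) x| ≤ θ)
    {μ : Measure (Torus n)} [IsFiniteMeasure μ] (hμ : MeasureClose ε (gibbs V) μ)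
    {φ : Torus n → ℝ} {Φ : Torus n → Euc n} (h : IsWeakGradient φ Φ)
    (hΦ : ∀ j, TorusContDiff 1 fun x => Φ x j) :
    ((1 - ε) ^ 2 * (rayleighInf (gibbs V) V + n * M) - n * M - n * θ) * ∫ x, ∑ i, Φ x i ^ 2 ∂μ
      ≤ ∫ x, ((jacobianMatrix Φ x * jacobianMatrix Φ x).trace +
        ∑ i, ∑ j, torusPartial i (torusPartial j V') x * Φ x i * Φ x j) ∂μ := by
  obtain ⟨hφ, h1, h2, hsymm⟩ := h.memSobolev_two hΦ
  obtain ⟨B, hB⟩ := isCompact_univ.exists_bound_of_continuousOn hV.continuous.continuousOn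
  obtain ⟨hr, hray⟩ := le_rayleighInf_gibbs hn hV fun x => hB x (Set.mem_univ _)
  have hr0 : 0 ≤ rayleighInf (gibbs V) V := le_trans (by positivity) hr
  have hM0 : 0 ≤ M := (abs_nonneg _).trans (hM ⟨0, hn⟩ ⟨0, hn⟩ 0)
  have := (hasPosDensity_gibbs hV.continuous).isFiniteMeasure
  have hac := (hasPosDensity_gibbs hV.continuous).absolutelyContinuous
  replace hray := hray φ hφ
  set lam := rayleighInf (gibbs V) V
  have hΦc : ∀ i, Continuous fun x => Φ x i := fun i => (hΦ i).continuous
  have hJc : ∀ i j, Continuous fun x => jacobianMatrix Φ x i j := fun i j =>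
    (hΦ i).continuous_partial j
  have hVc : ∀ {W : Torus n → ℝ}, TorusContDiff 2 W → ∀ i j,
      Continuous (torusPartial i (torusPartial j W)) := fun hW i j =>
    (hW.partial (k := 1) (by norm_num) j).continuous_partial i
  have hVc1 := hVc hV
  have hVc2 := hVc hV'
  have htr : ∀ x, (jacobianMatrix Φ x * jacobianMatrix Φ x).trace
      = ∑ i, ∑ j, jacobianMatrix Φ x i j ^ 2 := fun x => by
    simp only [Matrix.trace, Matrix.diag, Matrix.mul_apply]
    exact Finset.sum_congr rfl fun i _ => Finset.sum_congr rfl fun j _ => by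
      rw [hsymm j i, sq]
  set q : Torus n → ℝ := fun x => ∑ i, Φ x i ^ 2 with hq
  have hqc : Continuous q := continuous_finsetSum _ fun i _ => (hΦc i).pow 2
  have hq0 : ∀ x, 0 ≤ q x := fun x => Finset.sum_nonneg fun i _ => sq_nonneg _
  set a : Torus n → ℝ := fun x => (∑ i, ∑ j, jacobianMatrix Φ x i j ^ 2) +
    ∑ i, ∑ j, torusPartial i (torusPartial j V) x * Φ x i * Φ x j with ha
  have hsq : Continuous fun x => ∑ i, ∑ j, jacobianMatrix Φ x i j ^ 2 :=
    continuous_finsetSum _ fun i _ => continuous_finsetSum _ fun j _ => (hJc i j).pow 2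
  have hquad : ∀ {w : Fin n → Fin n → Torus n → ℝ}, (∀ i j, Continuous (w i j)) →
      Continuous fun x => ∑ i, ∑ j, w i j x * Φ x i * Φ x j := fun hw =>
    continuous_finsetSum _ fun i _ => continuous_finsetSum _ fun j _ =>
      ((hw i j).mul (hΦc i)).mul (hΦc j)
  have hac' : Continuous a := hsq.add (hquad hVc1)
  set b : Torus n → ℝ := fun x => (jacobianMatrix Φ x * jacobianMatrix Φ x).trace +
    ∑ i, ∑ j, torusPartial i (torusPartial j V') x * Φ x i * Φ x j with hb
  have hbc : Continuous b := by
    simp only [hb, htr]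
    exact hsq.add (hquad hVc2)
  have hG0 : ∀ x, 0 ≤ a x + n * M * q x := fun x => by
    have h3 := (abs_le.1 (abs_quadraticForm_le (hM · · x) fun i => Φ x i)).1
    have h4 : 0 ≤ ∑ i, ∑ j, jacobianMatrix Φ x i j ^ 2 :=
      Finset.sum_nonneg fun i _ => Finset.sum_nonneg fun j _ => sq_nonneg _
    simp only [ha, hq]
    linarith
  have hab : ∀ x, a x + n * M * q x ≤ b x + (n * M + n * θ) * q x := fun x => by
    have h3 := (abs_le.1 (abs_quadraticForm_le (hθ · · x) fun i => Φ x i)).1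
    simp only [sub_mul, Finset.sum_sub_distrib] at h3
    simp only [ha, hb, hq, htr]
    linarith
  have hHess : hessianForm (gibbs V) V φ = ∫ x, a x ∂(gibbs V) := by
    refine integral_congr_ae (hac.ae_le ?_)
    filter_upwards [ae_all_iff.2 h1, ae_all_iff.2 fun i => ae_all_iff.2 (h2 i)] with x hx1 hx2
    simp only [hx1, hx2, ha]
  have hgrad : ∫ x, ∑ i, weakDeriv (Pi.single i 1) φ x ^ 2 ∂(gibbs V) = ∫ x, q x ∂(gibbs V) := by
    refine integral_congr_ae (hac.ae_le ?_)
    filter_upwards [ae_all_iff.2 h1] with x hx1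
    simp only [hx1, hq]
  rw [hHess, hgrad] at hray
  have k1 := (hμ (fun x => a x + n * M * q x) (hac'.add (hqc.const_mul _)) hG0).1
  have k2 := (hμ q hqc hq0).2
  have k3 : ∫ x, (a x + n * M * q x) ∂μ ≤ ∫ x, (b x + (n * M + n * θ) * q x) ∂μ :=
    integral_mono (hac'.add (hqc.const_mul _)).integrable_of_compact
      (hbc.add (hqc.const_mul _)).integrable_of_compact hab
  rw [integral_add hbc.integrable_of_compact (hqc.integrable_of_compact.const_mul _),
    integral_const_mul] at k3
  rw [integral_add hac'.integrable_of_compact (hqc.integrable_of_compact.const_mul _),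
    integral_const_mul] at k1
  have k4 : (1 - ε) * ((lam + n * M) * ((1 - ε) * ∫ x, q x ∂μ))
      ≤ (1 - ε) * (∫ x, a x ∂(gibbs V) + n * M * ∫ x, q x ∂(gibbs V)) := by
    refine mul_le_mul_of_nonneg_left ?_ (by linarith)
    refine (mul_le_mul_of_nonneg_left k2 (by positivity)).trans ?_
    linarith
  calc _ = (1 - ε) * ((lam + n * M) * ((1 - ε) * ∫ x, q x ∂μ))
        - (n * M + n * θ) * ∫ x, q x ∂μ := by ring
    _ ≤ _ := by linarith

end LowerBound

/-! ### Stability of the lower bound near an equilibrium -/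

section Stability

variable {n : ℕ}

theorem pushAlong_congr {μ : Measure (Torus n)} {Φ Ψ : Torus n → Euc n} (h : Φ =ᵐ[μ] Ψ) (t : ℝ) :
    pushAlong μ Φ t = pushAlong μ Ψ t :=
  Measure.map_congr (by filter_upwards [h] with x hx; rw [hx])

theorem exists_forall_fin_pos {P : Fin n → Fin n → ℝ → Prop}
    (hP : ∀ i j, ∃ r, 0 < r ∧ P i j r) (hmono : ∀ i j r r', r' ≤ r → P i j r → P i j r') :
    ∃ r, 0 < r ∧ ∀ i j, P i j r := by
  choose r hr hPr using hP
  rcases isEmpty_or_nonempty (Fin n) with hne | hne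
  · exact ⟨1, one_pos, fun i => hne.elim i⟩
  obtain ⟨q, -, hq⟩ := Finset.exists_min_image (Finset.univ : Finset (Fin n × Fin n))
    (fun q => r q.1 q.2) Finset.univ_nonempty
  exact ⟨r q.1 q.2, hr _ _, fun i j => hmono i j _ _ (hq (i, j) (Finset.mem_univ _)) (hPr i j)⟩

theorem exists_bound_partialLeft {f : Torus n → Torus n → ℝ} (hf : JointContDiff 2 f) :
    ∃ M : ℝ, 0 ≤ M ∧ ∀ i j x y, |partialLeft i (partialLeft j f) x y| ≤ M := by
  have hc : ∀ i j, Continuous fun z : Torus n × Torus n =>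
      partialLeft i (partialLeft j f) z.1 z.2 := fun i j =>
    ((hf.partialLeft (k := 1) (by norm_num) j).partialLeft (k := 0) (by norm_num) i).continuous
  choose B hB0 hB using fun i j => exists_bound_of_jointContinuous (hc i j)
  refine ⟨∑ i, ∑ j, B i j, Finset.sum_nonneg fun i _ => Finset.sum_nonneg fun j _ => hB0 i j,
    fun i j x y => (hB i j x y).trans ?_⟩
  exact (Finset.single_le_sum (f := fun j => B i j) (fun j _ => hB0 i j) (Finset.mem_univ j)).trans
    (Finset.single_le_sum (f := fun i => ∑ j, B i j)
      (fun i _ => Finset.sum_nonneg fun j _ => hB0 i j) (Finset.mem_univ i))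

theorem exists_radius_partialLeft {f : Torus n → Torus n → ℝ} (hf : JointContDiff 2 f) {θ : ℝ}
    (hθ : 0 < θ) : ∃ r : ℝ, 0 < r ∧ ∀ i j (v : Euc n), ‖v‖ ≤ r → ∀ x y,
      |partialLeft i (partialLeft j f) x (y + toTorus v) - partialLeft i (partialLeft j f) x y|
        ≤ θ := by
  refine exists_forall_fin_pos (P := fun i j r => ∀ v : Euc n, ‖v‖ ≤ r → ∀ x y,
    |partialLeft i (partialLeft j f) x (y + toTorus v) - partialLeft i (partialLeft j f) x y| ≤ θ)
    (fun i j => ?_) fun i j r r' hr h v hv => h v (hv.trans hr)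
  obtain ⟨r, hr, h⟩ := exists_radius_of_jointContinuous
    ((hf.partialLeft (k := 1) (by norm_num) j).partialLeft (k := 0) (by norm_num) i).continuous hθ
  exact ⟨r, hr, fun v hv x y => (h v hv x y).2⟩

theorem abs_integral_sub_integral_le {ν : Measure (Torus n)} [IsProbabilityMeasure ν]
    {g h : Torus n → ℝ} (hg : Continuous g) (hh : Continuous h) {θ : ℝ}
    (hgh : ∀ y, |g y - h y| ≤ θ) : |∫ y, g y ∂ν - ∫ y, h y ∂ν| ≤ θ := by
  rw [← integral_sub hg.integrable_of_compact hh.integrable_of_compact]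
  exact abs_integral_le_of_abs_le hgh

/-- The entropic second variation near a Gibbs equilibrium, for one player. -/
theorem exists_radius_secondVariation (hn : 0 < n) {f : Torus n → Torus n → ℝ}
    (hf : JointContDiff 2 f) {η : ℝ} (hη : 0 < η) (hη1 : η ≤ 1) {p : ℝ} (hp : (n : ℝ) < p) :
    ∃ δ₀ : ℝ, 0 < δ₀ ∧ ∀ δ ≤ δ₀, ∀ μs νs : Measure (Torus n), IsProbabilityMeasure νs →
      νs ≪ volume → μs = gibbs (fun x => ∫ y, f x y ∂νs) →
      0 < rayleighInf μs (fun x => ∫ y, f x y ∂νs) ∧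
      ∀ T S : Torus n → Torus n, SobolevCloseToId p δ μs T → SobolevCloseToId p δ νs S →
        (∃ ρ, HasPosDensity (μs.map T) ρ) ∧ IsProbabilityMeasure (μs.map T) ∧
        ∀ (φ : Torus n → ℝ) (Φ : Torus n → Euc n), IsWeakGradient φ Φ → MemSobolev 2 p Φ →
          ∃ (D : ℝ) (g g' : ℝ → ℝ),
            (∀ᶠ t in 𝓝 (0 : ℝ), ∃ s : ℝ, entropy (pushAlong (μs.map T) Φ t) = (s : EReal) ∧
              IsProbabilityMeasure (pushAlong (μs.map T) Φ t) ∧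
              g t = ∫ x, ∫ y, f x y ∂(νs.map S) ∂(pushAlong (μs.map T) Φ t) + s) ∧
            (∀ᶠ t in 𝓝 (0 : ℝ), HasDerivAt g (g' t) t) ∧ HasDerivAt g' D 0 ∧
            (1 - η) * rayleighInf μs (fun x => ∫ y, f x y ∂νs) * ∫ x, ‖Φ x‖ ^ 2 ∂(μs.map T)
              ≤ D := by
  have hn' : (0 : ℝ) < n := by exact_mod_cast hn
  have hp1 : 1 ≤ p := le_trans (by exact_mod_cast hn) hp.le
  obtain ⟨B, hB0, hB⟩ := exists_bound_of_jointContinuous hf.continuous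
  obtain ⟨M, hM0, hM⟩ := exists_bound_partialLeft hf
  -- A lower bound for the Rayleigh infimum at every equilibrium, known from `f` alone; all
  -- tolerances are measured against it.
  set c := (n * Real.exp (2 * B))⁻¹ with hc
  have hc0 : 0 < c := by positivity
  -- Chosen so that `2 ε (λ + n M) ≤ η λ / 4` for every `λ ≥ c`. Together with the loss `n θ ≤ η λ /
  -- 2` from the Hessians this stays below `η λ`.
  set ε := η * c / (8 * (c + n * M)) with hε
  have hε0 : 0 < ε := by positivity
  have hε1 : ε < 1 := by
    rw [hε, div_lt_one (by positivity)]
    nlinarith [mul_nonneg hn'.le hM0]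
  set θ := η * c / (2 * n) with hθ
  have hθ0 : 0 < θ := by positivity
  obtain ⟨r₁, hr₁, hf₁⟩ := exists_radius_of_jointContinuous hf.continuous (half_pos hε0)
  obtain ⟨r₂, hr₂, hf₂⟩ := exists_radius_partialLeft hf hθ0
  obtain ⟨r₃, hr₃, hdet⟩ := exists_det_one_add_close n (half_pos hε0)
  -- In order: the density of the Gibbs measure moves little, the Hessian of the opponent's
  -- potential moves little, the Jacobian is near `1`, and the displacement is a contraction.
  set κ := min (min r₁ r₂) (min r₃ (1 / (2 * n ^ 2))) with hκ
  have hκ0 : 0 < κ := lt_min (lt_min hr₁ hr₂) (lt_min hr₃ (by positivity))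
  have hκ1 : κ ≤ r₁ := (min_le_left _ _).trans (min_le_left _ _)
  have hκ2 : κ ≤ r₂ := (min_le_left _ _).trans (min_le_right _ _)
  have hκ3 : κ ≤ r₃ := (min_le_right _ _).trans (min_le_left _ _)
  have hκ4 : n ^ 2 * κ ≤ 1 / 2 := by
    have h1 : κ ≤ 1 / (2 * n ^ 2) := (min_le_right _ _).trans (min_le_right _ _)
    calc (n : ℝ) ^ 2 * κ ≤ n ^ 2 * (1 / (2 * n ^ 2)) := by gcongr
      _ = 1 / 2 := by field_simp
  obtain ⟨δ₀, hδ₀, hclose⟩ := exists_sobolev_radius hp1 hp hκ0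
  refine ⟨δ₀, hδ₀, fun δ hδ μs νs hνs hνac hμs => ?_⟩
  replace hclose : ∀ (m : Measure (Torus n)) (T : Torus n → Torus n), m ≪ volume →
      SobolevCloseToId p δ m T → ∃ U : Torus n → Euc n, DerivBounded κ U ∧ (∀ x, ‖U x‖ ≤ κ) ∧
        m.map T = m.map (perturbation U) := fun m T hm ⟨u, h1, h2, h3⟩ =>
    hclose m T hm ⟨u, h1, h2, h3.trans hδ⟩
  set V : Torus n → ℝ := fun x => ∫ y, f x y ∂νs with hVdef
  obtain ⟨hV, hVp⟩ := potential_contDiff_two hf νs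
  have hfc : ∀ x, Continuous (f x) := fun x => hf.continuous.comp (by fun_prop : Continuous (x, ·))
  have hray := (le_rayleighInf_gibbs hn hV fun x => abs_integral_le_of_abs_le (hB x)).1
  have hdens := hasPosDensity_gibbs hV.continuous
  have hprob : IsProbabilityMeasure (gibbs V) := isProbabilityMeasure_tilted
    (by have := hV.continuous; fun_prop : Continuous fun x => Real.exp (-V x)).integrable_of_compact
  subst hμs
  set lam := rayleighInf (gibbs V) V with hlam
  refine ⟨hc0.trans_le hray, fun T S hT hS => ?_⟩
  obtain ⟨U, hU, hUκ, hTU⟩ := hclose _ T hdens.absolutelyContinuous hT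
  obtain ⟨U', hU', hUκ', hSU⟩ := hclose _ S hνac hS
  rw [hTU, hSU]
  have hL := lipschitz_field hκ0.le hU hκ4
  have hJ : ∀ x, |(1 + jacobianMatrix U x).det - 1| ≤ ε / 2 := fun x =>
    hdet _ fun i j => (hU.2 i j x).trans hκ3
  obtain ⟨⟨ρ, hρ⟩, -⟩ := hdens.map_perturbation hU.1 hL fun x => by
    linarith [(abs_le.1 (hJ x)).1]
  have hTc := continuous_perturbation hU.1
  have hSc := continuous_perturbation hU'.1
  have hμp : IsProbabilityMeasure ((gibbs V).map (perturbation U)) :=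
    Measure.isProbabilityMeasure_map hTc.measurable.aemeasurable
  have hνp : IsProbabilityMeasure (νs.map (perturbation U')) :=
    Measure.isProbabilityMeasure_map hSc.measurable.aemeasurable
  refine ⟨⟨ρ, hρ⟩, hμp, fun φ Φ hφ hΦ => ?_⟩
  have hmc : MeasureClose ε (gibbs V) ((gibbs V).map (perturbation U)) :=
    measureClose_gibbs hV.continuous hU.1 hL hε0 hε1 hJ fun x =>
      abs_integral_sub_integral_le (hfc _) (hfc _) fun y =>
        (hf₁ (U x) ((hUκ x).trans hκ1) x y).1
  set μ := (gibbs V).map (perturbation U) with hμ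
  set ν := νs.map (perturbation U') with hν
  obtain ⟨hV', hVp'⟩ := potential_contDiff_two hf ν
  have hpc : ∀ i j x, Continuous (partialLeft i (partialLeft j f) x) := fun i j x =>
    ((hf.partialLeft (k := 1) (by norm_num) j).partialLeft (k := 0)
      (by norm_num) i).continuous.comp (by fun_prop : Continuous (x, ·))
  have hdiff : ∀ i j x, |torusPartial i (torusPartial j fun x => ∫ y, f x y ∂ν) x
      - torusPartial i (torusPartial j V) x| ≤ θ := fun i j x => by
    rw [hVp', hVp, hν, integral_map hSc.measurable.aemeasurable
      (hpc i j x).aestronglyMeasurable]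
    exact abs_integral_sub_integral_le ((hpc i j x).comp hSc) (hpc i j x) fun y =>
      hf₂ i j (U' y) ((hUκ' y).trans hκ2) x y
  have hMV : ∀ i j x, |torusPartial i (torusPartial j V) x| ≤ M := fun i j x => by
    rw [hVp]
    exact abs_integral_le_of_abs_le (hM i j x)
  -- The test field is replaced by its `C¹` representative. The push-forwards do not change, since
  -- `μ` has a density.
  obtain ⟨C, -, hC⟩ := exists_sobolev_embedding_const hp1 hp
  obtain ⟨Ψ, hΦΨ, hΨ, -⟩ := hC Φ hΦ
  have hΦΨμ : Φ =ᵐ[μ] Ψ := hρ.absolutelyContinuous.ae_le hΦΨ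
  have hlow := le_secondVariation hn hV hV' hε1 hMV hdiff hmc (hφ.congr hΦΨ) hΨ
  obtain ⟨g, g', h1, h2, h3⟩ := exists_secondVariation hρ hΨ hV'
  refine ⟨_, g, g', ?_, h2, h3, le_trans ?_ hlow⟩
  · filter_upwards [h1] with t ht
    rw [pushAlong_congr hΦΨμ]
    obtain ⟨s, hs, hg⟩ := ht
    exact ⟨s, hs, Measure.isProbabilityMeasure_map (continuous_id.add (continuous_toTorus.comp
      ((continuous_field hΨ).const_smul t))).measurable.aemeasurable, hg⟩
  · have hint : ∫ x, ‖Φ x‖ ^ 2 ∂μ = ∫ x, ∑ i, Ψ x i ^ 2 ∂μ := by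
      refine integral_congr_ae ?_
      filter_upwards [hΦΨμ] with x hx
      rw [hx, EuclideanSpace.real_norm_sq_eq]
    rw [hint]
    refine mul_le_mul_of_nonneg_right ?_
      (integral_nonneg fun x => Finset.sum_nonneg fun i _ => sq_nonneg _)
    have hlam0 : 0 < lam := hc0.trans_le hray
    have hnθ : n * θ ≤ η * lam / 2 := by
      have : n * θ = η * c / 2 := by rw [hθ]; field_simp
      rw [this]
      gcongr
    -- As `c ≤ lam`, the ratio `(lam + n M) / (c + n M)` is at most `lam / c`.
    have hεK : ε * (lam + n * M) ≤ η * lam / 8 := by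
      rw [hε, div_mul_eq_mul_div, div_le_div_iff₀ (by positivity) (by norm_num)]
      have h4 : c * (n * M) ≤ lam * (n * M) := by gcongr
      nlinarith [mul_le_mul_of_nonneg_left h4 hη.le]
    have h5 : 0 ≤ ε ^ 2 * (lam + n * M) := by positivity
    nlinarith [mul_pos hη hlam0]

end Stability

end

/-! ### Both players together -/

theorem lemma3p2 (n : ℕ) (hn : 0 < n) (f : Torus n → Torus n → ℝ)
    (hf : ContDiff ℝ 2 (fun v : Euc n × Euc n => f (toTorus v.1) (toTorus v.2)))
    (η : ℝ) (hη : 0 < η) (p : ℝ) (hp : (n : ℝ) < p) :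
    ∃ δ : ℝ, 0 < δ ∧ ∀ μs νs : Measure (Torus n), IsMNE f μs νs →
      0 < spectralGap f μs νs ∧
      ∀ (μ ν : Measure (Torus n)) (T S : Torus n → Torus n),
        IsOptimalMap μs μ T → IsOptimalMap νs ν S →
        SobolevCloseToId p δ μs T → SobolevCloseToId p δ νs S →
        (∀ (φ : Torus n → ℝ) (Φ : Torus n → Euc n),
          IsWeakGradient φ Φ → MemSobolev 2 p Φ →
          ∃ D : ℝ, HasSecondDerivAtZero (fun t => payoff f (pushAlong μ Φ t) ν) D ∧
            (1 - η) * spectralGap f μs νs * ∫ x, ‖Φ x‖ ^ 2 ∂μ ≤ D) ∧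
        (∀ (ψ : Torus n → ℝ) (Ψ : Torus n → Euc n),
          IsWeakGradient ψ Ψ → MemSobolev 2 p Ψ →
          ∃ D : ℝ, HasSecondDerivAtZero (fun t => payoff f μ (pushAlong ν Ψ t)) D ∧
            D ≤ -((1 - η) * spectralGap f μs νs * ∫ y, ‖Ψ y‖ ^ 2 ∂ν)) := by
  have hf' : JointContDiff 2 f := hf
  -- Passing from the gap to the larger Rayleigh infimum of one player needs a nonnegative factor;
  -- for `η > 1` the estimate with factor `0` is stronger than the one required.
  set η' := min η 1 with hη'
  have hη0 : 0 < η' := lt_min hη one_pos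
  have hη1 : η' ≤ 1 := min_le_right _ _
  obtain ⟨δ₁, hδ₁, h₁⟩ := exists_radius_secondVariation hn hf' hη0 hη1 hp
  -- The maximising player minimises in the game with payoff `-f` and exchanged variables.
  obtain ⟨δ₂, hδ₂, h₂⟩ := exists_radius_secondVariation hn hf'.swap_neg hη0 hη1 hp
  refine ⟨min δ₁ δ₂, lt_min hδ₁ hδ₂, fun μs νs hmne => ?_⟩
  obtain ⟨hμg, hνg⟩ := hmne.eq_gibbs hf'
  obtain ⟨hμs, hνs, -, -⟩ := hmne
  have hμac : μs ≪ volume := by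
    rw [hμg]
    exact (hasPosDensity_gibbs (potential_contDiff_two hf' νs).1.continuous).absolutelyContinuous
  have hνac : νs ≪ volume := by
    rw [hνg]
    exact (hasPosDensity_gibbs
      (potential_contDiff_two hf'.swap_neg μs).1.continuous).absolutelyContinuous
  obtain ⟨hpos₁, k₁⟩ := h₁ _ (min_le_left _ _) μs νs hνs hνac hμg
  obtain ⟨hpos₂, k₂⟩ := h₂ _ (min_le_right _ _) νs μs hμs hμac hνg
  have hgap : spectralGap f μs νs = min (rayleighInf μs fun x => ∫ y, f x y ∂νs)
      (rayleighInf νs fun y => ∫ x, -f x y ∂μs) := by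
    simp only [spectralGap, integral_neg]
  have hgap0 : 0 < spectralGap f μs νs := by
    rw [hgap]; exact lt_min hpos₁ hpos₂
  have hle : ∀ {r I D : ℝ}, spectralGap f μs νs ≤ r → 0 ≤ I → (1 - η') * r * I ≤ D →
      (1 - η) * spectralGap f μs νs * I ≤ D := fun {r I D} hr hI hD => by
    refine le_trans (mul_le_mul_of_nonneg_right ?_ hI) hD
    calc (1 - η) * spectralGap f μs νs ≤ (1 - η') * spectralGap f μs νs :=
          mul_le_mul_of_nonneg_right (by linarith [min_le_left η 1]) hgap0.le
      _ ≤ (1 - η') * r := mul_le_mul_of_nonneg_left hr (by linarith)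
  refine ⟨hgap0, ?_⟩
  rintro μ ν T S ⟨-, rfl, -⟩ ⟨-, rfl, -⟩ hT hS
  obtain ⟨⟨ρ, hρ⟩, hμp, k₁⟩ := k₁ T S hT hS
  obtain ⟨⟨ρ', hρ'⟩, hνp, k₂⟩ := k₂ S T hS hT
  constructor
  · intro φ Φ hφ hΦ
    obtain ⟨D, g, g', e, d, d', hD⟩ := k₁ φ Φ hφ hΦ
    -- The opponent's entropy is a finite constant in `t`, so it shifts `g` without changing its
    -- derivatives.
    refine ⟨D, ⟨fun t => g t - ∫ x, Real.log (ρ' x) ∂(νs.map S), g', ?_, ?_, d'⟩,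
      hle (hgap ▸ min_le_left _ _) (integral_nonneg fun x => sq_nonneg _) hD⟩
    · filter_upwards [e] with t ⟨s, hs, _, hg⟩
      rw [payoff_of_entropy_eq hs hρ'.entropy_eq, hg]
    · filter_upwards [d] with t ht
      exact ht.sub_const _
  · intro ψ Ψ hψ hΨ
    obtain ⟨D, g, g', e, d, d', hD⟩ := k₂ ψ Ψ hψ hΨ
    refine ⟨-D, ⟨fun t => ∫ x, Real.log (ρ x) ∂(μs.map T) - g t, fun t => -g' t, ?_, ?_, d'.neg⟩,
      neg_le_neg (hle (hgap ▸ min_le_right _ _) (integral_nonneg fun x => sq_nonneg _) hD)⟩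
    · filter_upwards [e] with t ⟨s, hs, _, hg⟩
      -- Here `g` is the free energy for `-f` with the variables exchanged; Fubini identifies the
      -- payoff with a constant minus `g`.
      rw [payoff_of_entropy_eq hρ.entropy_eq hs, hg,
        integral_integral_swap (f := f) hf'.continuous.integrable_of_compact]
      simp_rw [integral_neg]
      congr 1
      ring
    · filter_upwards [d] with t ht
      exact ht.const_sub _
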